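/- **Conventions.** Let $k$ be an algebraically closed field of characteristic $0$. Algebras, coalgebras and modules over $k$ are finite-dimensional, $\mathrm{Vec}$ is the category of finite-dimensional $k$-vector spaces, and functors and equivalences between $k$-linear categories are $k$-linear. A $k$-linear category is *finite* if it is equivalent to the category $\mathrm{Rep}(B)$ of finite-dimensional left modules over a finite-dimensional algebra $B$. A *finite multi-tensor category* is a finite $k$-linear rigid monoidal category with $k$-bilinear tensor product. A *separable Frobenius functor* $F:\mathcal C\to\mathcal D$ between monoidal categories is a functor with a lax monoidal structure $F_2: F(X)\otimes F(Y)\to F(X\otimes Y)$, $F_0:\mathbf 1\to F(\mathbf 1)$ and an oplax monoidal structure $F_{-2}:F(X\otimes Y)\to F(X)\otimes F(Y)$, $F_{-0}:F(\mathbf 1)\to\mathbf 1$ such that (suppressing associators), for all $X,Y,Z$, $$(1\otimes F_2)(F_{-2}\otimes 1)=F_{-2}F_2: F(X\otimes Y)\otimes F(Z)\to F(X)\otimes F(Y\otimes Z),$$ $$(F_2\otimes 1)(1\otimes F_{-2})=F_{-2}F_2: F(X)\otimes F(Y\otimes Z)\to F(X\otimes Y)\otimes F(Z),$$ and $F_2F_{-2}=\mathrm{id}_{F(X\otimes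 Y)}$. An isomorphism of separable Frobenius functors is a natural isomorphism compatible with $F_2,F_0,F_{-2},F_{-0}$. A *weak fiber functor* $(\mathcal D,F)$ is a finite multi-tensor category $\mathcal D$ with a faithful exact separable Frobenius functor $F:\mathcal D\to\mathrm{Vec}$. Two weak fiber functors $(\mathcal D,F)$, $(\mathcal E,G)$ are *equivalent* if there is a monoidal equivalence $\Phi:\mathcal D\to\mathcal E$ with $G\Phi\cong F$ as separable Frobenius functors. A *weak Hopf algebra* is an algebra $A$ with a coalgebra structure $(\Delta,\epsilon)$ and a linear map $S:A\to A$ such that, for all $x,y,z\in A$ (in Sweedler notation), $\Delta(xy)=\Delta(x)\Delta(y)$; $\epsilon(xy_{(1)})\epsilon(y_{(2)}z)=\epsilon(xyz)=\epsilon(xy_{(2)})\epsilon(y_{(1)}z)$; $1_{(1)}\otimes1_{(2)}1_{(1')}\otimes1_{(2')}=1_{(1)}\otimes1_{(2)}\otimes1_{(3)}=1_{(1)}\otimes1_{(1')}1_{(2)}\otimes1_{(2')}$; $x_{(1)}S(x_{(2)})=\epsilon(1_{(1)}x)1_{(2)}$, $S(x_{(1)})x_{(2)}=1_{(1)}\epsilon(x1_{(2)})$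 and $S(x_{(1)})x_{(2)}S(x_{(3)})=S(x)$. An isomorphism of weak Hopf algebras is a linear bijection preserving multiplication, unit, comultiplication and counit. For a weak Hopf algebra $A$ put $\epsilon^{lr}(x)=\epsilon(1_{(1)}x)1_{(2)}$, $\epsilon^{rr}(x)=1_{(1)}\epsilon(1_{(2)}x)$ and $A^l=\epsilon^{lr}(A)$. The category $\mathrm{Rep}(A)$ is monoidal as follows. The tensor product $V\boxtimes W$ is the image of the idempotent $v\otimes w\mapsto 1_{(1)}v\otimes1_{(2)}w$ on $V\otimes W$, with action $x(v\otimes w)=x_{(1)}v\otimes x_{(2)}w$. The unit is $A^l$, with action $x\otimes y\mapsto\epsilon^{lr}(xy)$. The associator is the canonical map between retracts of the triple tensor product, and the unitors are the restrictions of $y\otimes v\mapsto yv$ and $v\otimes y\mapsto\epsilon^{rr}(y)v$. The forgetful functor $F^A:\mathrm{Rep}(A)\to\mathrm{Vec}$ has as $F^A_2$ the retraction and as $F^A_{-2}$ the inclusion given by this idempotent, $F^A_0(1)=1_A$, and $F^A_{-0}=\epsilon|_{A^l}$. For a weak fiber functor $(\mathcal D,F)$, let $\mathrm{End}(F)$ be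 the algebra of natural endomorphisms of $F$, with $\Delta$, $\epsilon$, $S$ given as follows: - $\Delta(\alpha)$ is the element of $\mathrm{End}(F)\otimes\mathrm{End}(F)$ with $J(\Delta(\alpha))_{X,Y}=F_{-2}\circ\alpha_{X\otimes Y}\circ F_2$ for all $X,Y$, where $J(\alpha\otimes\beta)_{X,Y}=\alpha_X\otimes\beta_Y$; - $\epsilon(\alpha)=(F_{-0}\circ\alpha_{\mathbf 1}\circ F_0)(1)$; - $S(\alpha)_X=(1\otimes\mathrm{Ev})(1\otimes\alpha_{X^L}\otimes1)(\mathrm{Coev}\otimes1)$, where $X^L$ is a left dual of $X$, with maps $\mathrm{ev}:X^L\otimes X\to\mathbf 1$ and $\mathrm{coev}:\mathbf 1\to X\otimes X^L$, and $\mathrm{Ev}=F_{-0}F(\mathrm{ev})F_2$, $\mathrm{Coev}=F_{-2}F(\mathrm{coev})F_0$. The comparison functor $\widetilde F:\mathcal D\to\mathrm{Rep}(\mathrm{End}(F))$ sends $X$ to $F(X)$ with the action $\alpha\otimes v\mapsto\alpha_X(v)$. **Theorem.** 1. For every weak fiber functor $(\mathcal D,F)$, the algebra $\mathrm{End}(F)$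 is finite-dimensional, $\Delta,\epsilon,S$ are well defined (uniquely determined by the formulas above, for every choice of left duals), and $(\mathrm{End}(F),\Delta,\epsilon,S)$ is a weak Hopf algebra. 2. For every weak Hopf algebra $A$, the category $\mathrm{Rep}(A)$ is a finite multi-tensor category, $F^A$ is a weak fiber functor on it, and $A\cong\mathrm{End}(F^A)$ as weak Hopf algebras. 3. For every weak fiber functor $(\mathcal D,F)$, the comparison functor $\widetilde F:\mathcal D\to\mathrm{Rep}(\mathrm{End}(F))$ is a monoidal equivalence, for a strong monoidal structure with $F^{\mathrm{End}(F)}\circ\widetilde F=F$ strictly, as separable Frobenius functors. 4. Isomorphism of weak Hopf algebras and equivalence of weak fiber functors are equivalence relations. The assignment $A\mapsto(\mathrm{Rep}(A),F^A)$ sends isomorphic weak Hopf algebras to equivalent weak fiber functors, and $(\mathcal D,F)\mapsto\mathrm{End}(F)$ sends equivalent weak fiber functors to isomorphic weak Hopf algebras. They induce mutually inverse bijections between the isomorphism classes of weak Hopf algebras and the equivalence classes of weak fiber functors. -/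

import Mathlib

open CategoryTheory MonoidalCategory
open scoped TensorProduct

universe u v w v' w'

set_option linter.unusedSectionVars false

/-- A weak bialgebra over `k`: an algebra and coalgebra with multiplicative (not necessarily unital)
comultiplication and weakened compatibility of the counit and of the unit. -/
class WeakBialgebra (k : Type u) (A : Type w) [Field k] [Ring A] [Algebra k A] extends
    Coalgebra k A where
  /-- `Δ(x) Δ(y) = Δ(xy)` -/
  comul_mul : ∀ x y : A, comul (x * y) = comul x * comul y
  /-- `ε(x y₍₁₎) ε(y₍₂₎ z) = ε(xyz)` -/
  counit_mul_left : ∀ x y z : A,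
    LinearMap.mul' k k (TensorProduct.map (counit ∘ₗ LinearMap.mulLeft k x)
      (counit ∘ₗ LinearMap.mulRight k z) (comul y)) = counit (x * y * z)
  /-- `ε(y₍₁₎ z) ε(x y₍₂₎) = ε(xyz)` -/
  counit_mul_right : ∀ x y z : A,
    LinearMap.mul' k k (TensorProduct.map (counit ∘ₗ LinearMap.mulRight k z)
      (counit ∘ₗ LinearMap.mulLeft k x) (comul y)) = counit (x * y * z)
  /-- `1₍₁₎ ⊗ 1₍₂₎ 1₍₁'₎ ⊗ 1₍₂'₎ = 1₍₁₎ ⊗ 1₍₂₎ ⊗ 1₍₃₎` -/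
  comul_one_left :
    TensorProduct.assoc k A A A (comul (1 : A) ⊗ₜ[k] (1 : A)) *
      ((1 : A) ⊗ₜ[k] comul (1 : A)) =
        LinearMap.lTensor A comul (comul (1 : A))
  /-- `1₍₁₎ ⊗ 1₍₁'₎ 1₍₂₎ ⊗ 1₍₂'₎ = 1₍₁₎ ⊗ 1₍₂₎ ⊗ 1₍₃₎` -/
  comul_one_right :
    ((1 : A) ⊗ₜ[k] comul (1 : A)) *
      TensorProduct.assoc k A A A (comul (1 : A) ⊗ₜ[k] (1 : A)) =
        LinearMap.lTensor A comul (comul (1 : A))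

namespace WeakBialgebra

section
variable (k : Type u) (A : Type w) [Field k] [Ring A] [Algebra k A] [CoalgebraStruct k A]

/-- `a ⊗ b ↦ ε(a) b` -/
def cL : A ⊗[k] A →ₗ[k] A :=
  (TensorProduct.lid k A).toLinearMap ∘ₗ LinearMap.rTensor A CoalgebraStruct.counit

/-- `a ⊗ b ↦ a ε(b)` -/
def cR : A ⊗[k] A →ₗ[k] A :=
  (TensorProduct.rid k A).toLinearMap ∘ₗ LinearMap.lTensor A CoalgebraStruct.counit

/-- `εˡʳ(x) = ε(1₍₁₎ x) 1₍₂₎` -/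
def epsLR : A →ₗ[k] A :=
  cL k A ∘ₗ LinearMap.mulLeft k (CoalgebraStruct.comul (R := k) (1 : A)) ∘ₗ
    (TensorProduct.mk k A A).flip 1

/-- `εʳʳ(x) = 1₍₁₎ ε(1₍₂₎ x)` -/
def epsRR : A →ₗ[k] A :=
  cR k A ∘ₗ LinearMap.mulLeft k (CoalgebraStruct.comul (R := k) (1 : A)) ∘ₗ
    TensorProduct.mk k A A 1

/-- `1₍₁₎ ε(x 1₍₂₎)` -/
def epsRL : A →ₗ[k] A :=
  cR k A ∘ₗ LinearMap.mulRight k (CoalgebraStruct.comul (R := k) (1 : A)) ∘ₗ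
    TensorProduct.mk k A A 1

end

section
variable {k : Type u} {A : Type w} [Field k] [Ring A] [Algebra k A]

@[simp] lemma cL_tmul [CoalgebraStruct k A] (a b : A) :
    cL k A (a ⊗ₜ b) = CoalgebraStruct.counit (R := k) a • b := by simp [cL]
@[simp] lemma cR_tmul [CoalgebraStruct k A] (a b : A) :
    cR k A (a ⊗ₜ b) = CoalgebraStruct.counit (R := k) b • a := by simp [cR]
lemma epsLR_apply [CoalgebraStruct k A] (a : A) : epsLR k A a =
    cL k A (CoalgebraStruct.comul (R := k) (1 : A) * a ⊗ₜ 1) := rfl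
lemma epsRR_apply [CoalgebraStruct k A] (a : A) : epsRR k A a =
    cR k A (CoalgebraStruct.comul (R := k) (1 : A) * 1 ⊗ₜ a) := rfl
lemma epsRL_apply [CoalgebraStruct k A] (a : A) : epsRL k A a =
    cR k A (1 ⊗ₜ a * CoalgebraStruct.comul (R := k) (1 : A)) := rfl

variable [WeakBialgebra k A]

open CoalgebraStruct

lemma cL_comul (a : A) : cL k A (comul (R := k) a) = a := by
  simp [cL, Coalgebra.rTensor_counit_comul]
lemma cR_comul (a : A) : cR k A (comul (R := k) a) = a := by
  simp [cR, Coalgebra.lTensor_counit_comul]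

lemma comul_one_mul (a : A) : comul (R := k) (1 : A) * comul (R := k) a = comul (R := k) a := by
  rw [← comul_mul, one_mul]
lemma comul_mul_one (a : A) : comul (R := k) a * comul (R := k) (1 : A) = comul (R := k) a := by
  rw [← comul_mul, mul_one]

/-- `a ⊗ b ⊗ c ↦ f(a) g(b) c` -/
def c3L (f g : A →ₗ[k] k) : A ⊗[k] (A ⊗[k] A) →ₗ[k] A :=
  (TensorProduct.lid k A).toLinearMap ∘ₗ
    TensorProduct.map f ((TensorProduct.lid k A).toLinearMap ∘ₗ LinearMap.rTensor A g)

@[simp] lemma c3L_tmul (f g : A →ₗ[k] k) (a b c : A) :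
    c3L f g (a ⊗ₜ (b ⊗ₜ c)) = (f a * g b) • c := by
  simp [c3L, smul_smul, mul_comm]

/-- `a ⊗ b ⊗ c ↦ a f(b) g(c)` -/
def c3R (f g : A →ₗ[k] k) : A ⊗[k] (A ⊗[k] A) →ₗ[k] A :=
  (TensorProduct.rid k A).toLinearMap ∘ₗ
    LinearMap.lTensor A (LinearMap.mul' k k ∘ₗ TensorProduct.map f g)

@[simp] lemma c3R_tmul (f g : A →ₗ[k] k) (a b c : A) :
    c3R f g (a ⊗ₜ (b ⊗ₜ c)) = (f b * g c) • a := by simp [c3R, mul_smul]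

lemma c3L_assoc (f g : A →ₗ[k] k) (t : A ⊗[k] A) (c : A) :
    c3L f g (TensorProduct.assoc k A A A (t ⊗ₜ c)) =
      LinearMap.mul' k k (TensorProduct.map f g t) • c := by
  induction t with
  | zero => simp
  | tmul a b => simp
  | add x y hx hy => simp only [TensorProduct.add_tmul, map_add, hx, hy, add_smul]

lemma c3R_tmul' (f g : A →ₗ[k] k) (t : A ⊗[k] A) (a : A) :
    c3R f g (a ⊗ₜ t) = LinearMap.mul' k k (TensorProduct.map f g t) • a := by
  simp [c3R]

lemma coassoc' (z : A) : TensorProduct.assoc k A A A (LinearMap.rTensor A comul (comul (R := k) z))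
    = LinearMap.lTensor A comul (comul (R := k) z) := Coalgebra.coassoc_apply z

/-- `ε(a z₁ x) z₂ y = ε(a z₁) ε(z₂ x) z₃ y` -/
lemma auxL (a z x : A) : cL k A (a ⊗ₜ 1 * comul (R := k) z * x ⊗ₜ 1) =
    c3L (counit ∘ₗ LinearMap.mulLeft k a) (counit ∘ₗ LinearMap.mulRight k x)
      (LinearMap.lTensor A comul (comul (R := k) z)) := by
  rw [← coassoc']
  generalize comul (R := k) z = t
  induction t with
  | zero => simp
  | tmul p q =>
    rw [LinearMap.rTensor_tmul, c3L_assoc, counit_mul_left]; simp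
  | add x y hx hy => simp only [map_add, ← hx, ← hy, mul_add, add_mul]

lemma auxL' (a z x : A) : cL k A (a ⊗ₜ 1 * comul (R := k) z * x ⊗ₜ 1) =
    c3L (counit ∘ₗ LinearMap.mulRight k x) (counit ∘ₗ LinearMap.mulLeft k a) 
      (LinearMap.lTensor A comul (comul (R := k) z)) := by
  rw [← coassoc']
  generalize comul (R := k) z = t
  induction t with
  | zero => simp
  | tmul p q =>
    rw [LinearMap.rTensor_tmul, c3L_assoc, counit_mul_right]; simp
  | add x y hx hy => simp only [map_add, ← hx, ← hy, mul_add, add_mul]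

lemma auxR (a z x : A) : cR k A (1 ⊗ₜ a * comul (R := k) z * 1 ⊗ₜ x) =
    c3R (counit ∘ₗ LinearMap.mulLeft k a) (counit ∘ₗ LinearMap.mulRight k x)
      (LinearMap.lTensor A comul (comul (R := k) z)) := by
  generalize comul (R := k) z = t
  induction t with
  | zero => simp
  | tmul p q =>
    rw [LinearMap.lTensor_tmul, c3R_tmul', counit_mul_left]; simp
  | add x y hx hy => simp only [map_add, ← hx, ← hy, mul_add, add_mul]

lemma auxR' (a z x : A) : cR k A (1 ⊗ₜ a * comul (R := k) z * 1 ⊗ₜ x) =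
    c3R (counit ∘ₗ LinearMap.mulRight k x) (counit ∘ₗ LinearMap.mulLeft k a)
      (LinearMap.lTensor A comul (comul (R := k) z)) := by
  generalize comul (R := k) z = t
  induction t with
  | zero => simp
  | tmul p q =>
    rw [LinearMap.lTensor_tmul, c3R_tmul', counit_mul_right]; simp
  | add x y hx hy => simp only [map_add, ← hx, ← hy, mul_add, add_mul]


lemma cL_mul_left (c : A) (s : A ⊗[k] A) : cL k A (1 ⊗ₜ c * s) = c * cL k A s := by
  induction s with
  | zero => simp
  | tmul p q => simp
  | add x y hx hy => simp only [map_add, mul_add, hx, hy]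

lemma cL_mul_right (c : A) (s : A ⊗[k] A) : cL k A (s * 1 ⊗ₜ c) = cL k A s * c := by
  induction s with
  | zero => simp
  | tmul p q => simp
  | add x y hx hy => simp only [map_add, add_mul, hx, hy]

lemma cR_mul_left (c : A) (s : A ⊗[k] A) : cR k A (c ⊗ₜ 1 * s) = c * cR k A s := by
  induction s with
  | zero => simp
  | tmul p q => simp
  | add x y hx hy => simp only [map_add, mul_add, hx, hy]

lemma cR_mul_right (c : A) (s : A ⊗[k] A) : cR k A (s * c ⊗ₜ 1) = cR k A s * c := by
  induction s with
  | zero => simp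
  | tmul p q => simp
  | add x y hx hy => simp only [map_add, add_mul, hx, hy]

lemma epsLR_one : epsLR k A 1 = 1 := by
  rw [epsLR_apply, ← Algebra.TensorProduct.one_def, mul_one, cL_comul]

lemma epsRR_one : epsRR k A 1 = 1 := by
  rw [epsRR_apply, ← Algebra.TensorProduct.one_def, mul_one, cR_comul]

/-- `ε(x εˡʳ(z)) = ε(x z)` -/
lemma counit_mul_epsLR (x z : A) :
    counit (R := k) (x * epsLR k A z) = counit (R := k) (x * z) := by
  have h := counit_mul_right (k := k) x 1 z
  rw [mul_one] at h
  rw [← h, epsLR_apply]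
  generalize comul (R := k) (1 : A) = t
  induction t with
  | zero => simp
  | tmul p q => simp
  | add x y hx hy => simp only [map_add, mul_add, add_mul, hx, hy]

/-- `ε(x εʳʳ(z)) = ε(x z)` -/
lemma counit_mul_epsRR (x z : A) :
    counit (R := k) (x * epsRR k A z) = counit (R := k) (x * z) := by
  have h := counit_mul_left (k := k) x 1 z
  rw [mul_one] at h
  rw [← h, epsRR_apply]
  generalize comul (R := k) (1 : A) = t
  induction t with
  | zero => simp
  | tmul p q => simp [mul_comm]
  | add x y hx hy => simp only [map_add, mul_add, add_mul, hx, hy]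

lemma counit_epsLR (z : A) : counit (R := k) (epsLR k A z) = counit (R := k) z := by
  simpa using counit_mul_epsLR (k := k) 1 z

lemma counit_epsRR (z : A) : counit (R := k) (epsRR k A z) = counit (R := k) z := by
  simpa using counit_mul_epsRR (k := k) 1 z

lemma cL_congr (s : A ⊗[k] A) (z z' : A)
    (h : ∀ x, counit (R := k) (x * z) = counit (R := k) (x * z')) :
    cL k A (s * z ⊗ₜ 1) = cL k A (s * z' ⊗ₜ 1) := by
  induction s with
  | zero => simp
  | tmul p q => simp [h]
  | add x y hx hy => simp only [map_add, add_mul, hx, hy]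

lemma cR_congr (s : A ⊗[k] A) (z z' : A)
    (h : ∀ x, counit (R := k) (x * z) = counit (R := k) (x * z')) :
    cR k A (s * 1 ⊗ₜ z) = cR k A (s * 1 ⊗ₜ z') := by
  induction s with
  | zero => simp
  | tmul p q => simp [h]
  | add x y hx hy => simp only [map_add, add_mul, hx, hy]

/-- `εˡʳ(x εˡʳ(z)) = εˡʳ(x z)` -/
lemma epsLR_mul_epsLR (x z : A) : epsLR k A (x * epsLR k A z) = epsLR k A (x * z) :=
  cL_congr _ _ _ fun y => by rw [← mul_assoc, counit_mul_epsLR, mul_assoc]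

lemma epsLR_idem (z : A) : epsLR k A (epsLR k A z) = epsLR k A z := by
  simpa using epsLR_mul_epsLR (k := k) 1 z

lemma epsLR_mul_epsRR (x z : A) : epsLR k A (x * epsRR k A z) = epsLR k A (x * z) :=
  cL_congr _ _ _ fun y => by rw [← mul_assoc, counit_mul_epsRR, mul_assoc]

lemma epsRR_epsLR (z : A) : epsRR k A (epsLR k A z) = epsRR k A z :=
  cR_congr _ _ _ fun y => counit_mul_epsLR y z

lemma auxKL (t : A ⊗[k] A) (z a : A) : cL k A (t * comul (R := k) z * a ⊗ₜ 1) =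
    TensorProduct.lid k A (TensorProduct.map (counit ∘ₗ LinearMap.mulRight k a)
      (cL k A ∘ₗ LinearMap.mulLeft k t ∘ₗ comul) (comul (R := k) z)) := by
  induction t with
  | zero =>
    simp only [zero_mul, map_zero]
    generalize comul (R := k) z = s
    induction s with
    | zero => simp
    | tmul p q => simp
    | add x y hx hy => rw [map_add, map_add, ← hx, ← hy, add_zero]
  | tmul b c =>
    have : b ⊗ₜ[k] c * comul (R := k) z * a ⊗ₜ 1 =
        1 ⊗ₜ c * (b ⊗ₜ 1 * comul (R := k) z * a ⊗ₜ 1) := by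
      simp only [← mul_assoc, Algebra.TensorProduct.tmul_mul_tmul, one_mul, mul_one]
    rw [this, cL_mul_left, auxL']
    generalize comul (R := k) z = s
    induction s with
    | zero => simp
    | tmul p q =>
      simp only [LinearMap.lTensor_tmul, TensorProduct.map_tmul, LinearMap.comp_apply,
        TensorProduct.lid_tmul]
      rw [show b ⊗ₜ[k] c = 1 ⊗ₜ c * b ⊗ₜ 1 by simp, LinearMap.mulLeft_apply, mul_assoc, cL_mul_left]
      generalize comul (R := k) q = r
      induction r with
      | zero => simp
      | tmul r1 r2 => simp [smul_smul]
      | add x y hx hy => simp only [map_add, mul_add, TensorProduct.tmul_add, smul_add, hx, hy]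
    | add x y hx hy => simp only [map_add, mul_add, hx, hy]
  | add x y hx hy =>
    simp only [add_mul, map_add, hx, hy]
    generalize comul (R := k) z = s
    induction s with
    | zero => simp
    | tmul p q => simp [add_mul]
    | add x y hx hy => simp only [map_add, ← hx, ← hy]; abel

lemma auxKR (t : A ⊗[k] A) (z a : A) : cR k A (t * comul (R := k) z * 1 ⊗ₜ a) =
    TensorProduct.rid k A (TensorProduct.map (cR k A ∘ₗ LinearMap.mulLeft k t ∘ₗ comul)
      (counit ∘ₗ LinearMap.mulRight k a) (comul (R := k) z)) := by
  induction t with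
  | zero =>
    simp only [zero_mul, map_zero]
    generalize comul (R := k) z = s
    induction s with
    | zero => simp
    | tmul p q => simp
    | add x y hx hy => rw [map_add, map_add, ← hx, ← hy, add_zero]
  | tmul b c =>
    have : b ⊗ₜ[k] c * comul (R := k) z * 1 ⊗ₜ a =
        b ⊗ₜ 1 * (1 ⊗ₜ c * comul (R := k) z * 1 ⊗ₜ a) := by
      simp only [← mul_assoc, Algebra.TensorProduct.tmul_mul_tmul, one_mul, mul_one]
    rw [this, cR_mul_left, auxR, ← coassoc']
    generalize comul (R := k) z = s
    induction s with
    | zero => simp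
    | tmul p q =>
      simp only [LinearMap.rTensor_tmul, TensorProduct.map_tmul, LinearMap.comp_apply,
        TensorProduct.rid_tmul]
      rw [show b ⊗ₜ[k] c = b ⊗ₜ 1 * 1 ⊗ₜ c by simp, LinearMap.mulLeft_apply, mul_assoc, cR_mul_left]
      generalize comul (R := k) p = r
      induction r with
      | zero => simp
      | tmul r1 r2 => simp [smul_smul, mul_comm]
      | add x y hx hy => simp only [map_add, mul_add, TensorProduct.add_tmul, smul_add, hx, hy]
    | add x y hx hy => simp only [map_add, mul_add, hx, hy]
  | add x y hx hy =>
    simp only [add_mul, map_add, hx, hy]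
    generalize comul (R := k) z = s
    induction s with
    | zero => simp
    | tmul p q => simp [add_mul]
    | add x y hx hy => simp only [map_add, ← hx, ← hy]; abel

/-- `ε(x₁ a) x₂ = x εˡʳ(a)` -/
lemma cL_comul_mul (x a : A) : cL k A (comul (R := k) x * a ⊗ₜ 1) = x * epsLR k A a := by
  rw [← comul_mul_one, auxKL, epsLR_apply,
    show cL k A ∘ₗ LinearMap.mulLeft k (comul (R := k) x) ∘ₗ comul = LinearMap.mulLeft k x from
      LinearMap.ext fun q => by
        simp only [LinearMap.comp_apply, LinearMap.mulLeft_apply, ← comul_mul, cL_comul]]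
  generalize comul (R := k) (1 : A) = s
  induction s with
  | zero => simp
  | tmul p q => simp
  | add x y hx hy => simp only [map_add, add_mul, mul_add, hx, hy]

/-- `x₁ ε(x₂ a) = x εʳʳ(a)` -/
lemma cR_comul_mul (x a : A) : cR k A (comul (R := k) x * 1 ⊗ₜ a) = x * epsRR k A a := by
  rw [← comul_mul_one, auxKR, epsRR_apply,
    show cR k A ∘ₗ LinearMap.mulLeft k (comul (R := k) x) ∘ₗ comul = LinearMap.mulLeft k x from
      LinearMap.ext fun q => by
        simp only [LinearMap.comp_apply, LinearMap.mulLeft_apply, ← comul_mul, cR_comul]]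
  generalize comul (R := k) (1 : A) = s
  induction s with
  | zero => simp
  | tmul p q => simp
  | add x y hx hy => simp only [map_add, add_mul, mul_add, hx, hy]

lemma auxKL' (t : A ⊗[k] A) (z a : A) : cL k A (a ⊗ₜ 1 * comul (R := k) z * t) =
    TensorProduct.lid k A (TensorProduct.map (counit ∘ₗ LinearMap.mulLeft k a)
      (cL k A ∘ₗ LinearMap.mulRight k t ∘ₗ comul) (comul (R := k) z)) := by
  induction t with
  | zero =>
    simp only [mul_zero, map_zero]
    generalize comul (R := k) z = s
    induction s with
    | zero => simp
    | tmul p q => simp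
    | add x y hx hy => rw [map_add, map_add, ← hx, ← hy, add_zero]
  | tmul b c =>
    have : a ⊗ₜ[k] 1 * comul (R := k) z * b ⊗ₜ c =
        (a ⊗ₜ 1 * comul (R := k) z * b ⊗ₜ 1) * 1 ⊗ₜ c := by
      simp only [mul_assoc, Algebra.TensorProduct.tmul_mul_tmul, one_mul, mul_one]
    rw [this, cL_mul_right, auxL]
    generalize comul (R := k) z = s
    induction s with
    | zero => simp
    | tmul p q =>
      simp only [LinearMap.lTensor_tmul, TensorProduct.map_tmul, LinearMap.comp_apply,
        TensorProduct.lid_tmul]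
      rw [show b ⊗ₜ[k] c = b ⊗ₜ 1 * 1 ⊗ₜ c by simp, LinearMap.mulRight_apply, ← mul_assoc,
        cL_mul_right]
      generalize comul (R := k) q = r
      induction r with
      | zero => simp
      | tmul r1 r2 => simp [smul_smul]
      | add x y hx hy =>
        simp only [map_add, add_mul, TensorProduct.tmul_add, smul_add, hx, hy]
    | add x y hx hy => simp only [map_add, add_mul, hx, hy]
  | add x y hx hy =>
    simp only [mul_add, map_add, hx, hy]
    generalize comul (R := k) z = s
    induction s with
    | zero => simp
    | tmul p q => simp [mul_add]
    | add x y hx hy => simp only [map_add, ← hx, ← hy]; abel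

lemma auxKR' (t : A ⊗[k] A) (z a : A) : cR k A (1 ⊗ₜ a * comul (R := k) z * t) =
    TensorProduct.rid k A (TensorProduct.map (cR k A ∘ₗ LinearMap.mulRight k t ∘ₗ comul)
      (counit ∘ₗ LinearMap.mulLeft k a) (comul (R := k) z)) := by
  induction t with
  | zero =>
    simp only [mul_zero, map_zero]
    generalize comul (R := k) z = s
    induction s with
    | zero => simp
    | tmul p q => simp
    | add x y hx hy => rw [map_add, map_add, ← hx, ← hy, add_zero]
  | tmul b c =>
    have : 1 ⊗ₜ[k] a * comul (R := k) z * b ⊗ₜ c =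
        (1 ⊗ₜ a * comul (R := k) z * 1 ⊗ₜ c) * b ⊗ₜ 1 := by
      simp only [mul_assoc, Algebra.TensorProduct.tmul_mul_tmul, one_mul, mul_one]
    rw [this, cR_mul_right, auxR', ← coassoc']
    generalize comul (R := k) z = s
    induction s with
    | zero => simp
    | tmul p q =>
      simp only [LinearMap.rTensor_tmul, TensorProduct.map_tmul, LinearMap.comp_apply,
        TensorProduct.rid_tmul]
      rw [show b ⊗ₜ[k] c = 1 ⊗ₜ c * b ⊗ₜ 1 by simp, LinearMap.mulRight_apply, ← mul_assoc,
        cR_mul_right]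
      generalize comul (R := k) p = r
      induction r with
      | zero => simp
      | tmul r1 r2 => simp [smul_smul, mul_comm]
      | add x y hx hy =>
        simp only [map_add, add_mul, TensorProduct.add_tmul, smul_add, hx, hy]
    | add x y hx hy => simp only [map_add, add_mul, hx, hy]
  | add x y hx hy =>
    simp only [mul_add, map_add, hx, hy]
    generalize comul (R := k) z = s
    induction s with
    | zero => simp
    | tmul p q => simp [mul_add]
    | add x y hx hy => simp only [map_add, ← hx, ← hy]; abel

/-- `ε(a x₁) x₂ = ε(a 1₁) 1₂ x` -/
lemma cL_mul_comul (x a : A) : cL k A (a ⊗ₜ 1 * comul (R := k) x) =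
    cL k A (a ⊗ₜ 1 * comul (R := k) (1 : A) * 1 ⊗ₜ x) := by
  rw [← comul_one_mul, ← mul_assoc, auxKL', cL_mul_right,
    show cL k A ∘ₗ LinearMap.mulRight k (comul (R := k) x) ∘ₗ comul = LinearMap.mulRight k x from
      LinearMap.ext fun q => by
        simp only [LinearMap.comp_apply, LinearMap.mulRight_apply, ← comul_mul, cL_comul]]
  generalize comul (R := k) (1 : A) = s
  induction s with
  | zero => simp
  | tmul p q => simp
  | add x y hx hy => simp only [map_add, add_mul, mul_add, hx, hy]

/-- `x₁ ε(a x₂) = 1₁ x ε(a 1₂)` -/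
lemma cR_mul_comul (x a : A) : cR k A (1 ⊗ₜ a * comul (R := k) x) =
    cR k A (1 ⊗ₜ a * comul (R := k) (1 : A) * x ⊗ₜ 1) := by
  rw [← comul_one_mul, ← mul_assoc, auxKR', cR_mul_right,
    show cR k A ∘ₗ LinearMap.mulRight k (comul (R := k) x) ∘ₗ comul = LinearMap.mulRight k x from
      LinearMap.ext fun q => by
        simp only [LinearMap.comp_apply, LinearMap.mulRight_apply, ← comul_mul, cR_comul]]
  generalize comul (R := k) (1 : A) = s
  induction s with
  | zero => simp
  | tmul p q => simp
  | add x y hx hy => simp only [map_add, add_mul, mul_add, hx, hy]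

/-- `Δ(y) = 1₁ y ⊗ 1₂` for `y = εˡʳ(z)` -/
lemma comul_epsLR (z : A) : comul (R := k) (epsLR k A z) =
    comul (R := k) (1 : A) * epsLR k A z ⊗ₜ 1 := by
  have h := congrArg (fun t => TensorProduct.lid k (A ⊗[k] A) (LinearMap.rTensor (A ⊗[k] A)
    (counit ∘ₗ LinearMap.mulRight k z) t)) (comul_one_right (k := k) (A := A))
  rw [epsLR_apply]
  refine Eq.trans (Eq.trans ?_ h.symm) ?_
  · generalize comul (R := k) (1 : A) = s
    induction s with
    | zero => simp
    | tmul p q => simp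
    | add x y hx hy => simp only [map_add, add_mul, hx, hy]
  · have key : ∀ r s : A ⊗[k] A, TensorProduct.lid k (A ⊗[k] A) (LinearMap.rTensor (A ⊗[k] A)
        (counit ∘ₗ LinearMap.mulRight k z) ((1 ⊗ₜ s) * TensorProduct.assoc k A A A (r ⊗ₜ 1))) =
        s * cL k A (r * z ⊗ₜ 1) ⊗ₜ 1 := by
      intro r s
      induction r with
      | zero => simp
      | tmul p q => simp [← TensorProduct.smul_tmul']
      | add x y hx hy =>
        simp only [map_add, add_mul, mul_add, TensorProduct.add_tmul, hx, hy]
    exact key _ _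

/-- `Δ(y) = 1₁ ⊗ 1₂ y` for `y = εʳʳ(z)` -/
lemma comul_epsRR (z : A) : comul (R := k) (epsRR k A z) =
    comul (R := k) (1 : A) * 1 ⊗ₜ epsRR k A z := by
  have h := congrArg (fun t => TensorProduct.rid k (A ⊗[k] A) (LinearMap.lTensor (A ⊗[k] A)
    (counit ∘ₗ LinearMap.mulRight k z) ((TensorProduct.assoc k A A A).symm t)))
      (comul_one_left (k := k) (A := A))
  rw [← coassoc', LinearEquiv.symm_apply_apply] at h
  rw [epsRR_apply]
  refine Eq.trans (Eq.trans ?_ h.symm) ?_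
  · generalize comul (R := k) (1 : A) = s
    induction s with
    | zero => simp
    | tmul p q => simp
    | add x y hx hy => simp only [map_add, add_mul, hx, hy]
  · have key : ∀ s r : A ⊗[k] A, TensorProduct.rid k (A ⊗[k] A) (LinearMap.lTensor (A ⊗[k] A)
        (counit ∘ₗ LinearMap.mulRight k z) ((TensorProduct.assoc k A A A).symm
          (TensorProduct.assoc k A A A (s ⊗ₜ 1) * (1 ⊗ₜ r)))) =
        s * 1 ⊗ₜ cR k A (r * 1 ⊗ₜ z) := by
      intro s r
      induction r with
      | zero => simp
      | tmul p q =>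
        induction s with
        | zero => simp
        | tmul p' q' => simp
        | add x y hx hy =>
          simp only [map_add, add_mul, TensorProduct.add_tmul, hx, hy]
      | add x y hx hy =>
        simp only [map_add, add_mul, mul_add, TensorProduct.tmul_add, hx, hy]
    exact key _ _

lemma rTensor_epsLR_ext (s s' : A ⊗[k] A)
    (h : ∀ p : A, cL k A (p ⊗ₜ 1 * s) = cL k A (p ⊗ₜ 1 * s')) :
    LinearMap.rTensor A (epsLR k A) s = LinearMap.rTensor A (epsLR k A) s' := by
  have key : ∀ s : A ⊗[k] A, LinearMap.rTensor A (epsLR k A) s =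
      TensorProduct.lift (LinearMap.mk₂ k
        (fun (p q : A) => q ⊗ₜ[k] cL k A (p ⊗ₜ 1 * s))
        (by simp [TensorProduct.add_tmul, add_mul, TensorProduct.tmul_add])
        (by intro c m n
            rw [← TensorProduct.smul_tmul', smul_mul_assoc, map_smul, TensorProduct.tmul_smul])
        (by simp [TensorProduct.add_tmul]) (by simp [TensorProduct.smul_tmul']))
        (comul (R := k) (1 : A)) := by
    intro s
    induction s with
    | zero =>
      generalize comul (R := k) (1 : A) = t
      induction t with
      | zero => simp
      | tmul p q => simp
      | add x y hx hy => rw [map_add, ← hx, ← hy]; simp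
    | tmul a b =>
      simp only [LinearMap.rTensor_tmul, epsLR_apply]
      generalize comul (R := k) (1 : A) = t
      induction t with
      | zero => simp
      | tmul p q => simp [TensorProduct.smul_tmul]
      | add x y hx hy => simp only [map_add, ← hx, ← hy, add_mul, TensorProduct.add_tmul]
    | add x y hx hy =>
      rw [map_add, hx, hy]
      generalize comul (R := k) (1 : A) = t
      induction t with
      | zero => simp
      | tmul p q => simp [mul_add, TensorProduct.tmul_add]; rfl
      | add x y hx hy => simp only [map_add, ← hx, ← hy]; abel
  rw [key, key]
  simp only [h]

lemma lTensor_epsLR_ext (s s' : A ⊗[k] A)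
    (h : ∀ p : A, cR k A (1 ⊗ₜ p * s) = cR k A (1 ⊗ₜ p * s')) :
    LinearMap.lTensor A (epsLR k A) s = LinearMap.lTensor A (epsLR k A) s' := by
  have key : ∀ s : A ⊗[k] A, LinearMap.lTensor A (epsLR k A) s =
      TensorProduct.lift (LinearMap.mk₂ k
        (fun (p q : A) => cR k A (1 ⊗ₜ p * s) ⊗ₜ[k] q)
        (by simp [TensorProduct.add_tmul, add_mul, TensorProduct.tmul_add])
        (by intro c m n
            rw [TensorProduct.tmul_smul, smul_mul_assoc, map_smul, TensorProduct.smul_tmul'])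
        (by simp [TensorProduct.tmul_add]) (by simp))
        (comul (R := k) (1 : A)) := by
    intro s
    induction s with
    | zero =>
      generalize comul (R := k) (1 : A) = t
      induction t with
      | zero => simp
      | tmul p q => simp
      | add x y hx hy => rw [map_add, ← hx, ← hy]; simp
    | tmul a b =>
      simp only [LinearMap.lTensor_tmul, epsLR_apply]
      generalize comul (R := k) (1 : A) = t
      induction t with
      | zero => simp
      | tmul p q => simp [TensorProduct.smul_tmul]
      | add x y hx hy => simp only [map_add, ← hx, ← hy, add_mul, TensorProduct.tmul_add]
    | add x y hx hy =>
      rw [map_add, hx, hy]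
      generalize comul (R := k) (1 : A) = t
      induction t with
      | zero => simp
      | tmul p q => simp [mul_add, TensorProduct.add_tmul]
      | add x y hx hy => simp only [map_add, ← hx, ← hy]; abel
  rw [key, key]
  simp only [h]

/-- `εˡʳ(1₁) ⊗ 1₂ y = εˡʳ(1₁ y) ⊗ 1₂` for `y = εˡʳ(z)` -/
lemma unit_left_aux (z : A) :
    LinearMap.rTensor A (epsLR k A) (comul (R := k) (1 : A) * 1 ⊗ₜ epsLR k A z) =
      LinearMap.rTensor A (epsLR k A) (comul (R := k) (1 : A) * epsLR k A z ⊗ₜ 1) :=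
  rTensor_epsLR_ext _ _ fun p => by
    rw [← comul_epsLR, cL_mul_comul, mul_assoc]

/-- `1₁ εʳʳ(z) ⊗ εˡʳ(1₂) = 1₁ ⊗ εˡʳ(1₂ z)` -/
lemma unit_right_aux (z : A) :
    LinearMap.lTensor A (epsLR k A) (comul (R := k) (1 : A) * epsRR k A z ⊗ₜ 1) =
      LinearMap.lTensor A (epsLR k A) (comul (R := k) (1 : A) * 1 ⊗ₜ z) :=
  lTensor_epsLR_ext _ _ fun p => by
    rw [← mul_assoc, ← cR_mul_comul, comul_epsRR, ← mul_assoc, ← mul_assoc]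
    exact cR_congr _ _ _ fun y => counit_mul_epsRR y z

/-- `1₁ εʳʳ(z) ⊗ 1₂ = 1₁ ⊗ 1₂ εˡʳ(z)` -/
lemma triangle_aux (z : A) :
    comul (R := k) (1 : A) * epsRR k A z ⊗ₜ 1 = comul (R := k) (1 : A) * 1 ⊗ₜ epsLR k A z := by
  have h1 : ∀ s : A ⊗[k] A, s * epsRR k A z ⊗ₜ 1 =
      LinearMap.rTensor A (cR k A ∘ₗ LinearMap.mulRight k (1 ⊗ₜ z))
        (LinearMap.rTensor A comul s) := by
    intro s
    induction s with
    | zero => simp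
    | tmul p q => simp [cR_comul_mul]
    | add x y hx hy => simp only [map_add, add_mul, hx, hy]
  have h2 : ∀ s : A ⊗[k] A, s * 1 ⊗ₜ epsLR k A z =
      LinearMap.lTensor A (cL k A ∘ₗ LinearMap.mulRight k (z ⊗ₜ 1))
        (LinearMap.lTensor A comul s) := by
    intro s
    induction s with
    | zero => simp
    | tmul p q => simp [cL_comul_mul]
    | add x y hx hy => simp only [map_add, add_mul, hx, hy]
  rw [h1, h2, ← coassoc']
  generalize LinearMap.rTensor A comul (comul (R := k) (1 : A)) = t
  induction t with
  | zero => simp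
  | tmul r q =>
    induction r with
    | zero => simp
    | tmul p p' => simp [TensorProduct.smul_tmul]
    | add x y hx hy => simp only [map_add, TensorProduct.add_tmul, hx, hy]
  | add x y hx hy => simp only [map_add, hx, hy]

end
end WeakBialgebra

/-- A finite-dimensional representation of a `k`-algebra `A`: a finite-dimensional vector space with
a left action of `A`. (Multiplication in `End V` is composition in the order of functions.) -/
structure FinRep (k : Type u) (A : Type w) [Field k] [Ring A] [Algebra k A] where
  V : FGModuleCat.{u} k
  ρ : A →ₐ[k] End V

namespace FinRep

section Basic
variable {k : Type u} {A : Type w} [Field k] [Ring A] [Algebra k A]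

/-- The action of `a : A` as a morphism of vector spaces. -/
def act (X : FinRep k A) (a : A) : X.V ⟶ X.V := X.ρ a

lemma act_one (X : FinRep k A) : X.act 1 = 𝟙 X.V := map_one X.ρ
lemma act_mul (X : FinRep k A) (a b : A) : X.act (a * b) = X.act b ≫ X.act a := map_mul X.ρ a b
lemma act_add (X : FinRep k A) (a b : A) : X.act (a + b) = X.act a + X.act b := map_add X.ρ a b
lemma act_zero (X : FinRep k A) : X.act 0 = 0 := map_zero X.ρ
lemma act_smul (X : FinRep k A) (c : k) (a : A) : X.act (c • a) = c • X.act a := map_smul X.ρ c a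

/-- Morphisms of representations: linear maps commuting with the action. -/
@[ext]
structure Hom (X Y : FinRep k A) where
  hom : X.V ⟶ Y.V
  comm : ∀ a : A, X.act a ≫ hom = hom ≫ Y.act a

instance : Category (FinRep k A) where
  Hom := Hom
  id X := ⟨𝟙 X.V, fun a => by simp⟩
  comp f g := ⟨f.hom ≫ g.hom, fun a => by
    rw [← Category.assoc, f.comm, Category.assoc, g.comm, Category.assoc]⟩

@[ext] lemma hom_ext {X Y : FinRep k A} {f g : X ⟶ Y} (h : f.hom = g.hom) : f = g := Hom.ext h

@[simp] lemma id_hom (X : FinRep k A) : Hom.hom (𝟙 X) = 𝟙 X.V := rfl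
@[simp] lemma comp_hom {X Y Z : FinRep k A} (f : X ⟶ Y) (g : Y ⟶ Z) :
    (f ≫ g).hom = f.hom ≫ g.hom := rfl

instance (X Y : FinRep k A) : Zero (X ⟶ Y) := ⟨⟨0, fun a => by simp⟩⟩
instance (X Y : FinRep k A) : Add (X ⟶ Y) :=
  ⟨fun f g => ⟨f.hom + g.hom, fun a => by simp [f.comm, g.comm]⟩⟩
instance (X Y : FinRep k A) : Neg (X ⟶ Y) := ⟨fun f => ⟨-f.hom, fun a => by simp [f.comm]⟩⟩
instance (X Y : FinRep k A) : Sub (X ⟶ Y) :=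
  ⟨fun f g => ⟨f.hom - g.hom, fun a => by simp [f.comm, g.comm]⟩⟩
instance (X Y : FinRep k A) : SMul k (X ⟶ Y) := ⟨fun c f => ⟨c • f.hom, fun a => by simp [f.comm]⟩⟩
instance (X Y : FinRep k A) : SMul ℕ (X ⟶ Y) := ⟨fun c f => ⟨c • f.hom, fun a => by simp [f.comm]⟩⟩
instance (X Y : FinRep k A) : SMul ℤ (X ⟶ Y) := ⟨fun c f => ⟨c • f.hom, fun a => by simp [f.comm]⟩⟩

lemma hom_injective (X Y : FinRep k A) :
    Function.Injective (fun f : X ⟶ Y => f.hom) := fun _ _ h => hom_ext h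

instance (X Y : FinRep k A) : AddCommGroup (X ⟶ Y) :=
  Function.Injective.addCommGroup (fun f : X ⟶ Y => f.hom) (hom_injective X Y)
    rfl (fun _ _ => rfl) (fun _ => rfl) (fun _ _ => rfl) (fun _ _ => rfl) (fun _ _ => rfl)

/-- The underlying linear map, additively. -/
def homAddHom (X Y : FinRep k A) : (X ⟶ Y) →+ (X.V ⟶ Y.V) where
  toFun f := f.hom
  map_zero' := rfl
  map_add' _ _ := rfl

instance (X Y : FinRep k A) : Module k (X ⟶ Y) :=
  Function.Injective.module k (homAddHom X Y) (hom_injective X Y) (fun _ _ => rfl)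

@[simp] lemma zero_hom (X Y : FinRep k A) : Hom.hom (0 : X ⟶ Y) = 0 := rfl
@[simp] lemma add_hom {X Y : FinRep k A} (f g : X ⟶ Y) : (f + g).hom = f.hom + g.hom := rfl
@[simp] lemma smul_hom {X Y : FinRep k A} (c : k) (f : X ⟶ Y) : (c • f).hom = c • f.hom := rfl

instance : Preadditive (FinRep k A) where
  add_comp _ _ _ f g h := hom_ext (Preadditive.add_comp _ _ _ f.hom g.hom h.hom)
  comp_add _ _ _ f g h := hom_ext (Preadditive.comp_add _ _ _ f.hom g.hom h.hom)

instance : CategoryTheory.Linear k (FinRep k A) where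
  smul_comp _ _ _ r f g := hom_ext (Linear.smul_comp _ _ _ r f.hom g.hom)
  comp_smul _ _ _ f r g := hom_ext (Linear.comp_smul _ _ _ f.hom r g.hom)

/-- Isomorphisms of representations from mutually inverse maps. -/
def mkIso {X Y : FinRep k A} (f : X ⟶ Y) (g : Y.V ⟶ X.V) (h₁ : f.hom ≫ g = 𝟙 _)
    (h₂ : g ≫ f.hom = 𝟙 _) : X ≅ Y where
  hom := f
  inv := ⟨g, fun a => by
    calc Y.act a ≫ g = (g ≫ f.hom) ≫ Y.act a ≫ g := by rw [h₂, Category.id_comp]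
      _ = g ≫ (f.hom ≫ Y.act a) ≫ g := by simp
      _ = g ≫ X.act a := by rw [← f.comm]; simp [h₁]⟩
  hom_inv_id := hom_ext h₁
  inv_hom_id := hom_ext h₂

variable (k A) in
/-- The forgetful functor from representations to vector spaces. -/
def forget : FinRep k A ⥤ FGModuleCat.{u} k where
  obj X := X.V
  map f := f.hom

/-- `f ↦ f ⊗ id` -/
def whiskerRightEnd (V W : FGModuleCat.{u} k) : End V →ₐ[k] End (V ⊗ W) :=
  AlgHom.ofLinearMap
    { toFun := fun f => (show V ⟶ V from f) ▷ W
      map_add' := fun f g => MonoidalPreadditive.add_whiskerRight (X := W) f g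
      map_smul' := fun c f => MonoidalLinear.smul_whiskerRight (X := W) c f }
    (MonoidalCategory.id_whiskerRight V W)
    (fun f g => MonoidalCategory.comp_whiskerRight g f W)

/-- `f ↦ id ⊗ f` -/
def whiskerLeftEnd (V W : FGModuleCat.{u} k) : End W →ₐ[k] End (V ⊗ W) :=
  AlgHom.ofLinearMap
    { toFun := fun f => V ◁ (show W ⟶ W from f)
      map_add' := fun f g => MonoidalPreadditive.whiskerLeft_add (X := V) f g
      map_smul' := fun c f => MonoidalLinear.whiskerLeft_smul V c f }
    (MonoidalCategory.whiskerLeft_id V W)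
    (fun f g => MonoidalCategory.whiskerLeft_comp V g f)

lemma whisker_commute (X Y : FinRep k A) (a b : A) :
    Commute (((whiskerRightEnd X.V Y.V).comp X.ρ) a) (((whiskerLeftEnd X.V Y.V).comp Y.ρ) b) :=
  MonoidalCategory.whisker_exchange (X.act a) (Y.act b)

/-- The action of `A ⊗ A` on the tensor product of two representations. -/
def tensorAct (X Y : FinRep k A) : A ⊗[k] A →ₐ[k] End (X.V ⊗ Y.V) :=
  Algebra.TensorProduct.lift ((whiskerRightEnd X.V Y.V).comp X.ρ)
    ((whiskerLeftEnd X.V Y.V).comp Y.ρ) (whisker_commute X Y)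

/-- The action of `t : A ⊗ A` as a morphism of vector spaces. -/
def act₂ (X Y : FinRep k A) (t : A ⊗[k] A) : X.V ⊗ Y.V ⟶ X.V ⊗ Y.V := tensorAct X Y t

lemma act₂_tmul (X Y : FinRep k A) (a b : A) :
    act₂ X Y (a ⊗ₜ b) = X.act a ⊗ₘ Y.act b := by
  rw [MonoidalCategory.tensorHom_def']
  change tensorAct X Y (a ⊗ₜ b) = _
  exact Algebra.TensorProduct.lift_tmul ((whiskerRightEnd X.V Y.V).comp X.ρ)
    ((whiskerLeftEnd X.V Y.V).comp Y.ρ) (whisker_commute X Y) a b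

lemma act₂_mul (X Y : FinRep k A) (s t : A ⊗[k] A) :
    act₂ X Y (s * t) = act₂ X Y t ≫ act₂ X Y s := map_mul (tensorAct X Y) s t
lemma act₂_add (X Y : FinRep k A) (s t : A ⊗[k] A) :
    act₂ X Y (s + t) = act₂ X Y s + act₂ X Y t := map_add (tensorAct X Y) s t
lemma act₂_smul (X Y : FinRep k A) (c : k) (t : A ⊗[k] A) :
    act₂ X Y (c • t) = c • act₂ X Y t := map_smul (tensorAct X Y) c t
lemma act₂_zero (X Y : FinRep k A) : act₂ X Y (0 : A ⊗[k] A) = 0 := map_zero (tensorAct X Y)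

lemma act₂_natural {X X' Y Y' : FinRep k A} (f : X ⟶ X') (g : Y ⟶ Y') (t : A ⊗[k] A) :
    act₂ X Y t ≫ (f.hom ⊗ₘ g.hom) = (f.hom ⊗ₘ g.hom) ≫ act₂ X' Y' t := by
  induction t with
  | zero => simp [act₂_zero]
  | tmul a b => simp only [act₂_tmul, MonoidalCategory.tensorHom_comp_tensorHom, f.comm, g.comm]
  | add s t hs ht => simp only [act₂_add, Preadditive.add_comp, Preadditive.comp_add, hs, ht]


/-- The image of an endomorphism of a vector space. -/
def im {M : FGModuleCat.{u} k} (e : M ⟶ M) : FGModuleCat.{u} k :=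
  FGModuleCat.of k (LinearMap.range e.hom.hom)

/-- The inclusion of the image. -/
def imι {M : FGModuleCat.{u} k} (e : M ⟶ M) : im e ⟶ M :=
  FGModuleCat.ofHom (LinearMap.range e.hom.hom).subtype

/-- The corestriction of `e` to its image. -/
def imπ {M : FGModuleCat.{u} k} (e : M ⟶ M) : M ⟶ im e :=
  FGModuleCat.ofHom e.hom.hom.rangeRestrict

lemma imπ_imι {M : FGModuleCat.{u} k} (e : M ⟶ M) : imπ e ≫ imι e = e := rfl

lemma imι_imπ {M : FGModuleCat.{u} k} (e : M ⟶ M) (he : e ≫ e = e) : imι e ≫ imπ e = 𝟙 _ := by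
  ext ⟨x, y, rfl⟩
  exact Subtype.ext (congrArg (fun f : M ⟶ M => f.hom.hom y) he)

lemma self_imπ {M : FGModuleCat.{u} k} (e : M ⟶ M) (he : e ≫ e = e) : e ≫ imπ e = imπ e := by
  change (imπ e ≫ imι e) ≫ imπ e = imπ e
  rw [Category.assoc, imι_imπ e he, Category.comp_id]

end Basic

section Monoidal
variable {k : Type u} {A : Type w} [Field k] [Ring A] [Algebra k A] [WeakBialgebra k A]
open CoalgebraStruct WeakBialgebra

/-- The idempotent `v ⊗ w ↦ 1₍₁₎ v ⊗ 1₍₂₎ w`. -/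
def e (X Y : FinRep k A) : X.V ⊗ Y.V ⟶ X.V ⊗ Y.V := act₂ X Y (comul (1 : A))

lemma e_act (X Y : FinRep k A) (a : A) :
    e X Y ≫ act₂ X Y (comul a) = act₂ X Y (comul a) := by
  rw [e, ← act₂_mul, comul_mul_one]

lemma act_e (X Y : FinRep k A) (a : A) :
    act₂ X Y (comul a) ≫ e X Y = act₂ X Y (comul a) := by
  rw [e, ← act₂_mul, comul_one_mul]

lemma e_e (X Y : FinRep k A) : e X Y ≫ e X Y = e X Y := e_act X Y 1

/-- The tensor product of representations: the image of `e X Y`, with action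
`x (v ⊗ w) = x₍₁₎ v ⊗ x₍₂₎ w`. -/
def tensor (X Y : FinRep k A) : FinRep k A where
  V := im (e X Y)
  ρ := AlgHom.ofLinearMap
    { toFun := fun a => imι (e X Y) ≫ act₂ X Y (comul a) ≫ imπ (e X Y)
      map_add' := fun a b => by
        rw [map_add, act₂_add, Preadditive.add_comp, Preadditive.comp_add]
      map_smul' := fun c a => by
        rw [map_smul, act₂_smul, Linear.smul_comp, Linear.comp_smul]
        rfl }
    (show imι (e X Y) ≫ e X Y ≫ imπ (e X Y) = 𝟙 _ by
      rw [self_imπ _ (e_e X Y), imι_imπ _ (e_e X Y)])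
    (fun a b => show imι (e X Y) ≫ act₂ X Y (comul (a * b)) ≫ imπ (e X Y) =
        (imι (e X Y) ≫ act₂ X Y (comul b) ≫ imπ (e X Y)) ≫
          (imι (e X Y) ≫ act₂ X Y (comul a) ≫ imπ (e X Y)) by
      have h := imπ_imι (e X Y)
      simp only [Category.assoc]
      rw [reassoc_of% h, ← Category.assoc (e X Y), e_act, comul_mul, act₂_mul, Category.assoc])

/-- The inclusion of the tensor product of representations in that of vector spaces. -/
def ι (X Y : FinRep k A) : (tensor X Y).V ⟶ X.V ⊗ Y.V := imι (e X Y)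

/-- The retraction onto the tensor product of representations. -/
def π (X Y : FinRep k A) : X.V ⊗ Y.V ⟶ (tensor X Y).V := imπ (e X Y)

lemma ι_π (X Y : FinRep k A) : ι X Y ≫ π X Y = 𝟙 _ := imι_imπ _ (e_e X Y)
lemma ι_π_assoc (X Y : FinRep k A) {M : FGModuleCat.{u} k}
    (h : (tensor X Y).V ⟶ M) :
    ι X Y ≫ π X Y ≫ h = h := by
  have t := congrArg (fun f => f ≫ h) (ι_π X Y)
  simpa only [Category.assoc, Category.id_comp] using t
lemma π_ι (X Y : FinRep k A) : π X Y ≫ ι X Y = e X Y := imπ_imι _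
lemma π_ι_assoc (X Y : FinRep k A) {M : FGModuleCat.{u} k}
    (h : X.V ⊗ Y.V ⟶ M) :
    π X Y ≫ ι X Y ≫ h = e X Y ≫ h := by
  have t := congrArg (fun f => f ≫ h) (π_ι X Y)
  simpa only [Category.assoc] using t
lemma e_π (X Y : FinRep k A) : e X Y ≫ π X Y = π X Y := by
  rw [← π_ι, Category.assoc, ι_π, Category.comp_id]
lemma ι_e (X Y : FinRep k A) : ι X Y ≫ e X Y = ι X Y := by
  rw [← π_ι, ι_π_assoc]
lemma ι_e_assoc (X Y : FinRep k A) {M : FGModuleCat.{u} k}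
    (h : X.V ⊗ Y.V ⟶ M) :
    ι X Y ≫ e X Y ≫ h = ι X Y ≫ h := by
  have t := congrArg (fun f => f ≫ h) (ι_e X Y)
  simpa only [Category.assoc] using t

instance (X Y : FinRep k A) : Mono (ι X Y) := mono_of_mono_fac (ι_π X Y)
instance (X Y : FinRep k A) : Epi (π X Y) := epi_of_epi_fac (ι_π X Y)

lemma tensor_act (X Y : FinRep k A) (a : A) :
    (tensor X Y).act a = ι X Y ≫ act₂ X Y (comul a) ≫ π X Y := rfl

lemma tensor_act_ι (X Y : FinRep k A) (a : A) :
    (tensor X Y).act a ≫ ι X Y = ι X Y ≫ act₂ X Y (comul a) := by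
  rw [tensor_act, Category.assoc, Category.assoc, π_ι, act_e]
lemma tensor_act_ι_assoc (X Y : FinRep k A) (a : A) {M : FGModuleCat.{u} k}
    (h : X.V ⊗ Y.V ⟶ M) :
    (tensor X Y).act a ≫ ι X Y ≫ h = ι X Y ≫ act₂ X Y (comul a) ≫ h := by
  have t := congrArg (fun f => f ≫ h) (tensor_act_ι X Y a)
  simpa only [Category.assoc] using t

lemma π_tensor_act (X Y : FinRep k A) (a : A) :
    π X Y ≫ (tensor X Y).act a = act₂ X Y (comul a) ≫ π X Y := by
  rw [tensor_act, π_ι_assoc, ← Category.assoc (e X Y), e_act]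

/-- The tensor product of morphisms of representations. -/
def tensorMap {X X' Y Y' : FinRep k A} (f : X ⟶ X') (g : Y ⟶ Y') : tensor X Y ⟶ tensor X' Y' where
  hom := ι X Y ≫ (f.hom ⊗ₘ g.hom) ≫ π X' Y'
  comm a := by
    rw [tensor_act_ι_assoc, ← Category.assoc (act₂ X Y _), act₂_natural]
    simp only [Category.assoc, π_tensor_act]

lemma tensorMap_ι {X X' Y Y' : FinRep k A} (f : X ⟶ X') (g : Y ⟶ Y') :
    (tensorMap f g).hom ≫ ι X' Y' = ι X Y ≫ (f.hom ⊗ₘ g.hom) := by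
  change (ι X Y ≫ (f.hom ⊗ₘ g.hom) ≫ π X' Y') ≫ ι X' Y' = _
  rw [Category.assoc, Category.assoc, π_ι, e, ← act₂_natural]
  exact ι_e_assoc _ _ _
lemma tensorMap_ι_assoc {X X' Y Y' : FinRep k A} (f : X ⟶ X') (g : Y ⟶ Y') {M : FGModuleCat.{u} k}
    (h : X'.V ⊗ Y'.V ⟶ M) :
    (tensorMap f g).hom ≫ ι X' Y' ≫ h = ι X Y ≫ (f.hom ⊗ₘ g.hom) ≫ h := by
  have t := congrArg (fun f => f ≫ h) (tensorMap_ι f g)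
  simpa only [Category.assoc] using t

lemma π_tensorMap {X X' Y Y' : FinRep k A} (f : X ⟶ X') (g : Y ⟶ Y') :
    π X Y ≫ (tensorMap f g).hom = (f.hom ⊗ₘ g.hom) ≫ π X' Y' := by
  change π X Y ≫ ι X Y ≫ (f.hom ⊗ₘ g.hom) ≫ π X' Y' = _
  rw [π_ι_assoc, e, ← Category.assoc, act₂_natural, Category.assoc]
  exact congrArg _ (e_π _ _)

/-- The action of `A ⊗ (A ⊗ A)` on a triple tensor product. -/
def act₃ (X Y Z : FinRep k A) : A ⊗[k] (A ⊗[k] A) →ₗ[k]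
    (X.V ⊗ (Y.V ⊗ Z.V) ⟶ X.V ⊗ (Y.V ⊗ Z.V)) :=
  TensorProduct.lift (LinearMap.mk₂ k (fun a t => X.act a ⊗ₘ act₂ Y Z t)
    (by intro a b t; simp only [act_add, MonoidalPreadditive.add_tensor])
    (by intro c a t; simp only [act_smul, MonoidalCategory.tensorHom_def,
      MonoidalLinear.smul_whiskerRight, Linear.smul_comp])
    (by intro a s t; simp only [act₂_add, MonoidalPreadditive.tensor_add])
    (by intro c a t; simp only [act₂_smul, MonoidalCategory.tensorHom_def,
      MonoidalLinear.whiskerLeft_smul, Linear.comp_smul]))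

lemma act₃_tmul (X Y Z : FinRep k A) (a : A) (t : A ⊗[k] A) :
    act₃ X Y Z (a ⊗ₜ t) = X.act a ⊗ₘ act₂ Y Z t := rfl

lemma act₃_assoc (X Y Z : FinRep k A) (t : A ⊗[k] A) (c : A) :
    (act₂ X Y t ⊗ₘ Z.act c) ≫ (α_ X.V Y.V Z.V).hom =
      (α_ X.V Y.V Z.V).hom ≫ act₃ X Y Z (TensorProduct.assoc k A A A (t ⊗ₜ c)) := by
  induction t with
  | zero => simp only [act₂_zero, MonoidalPreadditive.zero_tensor, TensorProduct.zero_tmul, map_zero,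
      Limits.zero_comp, Limits.comp_zero]
  | tmul a b =>
    rw [TensorProduct.assoc_tmul, act₃_tmul, act₂_tmul, act₂_tmul,
      MonoidalCategory.associator_naturality]
  | add s t hs ht => simp only [act₂_add, MonoidalPreadditive.add_tensor, TensorProduct.add_tmul,
      map_add, Preadditive.add_comp, Preadditive.comp_add, hs, ht]

lemma idem_left (X Y Z : FinRep k A) :
    (π X Y ▷ Z.V ≫ e (tensor X Y) Z ≫ ι X Y ▷ Z.V) ≫ (α_ X.V Y.V Z.V).hom =
      (α_ X.V Y.V Z.V).hom ≫
        act₃ X Y Z (LinearMap.lTensor A comul (comul (R := k) (1 : A))) := by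
  rw [← coassoc', e]
  generalize comul (R := k) (1 : A) = t
  induction t with
  | zero => simp only [act₂_zero, map_zero, Limits.zero_comp, Limits.comp_zero]
  | tmul a b =>
    rw [LinearMap.rTensor_tmul, ← act₃_assoc, act₂_tmul]
    congr 1
    rw [← MonoidalCategory.tensorHom_id, ← MonoidalCategory.tensorHom_id,
      MonoidalCategory.tensorHom_comp_tensorHom, MonoidalCategory.tensorHom_comp_tensorHom,
      tensor_act_ι, π_ι_assoc, e_act, Category.comp_id, Category.id_comp]
  | add s t hs ht =>
    simp only [act₂_add, map_add, Preadditive.add_comp, Preadditive.comp_add]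
    rw [hs, ht]

lemma idem_right (X Y Z : FinRep k A) :
    X.V ◁ π Y Z ≫ e X (tensor Y Z) ≫ X.V ◁ ι Y Z =
        act₃ X Y Z (LinearMap.lTensor A comul (comul (R := k) (1 : A))) := by
  rw [e]
  generalize comul (R := k) (1 : A) = t
  induction t with
  | zero => simp only [act₂_zero, map_zero, Limits.zero_comp, Limits.comp_zero]
  | tmul a b =>
    rw [LinearMap.lTensor_tmul, act₃_tmul, act₂_tmul]
    rw [← MonoidalCategory.id_tensorHom, ← MonoidalCategory.id_tensorHom,
      MonoidalCategory.tensorHom_comp_tensorHom, MonoidalCategory.tensorHom_comp_tensorHom,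
      tensor_act_ι, π_ι_assoc, e_act, Category.comp_id, Category.id_comp]
  | add s t hs ht =>
    simp only [act₂_add, map_add, Preadditive.add_comp, Preadditive.comp_add, hs, ht]

/-- The inclusion of `(X ⊠ Y) ⊠ Z`. -/
def jL (X Y Z : FinRep k A) : (tensor (tensor X Y) Z).V ⟶ (X.V ⊗ Y.V) ⊗ Z.V :=
  ι (tensor X Y) Z ≫ ι X Y ▷ Z.V
/-- The retraction onto `(X ⊠ Y) ⊠ Z`. -/
def qL (X Y Z : FinRep k A) : (X.V ⊗ Y.V) ⊗ Z.V ⟶ (tensor (tensor X Y) Z).V :=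
  π X Y ▷ Z.V ≫ π (tensor X Y) Z
/-- The inclusion of `X ⊠ (Y ⊠ Z)`. -/
def jR (X Y Z : FinRep k A) : (tensor X (tensor Y Z)).V ⟶ X.V ⊗ (Y.V ⊗ Z.V) :=
  ι X (tensor Y Z) ≫ X.V ◁ ι Y Z
/-- The retraction onto `X ⊠ (Y ⊠ Z)`. -/
def qR (X Y Z : FinRep k A) : X.V ⊗ (Y.V ⊗ Z.V) ⟶ (tensor X (tensor Y Z)).V :=
  X.V ◁ π Y Z ≫ π X (tensor Y Z)

lemma jL_qL (X Y Z : FinRep k A) : jL X Y Z ≫ qL X Y Z = 𝟙 _ := by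
  rw [jL, qL, Category.assoc, ← MonoidalCategory.comp_whiskerRight_assoc, ι_π,
    MonoidalCategory.id_whiskerRight]
  exact (congrArg _ (Category.id_comp _)).trans (ι_π _ _)
lemma jL_qL_assoc (X Y Z : FinRep k A) {M : FGModuleCat.{u} k}
    (h : (tensor (tensor X Y) Z).V ⟶ M) :
    jL X Y Z ≫ qL X Y Z ≫ h = h := by
  have t := congrArg (fun f => f ≫ h) (jL_qL X Y Z)
  simpa only [Category.assoc, Category.id_comp] using t
lemma jR_qR (X Y Z : FinRep k A) : jR X Y Z ≫ qR X Y Z = 𝟙 _ := by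
  rw [jR, qR, Category.assoc, ← MonoidalCategory.whiskerLeft_comp_assoc, ι_π,
    MonoidalCategory.whiskerLeft_id]
  exact (congrArg _ (Category.id_comp _)).trans (ι_π _ _)
lemma jR_qR_assoc (X Y Z : FinRep k A) {M : FGModuleCat.{u} k}
    (h : (tensor X (tensor Y Z)).V ⟶ M) :
    jR X Y Z ≫ qR X Y Z ≫ h = h := by
  have t := congrArg (fun f => f ≫ h) (jR_qR X Y Z)
  simpa only [Category.assoc, Category.id_comp] using t

/-- The two idempotents on the triple tensor product agree. -/
lemma qL_jL (X Y Z : FinRep k A) :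
    qL X Y Z ≫ jL X Y Z ≫ (α_ X.V Y.V Z.V).hom =
      (α_ X.V Y.V Z.V).hom ≫ qR X Y Z ≫ jR X Y Z := by
  have hL : qL X Y Z ≫ jL X Y Z = π X Y ▷ Z.V ≫ e (tensor X Y) Z ≫ ι X Y ▷ Z.V := by
    rw [qL, jL, Category.assoc]
    exact congrArg _ (π_ι_assoc (tensor X Y) Z _)
  have hR : qR X Y Z ≫ jR X Y Z = X.V ◁ π Y Z ≫ e X (tensor Y Z) ≫ X.V ◁ ι Y Z := by
    rw [qR, jR, Category.assoc]
    exact congrArg _ (π_ι_assoc X (tensor Y Z) _)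
  rw [← Category.assoc, hL, hR, idem_left, idem_right]
lemma qL_jL_assoc (X Y Z : FinRep k A) {M : FGModuleCat.{u} k}
    (h : X.V ⊗ (Y.V ⊗ Z.V) ⟶ M) :
    qL X Y Z ≫ jL X Y Z ≫ (α_ X.V Y.V Z.V).hom ≫ h =
      (α_ X.V Y.V Z.V).hom ≫ qR X Y Z ≫ jR X Y Z ≫ h := by
  have t := congrArg (fun f => f ≫ h) (qL_jL X Y Z)
  simpa only [Category.assoc] using t

/-- The associator: the canonical map between two retracts of the triple tensor product. -/
def assocHom (X Y Z : FinRep k A) : (tensor (tensor X Y) Z).V ⟶ (tensor X (tensor Y Z)).V :=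
  jL X Y Z ≫ (α_ X.V Y.V Z.V).hom ≫ qR X Y Z
/-- The inverse of the associator. -/
def assocInv (X Y Z : FinRep k A) : (tensor X (tensor Y Z)).V ⟶ (tensor (tensor X Y) Z).V :=
  jR X Y Z ≫ (α_ X.V Y.V Z.V).inv ≫ qL X Y Z

lemma assocHom_jR (X Y Z : FinRep k A) :
    assocHom X Y Z ≫ jR X Y Z = jL X Y Z ≫ (α_ X.V Y.V Z.V).hom := by
  rw [assocHom, Category.assoc, Category.assoc, ← qL_jL, jL_qL_assoc]
lemma assocHom_jR_assoc (X Y Z : FinRep k A) {M : FGModuleCat.{u} k}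
    (h : X.V ⊗ (Y.V ⊗ Z.V) ⟶ M) :
    assocHom X Y Z ≫ jR X Y Z ≫ h = jL X Y Z ≫ (α_ X.V Y.V Z.V).hom ≫ h := by
  have t := congrArg (fun f => f ≫ h) (assocHom_jR X Y Z)
  simpa only [Category.assoc] using t

lemma assocInv_jL (X Y Z : FinRep k A) :
    assocInv X Y Z ≫ jL X Y Z = jR X Y Z ≫ (α_ X.V Y.V Z.V).inv := by
  rw [← cancel_mono (α_ X.V Y.V Z.V).hom]
  simp only [assocInv, Category.assoc, qL_jL, Iso.inv_hom_id_assoc, Iso.inv_hom_id,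
    Category.comp_id]
  rw [jR_qR_assoc]
lemma assocInv_jL_assoc (X Y Z : FinRep k A) {M : FGModuleCat.{u} k}
    (h : (X.V ⊗ Y.V) ⊗ Z.V ⟶ M) :
    assocInv X Y Z ≫ jL X Y Z ≫ h = jR X Y Z ≫ (α_ X.V Y.V Z.V).inv ≫ h := by
  have t := congrArg (fun f => f ≫ h) (assocInv_jL X Y Z)
  simpa only [Category.assoc] using t

lemma qL_assocHom (X Y Z : FinRep k A) :
    qL X Y Z ≫ assocHom X Y Z = (α_ X.V Y.V Z.V).hom ≫ qR X Y Z := by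
  rw [assocHom, qL_jL_assoc, jR_qR, Category.comp_id]
lemma qL_assocHom_assoc (X Y Z : FinRep k A) {M : FGModuleCat.{u} k}
    (h : (tensor X (tensor Y Z)).V ⟶ M) :
    qL X Y Z ≫ assocHom X Y Z ≫ h = (α_ X.V Y.V Z.V).hom ≫ qR X Y Z ≫ h := by
  have t := congrArg (fun f => f ≫ h) (qL_assocHom X Y Z)
  simpa only [Category.assoc] using t

instance (X Y Z : FinRep k A) : Mono (jR X Y Z) := mono_of_mono_fac (jR_qR X Y Z)
instance (X Y Z : FinRep k A) : Mono (jL X Y Z) := mono_of_mono_fac (jL_qL X Y Z)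

lemma act_jL (X Y Z : FinRep k A) (a : A) :
    (tensor (tensor X Y) Z).act a ≫ jL X Y Z ≫ (α_ X.V Y.V Z.V).hom =
      (jL X Y Z ≫ (α_ X.V Y.V Z.V).hom) ≫
        act₃ X Y Z (LinearMap.lTensor A comul (comul (R := k) a)) := by
  have h := tensor_act_ι_assoc (tensor X Y) Z a (ι X Y ▷ Z.V ≫ (α_ X.V Y.V Z.V).hom)
  rw [jL]
  simp only [Category.assoc]
  refine h.trans (congrArg (fun f => ι (tensor X Y) Z ≫ f) ?_)
  rw [← coassoc']
  generalize comul (R := k) a = t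
  induction t with
  | zero => simp only [act₂_zero, map_zero, Limits.zero_comp, Limits.comp_zero]
  | tmul a b =>
    rw [LinearMap.rTensor_tmul, ← act₃_assoc, act₂_tmul, ← Category.assoc, ← Category.assoc]
    congr 1
    rw [← MonoidalCategory.tensorHom_id,
      MonoidalCategory.tensorHom_comp_tensorHom, MonoidalCategory.tensorHom_comp_tensorHom,
      tensor_act_ι, Category.comp_id, Category.id_comp]
  | add s t hs ht =>
    simp only [act₂_add, map_add, Preadditive.add_comp, Preadditive.comp_add, hs, ht]

lemma act_jR (X Y Z : FinRep k A) (a : A) :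
    (tensor X (tensor Y Z)).act a ≫ jR X Y Z =
      jR X Y Z ≫ act₃ X Y Z (LinearMap.lTensor A comul (comul (R := k) a)) := by
  have h := tensor_act_ι_assoc X (tensor Y Z) a (X.V ◁ ι Y Z)
  rw [jR]
  simp only [Category.assoc]
  refine h.trans (congrArg (fun f => ι X (tensor Y Z) ≫ f) ?_)
  generalize comul (R := k) a = t
  induction t with
  | zero => simp only [act₂_zero, map_zero, Limits.zero_comp, Limits.comp_zero]
  | tmul a b =>
    rw [LinearMap.lTensor_tmul, act₃_tmul, act₂_tmul]
    rw [← MonoidalCategory.id_tensorHom,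
      MonoidalCategory.tensorHom_comp_tensorHom, MonoidalCategory.tensorHom_comp_tensorHom,
      tensor_act_ι, Category.comp_id, Category.id_comp]
  | add s t hs ht =>
    simp only [act₂_add, map_add, Preadditive.add_comp, Preadditive.comp_add, hs, ht]

/-- The associator of representations. -/
def assoc (X Y Z : FinRep k A) : tensor (tensor X Y) Z ≅ tensor X (tensor Y Z) :=
  mkIso ⟨assocHom X Y Z, fun a => by
      rw [← cancel_mono (jR X Y Z)]
      simp only [Category.assoc, assocHom_jR, act_jL, act_jR]
      rw [assocHom_jR_assoc]⟩
    (assocInv X Y Z)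
    (by
      change assocHom X Y Z ≫ assocInv X Y Z = _
      rw [← cancel_mono (jL X Y Z)]
      simp only [Category.assoc, assocInv_jL, assocHom_jR_assoc, Iso.hom_inv_id, Category.comp_id,
        Category.id_comp])
    (by
      change assocInv X Y Z ≫ assocHom X Y Z = _
      rw [← cancel_mono (jR X Y Z)]
      simp only [Category.assoc, assocHom_jR, assocInv_jL_assoc, Iso.inv_hom_id, Category.comp_id,
        Category.id_comp])

end Monoidal
end FinRep

noncomputable section
namespace FinRep
section Unit
variable {k : Type u} {A : Type w} [Field k] [Ring A] [Algebra k A] [WeakBialgebra k A]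
  [Module.Finite k A]
open CoalgebraStruct WeakBialgebra

variable (k A) in
/-- The subspace `Aˡ = εˡʳ(A)`. -/
abbrev Al : Submodule k A := LinearMap.range (epsLR k A)

instance : Small.{u} (Al k A) := Module.Finite.small k _

variable (k A) in
/-- The space `Aˡ`, moved to the universe of `k`. -/
def unitV : FGModuleCat.{u} k := FGModuleCat.of k (Shrink.{u} (Al k A))

variable (k A) in
/-- The inclusion `Aˡ → A`. -/
def inclAl : unitV k A →ₗ[k] A := (Al k A).subtype ∘ₗ (Shrink.linearEquiv.{u} k (Al k A)).toLinearMap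

variable (k A) in
/-- The projection `εˡʳ : A → Aˡ`. -/
def projAl : A →ₗ[k] unitV k A :=
  (Shrink.linearEquiv.{u} k (Al k A)).symm.toLinearMap ∘ₗ (epsLR k A).rangeRestrict

lemma inclAl_projAl (x : A) : inclAl k A (projAl k A x) = epsLR k A x := by
  change ((Shrink.linearEquiv.{u} k (Al k A) ((Shrink.linearEquiv.{u} k (Al k A)).symm
    ((epsLR k A).rangeRestrict x)) : Al k A) : A) = _
  rw [LinearEquiv.apply_symm_apply]
  rfl

lemma inclAl_injective : Function.Injective (inclAl k A) :=
  Subtype.val_injective.comp (Shrink.linearEquiv.{u} k (Al k A)).injective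

lemma epsLR_inclAl (y : unitV k A) : epsLR k A (inclAl k A y) = inclAl k A y := by
  obtain ⟨x, hx⟩ : inclAl k A y ∈ Al k A := ((Shrink.linearEquiv.{u} k (Al k A)) y).2
  rw [← hx, epsLR_idem]

lemma projAl_inclAl (y : unitV k A) : projAl k A (inclAl k A y) = y :=
  inclAl_injective (by rw [inclAl_projAl, epsLR_inclAl])

lemma projAl_epsLR (x : A) : projAl k A (epsLR k A x) = projAl k A x :=
  inclAl_injective (by rw [inclAl_projAl, inclAl_projAl, epsLR_idem])

variable (k A) in
/-- The unit representation `Aˡ`, with action `x ⊗ y ↦ εˡʳ(xy)`. -/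
def unit : FinRep k A where
  V := unitV k A
  ρ := AlgHom.ofLinearMap
    { toFun := fun a => FGModuleCat.ofHom (projAl k A ∘ₗ LinearMap.mulLeft k a ∘ₗ inclAl k A)
      map_add' := fun a b => by
        refine FGModuleCat.hom_ext (LinearMap.ext fun y => ?_)
        change projAl k A ((a + b) * inclAl k A y) =
          projAl k A (a * inclAl k A y) + projAl k A (b * inclAl k A y)
        rw [add_mul, map_add]
      map_smul' := fun c a => by
        refine FGModuleCat.hom_ext (LinearMap.ext fun y => ?_)
        change projAl k A ((c • a) * inclAl k A y) = c • projAl k A (a * inclAl k A y)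
        rw [smul_mul_assoc, map_smul] }
    (by
      refine FGModuleCat.hom_ext (LinearMap.ext fun y => ?_)
      change projAl k A (1 * inclAl k A y) = y
      rw [one_mul, projAl_inclAl])
    (fun a b => by
      refine FGModuleCat.hom_ext (LinearMap.ext fun y => ?_)
      change projAl k A (a * b * inclAl k A y) =
        projAl k A (a * inclAl k A (projAl k A (b * inclAl k A y)))
      rw [inclAl_projAl, mul_assoc, ← projAl_epsLR (a * epsLR k A _), epsLR_mul_epsLR,
        projAl_epsLR])

variable (k A) in
/-- The inclusion `Aˡ → A`. -/
def unitIncl : (unit k A).V →ₗ[k] A := inclAl k A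

variable (k A) in
/-- The projection `εˡʳ : A → Aˡ`. -/
def unitProj : A →ₗ[k] (unit k A).V := projAl k A

lemma unitIncl_unitProj (x : A) : unitIncl k A (unitProj k A x) = epsLR k A x :=
  inclAl_projAl x

lemma epsLR_unitIncl (y : (unit k A).V) : epsLR k A (unitIncl k A y) = unitIncl k A y :=
  epsLR_inclAl y

lemma unitProj_unitIncl (y : (unit k A).V) : unitProj k A (unitIncl k A y) = y :=
  projAl_inclAl y

lemma unitProj_epsLR (x : A) : unitProj k A (epsLR k A x) = unitProj k A x :=
  projAl_epsLR x

/-- The action as a linear map on elements. -/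
def actV (X : FinRep k A) : A →ₗ[k] (X.V →ₗ[k] X.V) where
  toFun a := (X.act a).hom.hom
  map_add' a b := by rw [act_add]; rfl
  map_smul' c a := by rw [act_smul]; rfl

lemma actV_one (X : FinRep k A) (v : X.V) : actV X 1 v = v := by
  change (X.act 1).hom.hom v = v
  rw [act_one]; rfl

lemma actV_mul (X : FinRep k A) (a b : A) (v : X.V) : actV X (a * b) v = actV X a (actV X b v) := by
  change (X.act (a * b)).hom.hom v = _
  rw [act_mul]; rfl

lemma unit_actV (a : A) (y : (unit k A).V) :
    actV (unit k A) a y = unitProj k A (a * unitIncl k A y) := rfl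

lemma act₂_apply (X Y : FinRep k A) (a b : A) (v : X.V) (w : Y.V) :
    (act₂ X Y (a ⊗ₜ b)).hom.hom (v ⊗ₜ[k] w) = actV X a v ⊗ₜ[k] actV Y b w := by
  rw [act₂_tmul]; rfl

/-- `v ⊗ w ↦ t (v ⊗ w)`, linear in `t`. -/
lemma act₂_apply' (X Y : FinRep k A) (t : A ⊗[k] A) (v : X.V) (w : Y.V) :
    (act₂ X Y t).hom.hom (v ⊗ₜ[k] w) =
      TensorProduct.map ((actV X).flip v) ((actV Y).flip w) t := by
  induction t with
  | zero => rw [act₂_zero, map_zero]; rfl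
  | tmul a b => exact act₂_apply X Y a b v w
  | add s t hs ht => rw [map_add, ← hs, ← ht, act₂_add]; rfl

/-- `y ⊗ v ↦ y v` on `Aˡ ⊗ V` -/
def lt (X : FinRep k A) : (unit k A).V ⊗ X.V ⟶ X.V :=
  FGModuleCat.ofHom (TensorProduct.lift (actV X ∘ₗ unitIncl k A))

/-- `v ⊗ y ↦ εʳʳ(y) v` on `V ⊗ Aˡ` -/
def rt (X : FinRep k A) : X.V ⊗ (unit k A).V ⟶ X.V :=
  FGModuleCat.ofHom (TensorProduct.lift (actV X ∘ₗ epsRR k A ∘ₗ unitIncl k A).flip)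

lemma lt_apply (X : FinRep k A) (y : (unit k A).V) (v : X.V) :
    (lt X).hom.hom (y ⊗ₜ[k] v) = actV X (unitIncl k A y) v := rfl
lemma rt_apply (X : FinRep k A) (y : (unit k A).V) (v : X.V) :
    (rt X).hom.hom (v ⊗ₜ[k] y) = actV X (epsRR k A (unitIncl k A y)) v := rfl

lemma tensor_hom_ext {V W : FGModuleCat.{u} k} {M : FGModuleCat.{u} k} {f g : V ⊗ W ⟶ M}
    (h : ∀ (v : V) (w : W), f.hom.hom (v ⊗ₜ[k] w) = g.hom.hom (v ⊗ₜ[k] w)) : f = g :=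
  FGModuleCat.hom_ext (TensorProduct.ext' h)

lemma act₂_lt (X : FinRep k A) (a : A) : act₂ (unit k A) X (comul a) ≫ lt X = lt X ≫ X.act a := by
  apply tensor_hom_ext
  intro y v
  change (lt X).hom.hom ((act₂ (unit k A) X (comul a)).hom.hom (y ⊗ₜ[k] v)) =
    actV X a (actV X (unitIncl k A y) v)
  have key : ∀ t : A ⊗[k] A, (lt X).hom.hom ((act₂ (unit k A) X t).hom.hom (y ⊗ₜ[k] v)) =
      actV X (cL k A (comul (1 : A) * t * unitIncl k A y ⊗ₜ 1)) v := by
    intro t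
    induction t with
    | zero => simp only [act₂_zero, mul_zero, zero_mul, map_zero]; rfl
    | tmul p q =>
      rw [act₂_apply, lt_apply, unit_actV, unitIncl_unitProj, ← actV_mul, epsLR_apply,
        ← cL_mul_right, mul_assoc, mul_assoc, Algebra.TensorProduct.tmul_mul_tmul,
        Algebra.TensorProduct.tmul_mul_tmul, one_mul, mul_one, mul_one]
    | add s t hs ht =>
      rw [act₂_add, mul_add, add_mul, map_add, map_add, LinearMap.add_apply, ← hs, ← ht, ← map_add]
      rfl
  rw [key, comul_one_mul, cL_comul_mul, epsLR_unitIncl, actV_mul]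

lemma act₂_rt (X : FinRep k A) (a : A) : act₂ X (unit k A) (comul a) ≫ rt X = rt X ≫ X.act a := by
  apply tensor_hom_ext
  intro v y
  change (rt X).hom.hom ((act₂ X (unit k A) (comul a)).hom.hom (v ⊗ₜ[k] y)) =
    actV X a (actV X (epsRR k A (unitIncl k A y)) v)
  have key : ∀ t : A ⊗[k] A, (rt X).hom.hom ((act₂ X (unit k A) t).hom.hom (v ⊗ₜ[k] y)) =
      actV X (cR k A (comul (1 : A) * t * 1 ⊗ₜ unitIncl k A y)) v := by
    intro t
    induction t with
    | zero => simp only [act₂_zero, mul_zero, zero_mul, map_zero]; rfl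
    | tmul p q =>
      rw [act₂_apply, rt_apply, unit_actV, unitIncl_unitProj, ← actV_mul, epsRR_epsLR, epsRR_apply,
        ← cR_mul_right, mul_assoc, mul_assoc, Algebra.TensorProduct.tmul_mul_tmul,
        Algebra.TensorProduct.tmul_mul_tmul, one_mul, mul_one, mul_one]
    | add s t hs ht =>
      rw [act₂_add, mul_add, add_mul, map_add, map_add, LinearMap.add_apply, ← hs, ← ht, ← map_add]
      rfl
  rw [key, comul_one_mul, cR_comul_mul, actV_mul]

lemma e_lt (X : FinRep k A) : e (unit k A) X ≫ lt X = lt X := by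
  rw [e, act₂_lt, act_one, Category.comp_id]
lemma e_lt_assoc (X : FinRep k A) {M : FGModuleCat.{u} k}
    (h : X.V ⟶ M) :
    e (unit k A) X ≫ lt X ≫ h = lt X ≫ h := by
  have t := congrArg (fun f => f ≫ h) (e_lt X)
  simpa only [Category.assoc] using t

lemma e_rt (X : FinRep k A) : e X (unit k A) ≫ rt X = rt X := by
  rw [e, act₂_rt, act_one, Category.comp_id]
lemma e_rt_assoc (X : FinRep k A) {M : FGModuleCat.{u} k}
    (h : X.V ⟶ M) :
    e X (unit k A) ≫ rt X ≫ h = rt X ≫ h := by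
  have t := congrArg (fun f => f ≫ h) (e_rt X)
  simpa only [Category.assoc] using t

variable (k A) in
/-- The map `k → Aˡ`, `1 ↦ 1`. -/
def unitMap : 𝟙_ (FGModuleCat.{u} k) ⟶ (unit k A).V :=
  FGModuleCat.ofHom (LinearMap.toSpanSingleton k ((unit k A).V) (unitProj k A 1))

lemma unitIncl_unitProj_one : unitIncl k A (unitProj k A 1) = 1 := by
  rw [unitIncl_unitProj, epsLR_one]

lemma unitMap_lt (X : FinRep k A) : unitMap k A ▷ X.V ≫ lt X = (λ_ X.V).hom := by
  apply tensor_hom_ext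
  intro c v
  change actV X (unitIncl k A ((c : k) • unitProj k A 1)) v = (c : k) • v
  rw [map_smul, unitIncl_unitProj_one, map_smul, LinearMap.smul_apply, actV_one]

lemma unitMap_rt (X : FinRep k A) : X.V ◁ unitMap k A ≫ rt X = (ρ_ X.V).hom := by
  apply tensor_hom_ext
  intro v c
  change actV X (epsRR k A (unitIncl k A ((c : k) • unitProj k A 1))) v = (c : k) • v
  rw [map_smul, unitIncl_unitProj_one, map_smul, map_smul, LinearMap.smul_apply, epsRR_one,
    actV_one]

lemma lt_inv (X : FinRep k A) :
    lt X ≫ (λ_ X.V).inv ≫ unitMap k A ▷ X.V ≫ e (unit k A) X = e (unit k A) X := by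
  apply tensor_hom_ext
  intro y v
  change (act₂ (unit k A) X (comul 1)).hom.hom
    (((1 : k) • unitProj k A 1) ⊗ₜ[k] actV X (unitIncl k A y) v) =
      (act₂ (unit k A) X (comul 1)).hom.hom (y ⊗ₜ[k] v)
  rw [one_smul]
  have h1 : ∀ t : A ⊗[k] A,
      (act₂ (unit k A) X t).hom.hom (unitProj k A 1 ⊗ₜ[k] actV X (unitIncl k A y) v) =
      TensorProduct.map (unitProj k A) ((actV X).flip v)
        (LinearMap.rTensor A (epsLR k A) (t * 1 ⊗ₜ unitIncl k A y)) := by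
    intro t
    induction t with
    | zero => simp only [act₂_zero, zero_mul, map_zero]; rfl
    | tmul p q =>
      rw [act₂_apply, unit_actV, unitIncl_unitProj_one, Algebra.TensorProduct.tmul_mul_tmul,
        LinearMap.rTensor_tmul, TensorProduct.map_tmul, unitProj_epsLR, LinearMap.flip_apply,
        actV_mul]
    | add s t hs ht => rw [act₂_add, add_mul, map_add, map_add, ← hs, ← ht]; rfl
  have h2 : ∀ t : A ⊗[k] A, (act₂ (unit k A) X t).hom.hom (y ⊗ₜ[k] v) =
      TensorProduct.map (unitProj k A) ((actV X).flip v)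
        (LinearMap.rTensor A (epsLR k A) (t * unitIncl k A y ⊗ₜ 1)) := by
    intro t
    induction t with
    | zero => simp only [act₂_zero, zero_mul, map_zero]; rfl
    | tmul p q =>
      rw [act₂_apply, unit_actV, Algebra.TensorProduct.tmul_mul_tmul,
        LinearMap.rTensor_tmul, TensorProduct.map_tmul, unitProj_epsLR, LinearMap.flip_apply,
        mul_one]
    | add s t hs ht => rw [act₂_add, add_mul, map_add, map_add, ← hs, ← ht]; rfl
  rw [h1, h2, ← epsLR_unitIncl, unit_left_aux]

lemma rt_inv (X : FinRep k A) :
    rt X ≫ (ρ_ X.V).inv ≫ X.V ◁ unitMap k A ≫ e X (unit k A) = e X (unit k A) := by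
  apply tensor_hom_ext
  intro v y
  change (act₂ X (unit k A) (comul 1)).hom.hom
    (actV X (epsRR k A (unitIncl k A y)) v ⊗ₜ[k] ((1 : k) • unitProj k A 1)) =
      (act₂ X (unit k A) (comul 1)).hom.hom (v ⊗ₜ[k] y)
  rw [one_smul]
  have h1 : ∀ t : A ⊗[k] A, (act₂ X (unit k A) t).hom.hom
        (actV X (epsRR k A (unitIncl k A y)) v ⊗ₜ[k] unitProj k A 1) =
      TensorProduct.map ((actV X).flip v) (unitProj k A)
        (LinearMap.lTensor A (epsLR k A) (t * epsRR k A (unitIncl k A y) ⊗ₜ 1)) := by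
    intro t
    induction t with
    | zero => simp only [act₂_zero, zero_mul, map_zero]; rfl
    | tmul p q =>
      rw [act₂_apply, unit_actV, unitIncl_unitProj_one, Algebra.TensorProduct.tmul_mul_tmul,
        LinearMap.lTensor_tmul, TensorProduct.map_tmul, unitProj_epsLR, LinearMap.flip_apply,
        actV_mul]
    | add s t hs ht => rw [act₂_add, add_mul, map_add, map_add, ← hs, ← ht]; rfl
  have h2 : ∀ t : A ⊗[k] A, (act₂ X (unit k A) t).hom.hom (v ⊗ₜ[k] y) =
      TensorProduct.map ((actV X).flip v) (unitProj k A)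
        (LinearMap.lTensor A (epsLR k A) (t * 1 ⊗ₜ unitIncl k A y)) := by
    intro t
    induction t with
    | zero => simp only [act₂_zero, zero_mul, map_zero]; rfl
    | tmul p q =>
      rw [act₂_apply, unit_actV, Algebra.TensorProduct.tmul_mul_tmul,
        LinearMap.lTensor_tmul, TensorProduct.map_tmul, unitProj_epsLR, LinearMap.flip_apply,
        mul_one]
    | add s t hs ht => rw [act₂_add, add_mul, map_add, map_add, ← hs, ← ht]; rfl
  rw [h1, h2, unit_right_aux]

lemma rt_lt (X Y : FinRep k A) :
    rt X ▷ Y.V ≫ e X Y = (α_ X.V (unit k A).V Y.V).hom ≫ X.V ◁ lt Y ≫ e X Y := by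
  have key : ∀ (t : A ⊗[k] A) (a b : A) (v : X.V) (w : Y.V),
      (act₂ X Y t).hom.hom (actV X a v ⊗ₜ[k] actV Y b w) =
        (act₂ X Y (t * a ⊗ₜ b)).hom.hom (v ⊗ₜ[k] w) := by
    intro t a b v w
    rw [act₂_mul, ← act₂_apply]
    rfl
  apply FGModuleCat.hom_ext
  apply TensorProduct.ext_threefold
  intro v y w
  change (act₂ X Y (comul 1)).hom.hom (actV X (epsRR k A (unitIncl k A y)) v ⊗ₜ[k] w) =
    (act₂ X Y (comul 1)).hom.hom (v ⊗ₜ[k] actV Y (unitIncl k A y) w)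
  have h1 := key (comul 1) (epsRR k A (unitIncl k A y)) 1 v w
  have h2 := key (comul 1) 1 (unitIncl k A y) v w
  rw [actV_one] at h1 h2
  rw [h1, h2, triangle_aux, epsLR_unitIncl]

/-- The left unitor: the restriction of `y ⊗ v ↦ y v`. -/
def leftUnitor (X : FinRep k A) : tensor (unit k A) X ≅ X :=
  mkIso ⟨ι (unit k A) X ≫ lt X, fun a => by
      rw [tensor_act_ι_assoc, act₂_lt, Category.assoc]⟩
    ((λ_ X.V).inv ≫ unitMap k A ▷ X.V ≫ π (unit k A) X)
    (by
      rw [← cancel_mono (ι (unit k A) X)]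
      simp only [Category.assoc, π_ι, lt_inv, Category.id_comp, ι_e])
    (by
      simp only [Category.assoc, π_ι_assoc, e_lt, unitMap_lt, Iso.inv_hom_id])

/-- The right unitor: the restriction of `v ⊗ y ↦ εʳʳ(y) v`. -/
def rightUnitor (X : FinRep k A) : tensor X (unit k A) ≅ X :=
  mkIso ⟨ι X (unit k A) ≫ rt X, fun a => by
      rw [tensor_act_ι_assoc, act₂_rt, Category.assoc]⟩
    ((ρ_ X.V).inv ≫ X.V ◁ unitMap k A ≫ π X (unit k A))
    (by
      rw [← cancel_mono (ι X (unit k A))]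
      simp only [Category.assoc, π_ι, rt_inv, Category.id_comp, ι_e])
    (by
      simp only [Category.assoc, π_ι_assoc, e_rt, unitMap_rt, Iso.inv_hom_id])


lemma assoc_hom_hom (X Y Z : FinRep k A) : (assoc X Y Z).hom.hom = assocHom X Y Z := rfl
lemma leftUnitor_hom_hom (X : FinRep k A) : (leftUnitor X).hom.hom = ι (unit k A) X ≫ lt X := rfl
lemma rightUnitor_hom_hom (X : FinRep k A) : (rightUnitor X).hom.hom = ι X (unit k A) ≫ rt X := rfl

lemma tensorMap_id (X Y : FinRep k A) : tensorMap (𝟙 X) (𝟙 Y) = 𝟙 (tensor X Y) := by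
  apply hom_ext
  rw [← cancel_mono (ι X Y), tensorMap_ι, id_hom, id_hom, id_hom,
    MonoidalCategory.id_tensorHom_id, Category.comp_id, Category.id_comp]

lemma tensorMap_comp {X X' X'' Y Y' Y'' : FinRep k A} (f : X ⟶ X') (f' : X' ⟶ X'') (g : Y ⟶ Y')
    (g' : Y' ⟶ Y'') : tensorMap f g ≫ tensorMap f' g' = tensorMap (f ≫ f') (g ≫ g') := by
  apply hom_ext
  rw [← cancel_mono (ι X'' Y''), comp_hom, Category.assoc, tensorMap_ι, tensorMap_ι_assoc,
    tensorMap_ι, comp_hom, comp_hom, MonoidalCategory.tensorHom_comp_tensorHom]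

lemma assoc_naturality {X X' Y Y' Z Z' : FinRep k A} (f : X ⟶ X') (g : Y ⟶ Y') (h : Z ⟶ Z') :
    tensorMap (tensorMap f g) h ≫ (assoc X' Y' Z').hom =
      (assoc X Y Z).hom ≫ tensorMap f (tensorMap g h) := by
  apply hom_ext
  have hL : (tensorMap (tensorMap f g) h).hom ≫ jL X' Y' Z' =
      jL X Y Z ≫ ((f.hom ⊗ₘ g.hom) ⊗ₘ h.hom) := by
    rw [jL, jL, tensorMap_ι_assoc, Category.assoc, ← MonoidalCategory.tensorHom_id,
      ← MonoidalCategory.tensorHom_id, MonoidalCategory.tensorHom_comp_tensorHom,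
      MonoidalCategory.tensorHom_comp_tensorHom, tensorMap_ι, Category.comp_id, Category.id_comp]
  have hR : (tensorMap f (tensorMap g h)).hom ≫ jR X' Y' Z' =
      jR X Y Z ≫ (f.hom ⊗ₘ (g.hom ⊗ₘ h.hom)) := by
    rw [jR, jR, tensorMap_ι_assoc, Category.assoc, ← MonoidalCategory.id_tensorHom,
      ← MonoidalCategory.id_tensorHom, MonoidalCategory.tensorHom_comp_tensorHom,
      MonoidalCategory.tensorHom_comp_tensorHom, tensorMap_ι, Category.comp_id, Category.id_comp]
  rw [← cancel_mono (jR X' Y' Z'), comp_hom, comp_hom, assoc_hom_hom, assoc_hom_hom,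
    Category.assoc, Category.assoc, assocHom_jR, hR, assocHom_jR_assoc, ← Category.assoc, hL,
    Category.assoc, MonoidalCategory.associator_naturality]

lemma leftUnitor_nat {X Y : FinRep k A} (f : X ⟶ Y) :
    tensorMap (𝟙 (unit k A)) f ≫ (leftUnitor Y).hom = (leftUnitor X).hom ≫ f := by
  apply hom_ext
  rw [comp_hom, comp_hom, leftUnitor_hom_hom, leftUnitor_hom_hom, tensorMap_ι_assoc,
    Category.assoc]
  congr 1
  apply tensor_hom_ext
  intro y v
  exact (congrArg (fun g : X.V ⟶ Y.V => g.hom.hom v) (f.comm (unitIncl k A y))).symm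

lemma rightUnitor_nat {X Y : FinRep k A} (f : X ⟶ Y) :
    tensorMap f (𝟙 (unit k A)) ≫ (rightUnitor Y).hom = (rightUnitor X).hom ≫ f := by
  apply hom_ext
  rw [comp_hom, comp_hom, rightUnitor_hom_hom, rightUnitor_hom_hom, tensorMap_ι_assoc,
    Category.assoc]
  congr 1
  apply tensor_hom_ext
  intro v y
  exact (congrArg (fun g : X.V ⟶ Y.V => g.hom.hom v) (f.comm (epsRR k A (unitIncl k A y)))).symm

lemma assoc_pentagon (W X Y Z : FinRep k A) :
    tensorMap (assoc W X Y).hom (𝟙 Z) ≫ (assoc W (tensor X Y) Z).hom ≫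
        tensorMap (𝟙 W) (assoc X Y Z).hom =
      (assoc (tensor W X) Y Z).hom ≫ (assoc W X (tensor Y Z)).hom := by
  apply hom_ext
  simp only [comp_hom, assoc_hom_hom]
  have hm : Mono (W.V ◁ (X.V ◁ ι Y Z)) := by
    have h : W.V ◁ (X.V ◁ ι Y Z) ≫ W.V ◁ (X.V ◁ π Y Z) = 𝟙 _ := by
      rw [← MonoidalCategory.whiskerLeft_comp, ← MonoidalCategory.whiskerLeft_comp, ι_π,
        MonoidalCategory.whiskerLeft_id, MonoidalCategory.whiskerLeft_id]
    exact mono_of_mono_fac h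
  rw [← cancel_mono (jR W X (tensor Y Z)), ← cancel_mono (W.V ◁ (X.V ◁ ι Y Z))]
  have h1 : (tensorMap (𝟙 W) (assoc X Y Z).hom).hom ≫ jR W X (tensor Y Z) ≫ W.V ◁ (X.V ◁ ι Y Z) =
      jR W (tensor X Y) Z ≫ W.V ◁ (ι X Y ▷ Z.V ≫ (α_ X.V Y.V Z.V).hom) := by
    rw [jR, Category.assoc, tensorMap_ι_assoc, id_hom, MonoidalCategory.id_tensorHom,
      ← MonoidalCategory.whiskerLeft_comp, ← MonoidalCategory.whiskerLeft_comp, assoc_hom_hom]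
    have := assocHom_jR X Y Z
    rw [jR, jL] at this
    rw [this, jR]
    simp only [MonoidalCategory.whiskerLeft_comp, Category.assoc]
  have h2 : (tensorMap (assoc W X Y).hom (𝟙 Z)).hom ≫ jL W (tensor X Y) Z ≫
      (W.V ◁ ι X Y) ▷ Z.V = ι (tensor (tensor W X) Y) Z ≫
        (ι (tensor W X) Y ≫ ι W X ▷ Y.V ≫ (α_ W.V X.V Y.V).hom) ▷ Z.V := by
    rw [jL, Category.assoc, tensorMap_ι_assoc, id_hom, MonoidalCategory.tensorHom_id,
      ← MonoidalCategory.comp_whiskerRight, ← MonoidalCategory.comp_whiskerRight, assoc_hom_hom]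
    have := assocHom_jR W X Y
    rw [jR, jL, Category.assoc] at this
    rw [this]
  have h3 : assocHom W X (tensor Y Z) ≫ jR W X (tensor Y Z) ≫ W.V ◁ (X.V ◁ ι Y Z) =
      jR (tensor W X) Y Z ≫ ι W X ▷ (Y.V ⊗ Z.V) ≫ (α_ W.V X.V (Y.V ⊗ Z.V)).hom := by
    rw [assocHom_jR_assoc, jL, jR, Category.assoc, Category.assoc,
      ← MonoidalCategory.associator_naturality_right,
      ← MonoidalCategory.whisker_exchange_assoc]
  calc _ = (tensorMap (assoc W X Y).hom (𝟙 Z)).hom ≫ assocHom W (tensor X Y) Z ≫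
        (tensorMap (𝟙 W) (assoc X Y Z).hom).hom ≫ jR W X (tensor Y Z) ≫ W.V ◁ (X.V ◁ ι Y Z) := by
        simp only [Category.assoc]
    _ = ((tensorMap (assoc W X Y).hom (𝟙 Z)).hom ≫ jL W (tensor X Y) Z ≫
          (W.V ◁ ι X Y) ▷ Z.V) ≫ (α_ W.V (X.V ⊗ Y.V) Z.V).hom ≫
            W.V ◁ (α_ X.V Y.V Z.V).hom := by
        rw [h1, assocHom_jR_assoc, MonoidalCategory.whiskerLeft_comp]
        simp only [Category.assoc, MonoidalCategory.associator_naturality_middle_assoc]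
    _ = jL (tensor W X) Y Z ≫ (ι W X ▷ Y.V) ▷ Z.V ≫ (α_ W.V X.V Y.V).hom ▷ Z.V ≫
          (α_ W.V (X.V ⊗ Y.V) Z.V).hom ≫ W.V ◁ (α_ X.V Y.V Z.V).hom := by
        rw [h2, jL]
        simp only [MonoidalCategory.comp_whiskerRight, Category.assoc]
    _ = jL (tensor W X) Y Z ≫ (ι W X ▷ Y.V) ▷ Z.V ≫ (α_ (W.V ⊗ X.V) Y.V Z.V).hom ≫
          (α_ W.V X.V (Y.V ⊗ Z.V)).hom := by
        rw [MonoidalCategory.pentagon]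
    _ = assocHom (tensor W X) Y Z ≫ assocHom W X (tensor Y Z) ≫ jR W X (tensor Y Z) ≫
          W.V ◁ (X.V ◁ ι Y Z) := by
        rw [h3, assocHom_jR_assoc, MonoidalCategory.associator_naturality_left_assoc]
    _ = _ := by simp only [Category.assoc]

lemma assoc_triangle (X Y : FinRep k A) :
    (assoc X (unit k A) Y).hom ≫ tensorMap (𝟙 X) (leftUnitor Y).hom =
      tensorMap (rightUnitor X).hom (𝟙 Y) := by
  apply hom_ext
  rw [← cancel_mono (ι X Y), comp_hom, Category.assoc, tensorMap_ι, tensorMap_ι, id_hom, id_hom,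
    MonoidalCategory.id_tensorHom, MonoidalCategory.tensorHom_id, leftUnitor_hom_hom,
    rightUnitor_hom_hom, assoc_hom_hom]
  have hL : qL X (unit k A) Y ≫ ι (tensor X (unit k A)) Y ≫ (ι X (unit k A) ≫ rt X) ▷ Y.V =
      rt X ▷ Y.V ≫ e X Y := by
    have h := act₂_natural (rightUnitor X).hom (𝟙 Y) (comul (R := k) (1 : A))
    rw [id_hom, MonoidalCategory.tensorHom_id, rightUnitor_hom_hom] at h
    rw [qL, Category.assoc, π_ι_assoc, e, h, ← MonoidalCategory.comp_whiskerRight_assoc,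
      π_ι_assoc, e_rt, e]
  have hR : qR X (unit k A) Y ≫ ι X (tensor (unit k A) Y) ≫ X.V ◁ (ι (unit k A) Y ≫ lt Y) =
      X.V ◁ lt Y ≫ e X Y := by
    have h := act₂_natural (𝟙 X) (leftUnitor Y).hom (comul (R := k) (1 : A))
    rw [id_hom, MonoidalCategory.id_tensorHom, leftUnitor_hom_hom] at h
    rw [qR, Category.assoc, π_ι_assoc, e, h, ← MonoidalCategory.whiskerLeft_comp_assoc,
      π_ι_assoc, e_lt, e]
  have h0 : Epi (qL X (unit k A) Y) := epi_of_epi_fac (jL_qL X (unit k A) Y)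
  rw [← cancel_epi (qL X (unit k A) Y), qL_assocHom_assoc, hL, hR, rt_lt]

instance : MonoidalCategoryStruct (FinRep k A) where
  tensorObj := tensor
  tensorHom := tensorMap
  whiskerLeft X _ _ f := tensorMap (𝟙 X) f
  whiskerRight f Y := tensorMap f (𝟙 Y)
  tensorUnit := unit k A
  associator := assoc
  leftUnitor := leftUnitor
  rightUnitor := rightUnitor

instance : MonoidalCategory (FinRep k A) := MonoidalCategory.ofTensorHom
  (id_tensorHom_id := tensorMap_id)
  (tensorHom_comp_tensorHom := fun f₁ f₂ g₁ g₂ => tensorMap_comp f₁ g₁ f₂ g₂)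
  (associator_naturality := assoc_naturality)
  (leftUnitor_naturality := leftUnitor_nat)
  (rightUnitor_naturality := rightUnitor_nat)
  (pentagon := assoc_pentagon)
  (triangle := assoc_triangle)

/-- The lax monoidal structure of the forgetful functor: the retractions and `1 ↦ 1`. -/
instance : (forget k A).LaxMonoidal where
  ε := unitMap k A
  μ := π
  μ_natural_left {X Y} f Z := by
    rw [← MonoidalCategory.tensorHom_id]
    exact (π_tensorMap f (𝟙 Z)).symm
  μ_natural_right {X Y} Z f := by
    rw [← MonoidalCategory.id_tensorHom]
    exact (π_tensorMap (𝟙 Z) f).symm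
  associativity X Y Z := by
    have h := qL_assocHom X Y Z
    rw [qL, qR, Category.assoc] at h
    exact h
  left_unitality X := by
    change _ = unitMap k A ▷ X.V ≫ π (unit k A) X ≫ ι (unit k A) X ≫ lt X
    rw [π_ι_assoc, e_lt, unitMap_lt]
    rfl
  right_unitality X := by
    change _ = X.V ◁ unitMap k A ≫ π X (unit k A) ≫ ι X (unit k A) ≫ rt X
    rw [π_ι_assoc, e_rt, unitMap_rt]
    rfl

variable (k A) in
/-- The restriction of the counit to `Aˡ`. -/
def unitCounit : (unit k A).V ⟶ 𝟙_ (FGModuleCat.{u} k) :=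
  FGModuleCat.ofHom (counit ∘ₗ unitIncl k A)

lemma lInv_counit (X : FinRep k A) :
    unitMap k A ▷ X.V ≫ e (unit k A) X ≫ unitCounit k A ▷ X.V = 𝟙 _ := by
  apply tensor_hom_ext
  intro c v
  change (unitCounit k A ▷ X.V).hom.hom ((act₂ (unit k A) X (comul 1)).hom.hom
    (((c : k) • unitProj k A 1) ⊗ₜ[k] v)) = (c : k) ⊗ₜ[k] v
  have key : ∀ t : A ⊗[k] A, (unitCounit k A ▷ X.V).hom.hom ((act₂ (unit k A) X t).hom.hom
    (((c : k) • unitProj k A 1) ⊗ₜ[k] v)) = (c : k) ⊗ₜ[k] actV X (cL k A t) v := by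
    intro t
    induction t with
    | zero => rw [act₂_zero, map_zero, map_zero, LinearMap.zero_apply, TensorProduct.tmul_zero]; rfl
    | tmul p q =>
      rw [act₂_apply, map_smul, unit_actV, unitIncl_unitProj_one, mul_one, cL_tmul, map_smul]
      change (counit (unitIncl k A ((c : k) • unitProj k A p)) : k) ⊗ₜ[k] actV X q v = _
      rw [map_smul, unitIncl_unitProj, map_smul, counit_epsLR, smul_eq_mul, LinearMap.smul_apply,
        ← TensorProduct.smul_tmul, smul_eq_mul, mul_comm]
    | add s t hs ht =>
      rw [act₂_add, map_add, map_add, LinearMap.add_apply, TensorProduct.tmul_add, ← hs, ← ht,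
        ← map_add]
      rfl
  rw [key, cL_comul, actV_one]

lemma rInv_counit (X : FinRep k A) :
    X.V ◁ unitMap k A ≫ e X (unit k A) ≫ X.V ◁ unitCounit k A = 𝟙 _ := by
  apply tensor_hom_ext
  intro v c
  change (X.V ◁ unitCounit k A).hom.hom ((act₂ X (unit k A) (comul 1)).hom.hom
    (v ⊗ₜ[k] ((c : k) • unitProj k A 1))) = v ⊗ₜ[k] (c : k)
  have key : ∀ t : A ⊗[k] A, (X.V ◁ unitCounit k A).hom.hom ((act₂ X (unit k A) t).hom.hom
    (v ⊗ₜ[k] ((c : k) • unitProj k A 1))) = actV X (cR k A t) v ⊗ₜ[k] (c : k) := by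
    intro t
    induction t with
    | zero => rw [act₂_zero, map_zero, map_zero, LinearMap.zero_apply, TensorProduct.zero_tmul]; rfl
    | tmul p q =>
      rw [act₂_apply, map_smul, unit_actV, unitIncl_unitProj_one, mul_one, cR_tmul, map_smul]
      change actV X p v ⊗ₜ[k] (counit (unitIncl k A ((c : k) • unitProj k A q)) : k) = _
      rw [map_smul, unitIncl_unitProj, map_smul, counit_epsLR, smul_eq_mul, LinearMap.smul_apply,
        TensorProduct.smul_tmul, smul_eq_mul, mul_comm]
    | add s t hs ht =>
      rw [act₂_add, map_add, map_add, LinearMap.add_apply, TensorProduct.add_tmul, ← hs, ← ht,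
        ← map_add]
      rfl
  rw [key, cR_comul, actV_one]

/-- The oplax monoidal structure of the forgetful functor: the inclusions and the counit. -/
instance : (forget k A).OplaxMonoidal where
  η := unitCounit k A
  δ := ι
  δ_natural_left {X Y} f Z := by
    rw [← MonoidalCategory.tensorHom_id]
    exact (tensorMap_ι f (𝟙 Z)).symm
  δ_natural_right {X Y} Z f := by
    rw [← MonoidalCategory.id_tensorHom]
    exact (tensorMap_ι (𝟙 Z) f).symm
  oplax_associativity X Y Z := by
    have h := assocHom_jR X Y Z
    rw [jL, jR, Category.assoc] at h
    exact h.symm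
  oplax_left_unitality X := by
    change _ = ((λ_ X.V).inv ≫ unitMap k A ▷ X.V ≫ π (unit k A) X) ≫ ι (unit k A) X ≫
      unitCounit k A ▷ X.V
    simp only [Category.assoc]
    rw [π_ι_assoc, lInv_counit, Category.comp_id]
    rfl
  oplax_right_unitality X := by
    change _ = ((ρ_ X.V).inv ≫ X.V ◁ unitMap k A ≫ π X (unit k A)) ≫ ι X (unit k A) ≫
      X.V ◁ unitCounit k A
    simp only [Category.assoc]
    rw [π_ι_assoc, rInv_counit, Category.comp_id]
    rfl

end Unit
end FinRep
end

/-- A weak Hopf algebra: a weak bialgebra with an antipode. -/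
class WeakHopfAlgebra (k : Type u) (A : Type w) [Field k] [Ring A] [Algebra k A] extends
    WeakBialgebra k A where
  /-- the antipode -/
  antipode : A →ₗ[k] A
  /-- `x₍₁₎ S(x₍₂₎) = ε(1₍₁₎ x) 1₍₂₎` -/
  mul_antipode : ∀ x : A, LinearMap.mul' k A (LinearMap.lTensor A antipode (comul x)) =
    WeakBialgebra.epsLR k A x
  /-- `S(x₍₁₎) x₍₂₎ = 1₍₁₎ ε(x 1₍₂₎)` -/
  antipode_mul : ∀ x : A, LinearMap.mul' k A (LinearMap.rTensor A antipode (comul x)) =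
    WeakBialgebra.epsRL k A x
  /-- `S(x₍₁₎) x₍₂₎ S(x₍₃₎) = S(x)` -/
  antipode_mul_antipode : ∀ x : A, LinearMap.mul' k A (TensorProduct.map antipode
    (LinearMap.mul' k A ∘ₗ LinearMap.lTensor A antipode ∘ₗ comul) (comul x)) = antipode x

section Functors

variable {C : Type w} [Category.{v} C] [MonoidalCategory C]
  {D : Type w'} [Category.{v'} D] [MonoidalCategory D]

open Functor.LaxMonoidal Functor.OplaxMonoidal

/-- A functor with a lax and an oplax monoidal structure is separable Frobenius if both Frobenius
conditions and the separability condition hold. -/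
structure IsSeparableFrobenius (F : C ⥤ D) [F.LaxMonoidal] [F.OplaxMonoidal] : Prop where
  frobenius_left : ∀ X Y Z : C,
    δ F X Y ▷ F.obj Z ≫ (α_ (F.obj X) (F.obj Y) (F.obj Z)).hom ≫ F.obj X ◁ μ F Y Z =
      μ F (X ⊗ Y) Z ≫ F.map (α_ X Y Z).hom ≫ δ F X (Y ⊗ Z)
  frobenius_right : ∀ X Y Z : C,
    F.obj X ◁ δ F Y Z ≫ (α_ (F.obj X) (F.obj Y) (F.obj Z)).inv ≫ μ F X Y ▷ F.obj Z =
      μ F X (Y ⊗ Z) ≫ F.map (α_ X Y Z).inv ≫ δ F (X ⊗ Y) Z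
  separable : ∀ X Y : C, δ F X Y ≫ μ F X Y = 𝟙 (F.obj (X ⊗ Y))

/-- A natural isomorphism compatible with the lax and the oplax monoidal structures. -/
structure IsSeparableFrobeniusIso {F G : C ⥤ D} [F.LaxMonoidal] [F.OplaxMonoidal]
    [G.LaxMonoidal] [G.OplaxMonoidal] (ξ : F ≅ G) : Prop where
  μ_comp : ∀ X Y : C,
    μ F X Y ≫ ξ.hom.app (X ⊗ Y) = (ξ.hom.app X ⊗ₘ ξ.hom.app Y) ≫ μ G X Y
  ε_comp : ε F ≫ ξ.hom.app (𝟙_ C) = ε G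
  δ_comp : ∀ X Y : C,
    δ F X Y ≫ (ξ.hom.app X ⊗ₘ ξ.hom.app Y) = ξ.hom.app (X ⊗ Y) ≫ δ G X Y
  η_comp : ξ.hom.app (𝟙_ C) ≫ η G = η F

end Functors

section Categories

variable (k : Type u) [Field k]

/-- A `k`-linear category is finite if it is `k`-linearly equivalent to the category of
finite-dimensional modules over a finite-dimensional `k`-algebra. -/
def IsFiniteLinearCategory (C : Type w) [Category.{v} C] [Preadditive C]
    [CategoryTheory.Linear k C] : Prop :=
  ∃ (B : Type u) (_ : Ring B) (_ : Algebra k B), Module.Finite k B ∧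
    ∃ E : C ⥤ FinRep k B, E.IsEquivalence ∧ E.Additive ∧ E.Linear k

/-- A finite multi-tensor category: a finite `k`-linear rigid monoidal category whose tensor product
is `k`-bilinear. -/
structure IsFiniteMultiTensorCategory (C : Type w) [Category.{v} C] [MonoidalCategory C]
    [Preadditive C] [CategoryTheory.Linear k C] : Prop where
  finite : IsFiniteLinearCategory k C
  [monoidalPreadditive : MonoidalPreadditive C]
  monoidalLinear : MonoidalLinear k C
  rigid : Nonempty (RigidCategory C)

/-- A weak fiber functor: a faithful exact `k`-linear separable Frobenius functor to
finite-dimensional vector spaces. -/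
structure IsWeakFiberFunctor {C : Type w} [Category.{v} C] [MonoidalCategory C]
    [Preadditive C] [CategoryTheory.Linear k C] (F : C ⥤ FGModuleCat.{u} k)
    [F.LaxMonoidal] [F.OplaxMonoidal] : Prop where
  additive : F.Additive
  linear : F.Linear k
  faithful : F.Faithful
  preservesFiniteLimits : Limits.PreservesFiniteLimits F
  preservesFiniteColimits : Limits.PreservesFiniteColimits F
  separableFrobenius : IsSeparableFrobenius F

end Categories

section Reconstruction

variable {k : Type u} [Field k] {C : Type w} [Category.{v} C]

/-- Evaluation of natural endomorphisms at an object. -/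
def evalEnd (F : C ⥤ FGModuleCat.{u} k) (X : C) : End F →ₐ[k] End (F.obj X) :=
  AlgHom.ofLinearMap
    { toFun := fun α => NatTrans.app α X
      map_add' := fun _ _ => rfl
      map_smul' := fun _ _ => rfl } rfl (fun _ _ => rfl)

/-- The comparison functor: `F(X)` with its evident action of `End F`. -/
def comparison (F : C ⥤ FGModuleCat.{u} k) : C ⥤ FinRep k (End F) where
  obj X := ⟨F.obj X, evalEnd F X⟩
  map f := ⟨F.map f, fun α => (NatTrans.naturality α f).symm⟩
  map_id X := FinRep.hom_ext (F.map_id X)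
  map_comp f g := FinRep.hom_ext (F.map_comp f g)

/-- The triangle of underlying functors commutes strictly. -/
theorem comparison_comp_forget (F : C ⥤ FGModuleCat.{u} k) :
    comparison F ⋙ FinRep.forget k (End F) = F := rfl

/-- The component of a natural endomorphism. -/
def endApp {F : C ⥤ FGModuleCat.{u} k} (α : End F) (X : C) : F.obj X ⟶ F.obj X := NatTrans.app α X

/-- The natural endomorphism `J(t)` of `F(X) ⊗ F(Y)` given by `t : End F ⊗ End F`. -/
def endApp₂ {F : C ⥤ FGModuleCat.{u} k} (t : End F ⊗[k] End F) (X Y : C) :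
    F.obj X ⊗ F.obj Y ⟶ F.obj X ⊗ F.obj Y :=
  FinRep.act₂ ((comparison F).obj X) ((comparison F).obj Y) t

/-- `J(α ⊗ β) = α_X ⊗ β_Y` -/
theorem endApp₂_tmul {F : C ⥤ FGModuleCat.{u} k} (α β : End F) (X Y : C) :
    endApp₂ (α ⊗ₜ[k] β) X Y = (endApp α X ⊗ₘ endApp β Y) :=
  FinRep.act₂_tmul _ _ _ _

variable [MonoidalCategory C]

open Functor.LaxMonoidal Functor.OplaxMonoidal

/-- The evaluation `F(Xᴸ) ⊗ F(X) → k` induced from a left dual `Xᴸ` of `X`. -/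
def evF (F : C ⥤ FGModuleCat.{u} k) [F.LaxMonoidal] [F.OplaxMonoidal] (X XL : C)
    [ExactPairing X XL] : F.obj XL ⊗ F.obj X ⟶ 𝟙_ (FGModuleCat.{u} k) :=
  μ F XL X ≫ F.map (ε_ X XL) ≫ η F

/-- The coevaluation `k → F(X) ⊗ F(Xᴸ)` induced from a left dual `Xᴸ` of `X`. -/
def coevF (F : C ⥤ FGModuleCat.{u} k) [F.LaxMonoidal] [F.OplaxMonoidal] (X XL : C)
    [ExactPairing X XL] : 𝟙_ (FGModuleCat.{u} k) ⟶ F.obj X ⊗ F.obj XL :=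
  ε F ≫ F.map (η_ X XL) ≫ δ F X XL

/-- The weak Hopf algebra structure `W` on the algebra `End F` is the reconstructed one, i.e. its
comultiplication, counit and antipode are those determined by the separable Frobenius functor `F`.
A left dual of `X` is an object `XL` with maps `1 → X ⊗ XL` and `XL ⊗ X → 1`, that is, an
`ExactPairing X XL`. -/
structure IsReconstructed (F : C ⥤ FGModuleCat.{u} k) [F.LaxMonoidal] [F.OplaxMonoidal]
    (W : WeakHopfAlgebra k (End F)) : Prop where
  comul : ∀ (α : End F) (X Y : C),
    endApp₂ (W.comul α) X Y = μ F X Y ≫ endApp α (X ⊗ Y) ≫ δ F X Y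
  counit : ∀ α : End F, W.counit α = (ε F ≫ endApp α (𝟙_ C) ≫ η F).hom.hom (1 : k)
  antipode : ∀ (α : End F) (X XL : C) [ExactPairing X XL],
    endApp (W.antipode α) X =
      (λ_ (F.obj X)).inv ≫ coevF F X XL ▷ F.obj X ≫
        (α_ (F.obj X) (F.obj XL) (F.obj X)).hom ≫
          F.obj X ◁ endApp α XL ▷ F.obj X ≫ F.obj X ◁ evF F X XL ≫ (ρ_ (F.obj X)).hom

/-- The comparison functor is a `k`-linear monoidal equivalence, for a strong monoidal structure such
that composing with the forgetful functor from representations gives `F` as separable Frobenius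
functor (equality on the nose). -/
def IsMonoidalComparison (F : C ⥤ FGModuleCat.{u} k) [Preadditive C] [CategoryTheory.Linear k C]
    [F.LaxMonoidal] [F.OplaxMonoidal] [Module.Finite k (End F)] [WeakHopfAlgebra k (End F)] : Prop :=
  (comparison F).IsEquivalence ∧ (comparison F).Additive ∧ (comparison F).Linear k ∧
    ∃ _ : (comparison F).Monoidal,
      ε (comparison F ⋙ FinRep.forget k (End F)) = ε F ∧
      (∀ X Y : C, μ (comparison F ⋙ FinRep.forget k (End F)) X Y = μ F X Y) ∧
      η (comparison F ⋙ FinRep.forget k (End F)) = η F ∧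
      (∀ X Y : C, δ (comparison F ⋙ FinRep.forget k (End F)) X Y = δ F X Y)

end Reconstruction

/-- Finite-dimensional weak Hopf algebras over `k`. -/
structure FinWeakHopfAlgebra (k : Type u) [Field k] where
  of ::
  carrier : Type w
  [ring : Ring carrier]
  [algebra : Algebra k carrier]
  [finite : Module.Finite k carrier]
  [weakHopf : WeakHopfAlgebra k carrier]

attribute [instance] FinWeakHopfAlgebra.ring FinWeakHopfAlgebra.algebra FinWeakHopfAlgebra.finite
  FinWeakHopfAlgebra.weakHopf

/-- Two weak Hopf algebras are isomorphic if there is a bijective linear map preserving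
multiplication, unit, comultiplication and counit. -/
def FinWeakHopfAlgebra.Isomorphic {k : Type u} [Field k] (A B : FinWeakHopfAlgebra.{u, w} k) : Prop :=
  Nonempty (A.carrier ≃ₐc[k] B.carrier)

/-- Pairs of a finite multi-tensor category and a weak fiber functor on it. -/
structure WeakFiberFunctor (k : Type u) [Field k] where
  of ::
  C : Type w
  [category : Category.{v} C]
  [monoidal : MonoidalCategory C]
  [preadditive : Preadditive C]
  [linear : CategoryTheory.Linear k C]
  F : C ⥤ FGModuleCat.{u} k
  [lax : F.LaxMonoidal]
  [oplax : F.OplaxMonoidal]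
  isFiniteMultiTensorCategory : IsFiniteMultiTensorCategory k C
  isWeakFiberFunctor : IsWeakFiberFunctor k F

attribute [instance] WeakFiberFunctor.category WeakFiberFunctor.monoidal
  WeakFiberFunctor.preadditive WeakFiberFunctor.linear WeakFiberFunctor.lax WeakFiberFunctor.oplax

/-- `(C, F)` and `(D, G)` are equivalent if there is a `k`-linear monoidal equivalence `Φ : C → D`
with `G Φ ≅ F` as separable Frobenius functors. -/
def WeakFiberFunctor.Equivalent {k : Type u} [Field k] (P Q : WeakFiberFunctor.{u, v, w} k) : Prop :=
  ∃ (Φ : P.C ⥤ Q.C) (_ : Φ.Monoidal), Φ.IsEquivalence ∧ Φ.Additive ∧ Φ.Linear k ∧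
    ∃ ξ : Φ ⋙ Q.F ≅ P.F, IsSeparableFrobeniusIso ξ

set_option linter.unusedSectionVars false

namespace FinRep

open Limits

noncomputable section

variable {k : Type u} {A : Type w} [Field k] [Ring A] [Algebra k A]

/-- The underlying space of a representation, as an `A`-module. -/
def Carrier (X : FinRep k A) : Type u := X.V

instance (X : FinRep k A) : AddCommGroup X.Carrier := inferInstanceAs (AddCommGroup X.V)
instance (X : FinRep k A) : Module k X.Carrier := inferInstanceAs (Module k X.V)
instance (X : FinRep k A) : Module.Finite k X.Carrier := inferInstanceAs (Module.Finite k X.V)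

/-- The action of an algebra on a representation, as an algebra homomorphism to linear maps. -/
def toLin (X : FinRep k A) : A →ₐ[k] Module.End k X.Carrier where
  toFun a := (X.act a).hom.hom
  map_one' := by rw [act_one]; rfl
  map_mul' a b := by rw [act_mul]; rfl
  map_zero' := by rw [act_zero]; rfl
  map_add' a b := by rw [act_add]; rfl
  commutes' c := by
    rw [Algebra.algebraMap_eq_smul_one, act_smul, act_one]; rfl

instance (X : FinRep k A) : Module A X.Carrier := Module.compHom X.Carrier X.toLin.toRingHom

lemma carrier_smul (X : FinRep k A) (a : A) (x : X.Carrier) : a • x = (X.act a).hom.hom x := rfl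

instance (X : FinRep k A) : IsScalarTower k A X.Carrier where
  smul_assoc c a x := by
    rw [carrier_smul, carrier_smul, act_smul]; rfl

instance (X : FinRep k A) : Module.Finite A X.Carrier := Module.Finite.of_restrictScalars_finite k A _

/-- A morphism of representations as an `A`-linear map. -/
def homLin {X Y : FinRep k A} (f : X ⟶ Y) : X.Carrier →ₗ[A] Y.Carrier where
  toFun x := f.hom.hom.hom x
  map_add' := map_add f.hom.hom.hom
  map_smul' a x := congrArg (fun g : X.V ⟶ Y.V => g.hom.hom x) (f.comm a)

/-- A morphism of representations from an `A`-linear map. -/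
def ofLin {X Y : FinRep k A} (f : X.Carrier →ₗ[A] Y.Carrier) : X ⟶ Y where
  hom := InducedCategory.homMk (ModuleCat.ofHom (f.restrictScalars k))
  comm a := FGModuleCat.hom_ext (LinearMap.ext fun x => f.map_smul a x)

variable (k A) in
/-- Representations as finitely generated `A`-modules. -/
def toFG : FinRep k A ⥤ FGModuleCat.{u} A where
  obj X := FGModuleCat.of A X.Carrier
  map f := FGModuleCat.ofHom (homLin f)

instance : (toFG k A).Faithful where
  map_injective {X Y _ _} h := hom_ext (FGModuleCat.hom_ext (LinearMap.ext fun x =>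
    congrArg (fun t : FGModuleCat.of A X.Carrier ⟶ FGModuleCat.of A Y.Carrier => t.hom.hom x) h))

instance : (toFG k A).Full where
  map_surjective f := ⟨ofLin f.hom.hom, rfl⟩

/-- The representation on a finite-dimensional `A`-module. -/
def ofModule (M : Type u) [AddCommGroup M] [Module k M] [Module.Finite k M] [Module A M]
    [IsScalarTower k A M] : FinRep k A where
  V := FGModuleCat.of k M
  ρ := AlgHom.ofLinearMap
    { toFun := fun a => FGModuleCat.ofHom (Algebra.lsmul k k M a)
      map_add' := fun a b => FGModuleCat.hom_ext (LinearMap.ext fun x => add_smul a b x)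
      map_smul' := fun c a => FGModuleCat.hom_ext (LinearMap.ext fun x => smul_assoc c a x) }
    (FGModuleCat.hom_ext (LinearMap.ext fun x => one_smul A x))
    (fun a b => FGModuleCat.hom_ext (LinearMap.ext fun x => mul_smul a b x))

instance [Module.Finite k A] : (toFG k A).EssSurj where
  mem_essImage M := by
    let _ : Module k M := Module.compHom M (algebraMap k A)
    have : IsScalarTower k A M := ⟨fun c a x => by
      rw [Algebra.smul_def, mul_smul]; rfl⟩
    have : Module.Finite k M := Module.Finite.trans A M
    let e : (ofModule (k := k) (A := A) M).Carrier ≃ₗ[A] M :=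
      { (AddEquiv.refl M) with map_smul' := fun _ _ => rfl }
    exact ⟨ofModule M, ⟨e.toFGModuleCatIso⟩⟩

instance [Module.Finite k A] : (toFG k A).IsEquivalence where

lemma isNoetherianRing_of_finite (k : Type u) (A : Type w) [Field k] [Ring A] [Algebra k A]
    [Module.Finite k A] : IsNoetherianRing A := isNoetherian_of_tower k inferInstance

instance [Module.Finite k A] : HasFiniteLimits (FinRep k A) :=
  have := isNoetherianRing_of_finite k A
  ⟨fun _ _ _ => Adjunction.hasLimitsOfShape_of_equivalence (toFG k A)⟩

instance [Module.Finite k A] : Abelian (FinRep k A) :=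
  have := isNoetherianRing_of_finite k A
  abelianOfEquivalence (toFG k A)

/-- The space underlying a representation is the restriction of scalars of its `A`-module. -/
def carrierIso (X : FinRep k A) : ModuleCat.of k X.Carrier ≅
    (ModuleCat.restrictScalars.{u} (algebraMap k A)).obj (ModuleCat.of A X.Carrier) :=
  LinearEquiv.toModuleIso <| @AddEquiv.toLinearEquiv k X.Carrier X.Carrier _ _ _ _
    ((ModuleCat.restrictScalars.{u} (algebraMap k A)).obj (ModuleCat.of A X.Carrier)).isModule
    (AddEquiv.refl X.Carrier) fun c x => (algebraMap_smul A c x).symm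

instance [Module.Finite k A] : HasFiniteBiproducts (FinRep k A) := Abelian.hasFiniteBiproducts

variable (k A) in
/-- The two ways of forgetting from representations to modules over the field agree. -/
def forgetIso : forget k A ⋙ forget₂ (FGModuleCat.{u} k) (ModuleCat.{u} k) ≅
    toFG k A ⋙ forget₂ (FGModuleCat.{u} A) (ModuleCat.{u} A) ⋙
      ModuleCat.restrictScalars (algebraMap k A) :=
  NatIso.ofComponents (fun X => carrierIso X) (fun _ => rfl)

lemma restrictScalars_map_exact {R : Type v} {S : Type w} [Ring R] [Ring S] (f : R →+* S)
    (T : ShortComplex (ModuleCat.{u} S)) (h : T.Exact) :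
    (T.map (ModuleCat.restrictScalars.{u} f)).Exact := by
  rw [ShortComplex.ShortExact.moduleCat_exact_iff_function_exact] at h ⊢
  exact h

instance restrictScalars_preservesFiniteLimits {R : Type v} {S : Type w} [Ring R] [Ring S]
    (f : R →+* S) : PreservesFiniteLimits (ModuleCat.restrictScalars.{u} f) := by
  have h := ((ModuleCat.restrictScalars.{u} f).exact_tfae.out 1 3).mp (restrictScalars_map_exact f)
  exact h.1

instance restrictScalars_preservesFiniteColimits {R : Type v} {S : Type w} [Ring R] [Ring S]
    (f : R →+* S) : PreservesFiniteColimits (ModuleCat.restrictScalars.{u} f) := by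
  have h := ((ModuleCat.restrictScalars.{u} f).exact_tfae.out 1 3).mp (restrictScalars_map_exact f)
  exact h.2

instance [Module.Finite k A] : PreservesFiniteLimits (forget k A) :=
  have := isNoetherianRing_of_finite k A
  have : PreservesFiniteLimits (forget₂ (FGModuleCat.{u} A) (ModuleCat.{u} A) ⋙
      ModuleCat.restrictScalars.{u} (algebraMap k A)) := comp_preservesFiniteLimits _ _
  have : PreservesFiniteLimits (toFG k A ⋙ forget₂ (FGModuleCat.{u} A) (ModuleCat.{u} A) ⋙
      ModuleCat.restrictScalars.{u} (algebraMap k A)) := comp_preservesFiniteLimits _ _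
  have : PreservesFiniteLimits (forget k A ⋙ forget₂ (FGModuleCat.{u} k) (ModuleCat.{u} k)) :=
    preservesFiniteLimits_of_natIso (forgetIso k A).symm
  preservesFiniteLimits_of_reflects_of_preserves _ (forget₂ (FGModuleCat.{u} k) (ModuleCat.{u} k))

instance [Module.Finite k A] : PreservesFiniteColimits (forget k A) :=
  have := isNoetherianRing_of_finite k A
  have : PreservesFiniteColimits (forget₂ (FGModuleCat.{u} A) (ModuleCat.{u} A) ⋙
      ModuleCat.restrictScalars.{u} (algebraMap k A)) := comp_preservesFiniteColimits _ _
  have : PreservesFiniteColimits (toFG k A ⋙ forget₂ (FGModuleCat.{u} A) (ModuleCat.{u} A) ⋙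
      ModuleCat.restrictScalars.{u} (algebraMap k A)) := comp_preservesFiniteColimits _ _
  have : PreservesFiniteColimits (forget k A ⋙ forget₂ (FGModuleCat.{u} k) (ModuleCat.{u} k)) :=
    preservesFiniteColimits_of_natIso (forgetIso k A).symm
  preservesFiniteColimits_of_reflects_of_preserves _ (forget₂ (FGModuleCat.{u} k) (ModuleCat.{u} k))

instance : (forget k A).Faithful where
  map_injective h := hom_ext h

instance : (forget k A).Additive where
  map_add := rfl

instance : (forget k A).Linear k where
  map_smul _ _ := rfl

/-- The coregular representation `Hom(B, k)`, with action `(b f)(x) = f(x b)`. -/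
def coregular (k : Type u) (B : Type u) [Field k] [Ring B] [Algebra k B] [Module.Finite k B] :
    FinRep k B where
  V := FGModuleCat.of k (Module.Dual k B)
  ρ := AlgHom.ofLinearMap
    { toFun := fun b => FGModuleCat.ofHom (LinearMap.mulRight k b).dualMap
      map_add' := fun b c => FGModuleCat.hom_ext (LinearMap.ext fun f => LinearMap.ext fun x => by
        change f (x * (b + c)) = f (x * b) + f (x * c)
        rw [mul_add, map_add])
      map_smul' := fun r b => FGModuleCat.hom_ext (LinearMap.ext fun f => LinearMap.ext fun x => by
        change f (x * (r • b)) = r • f (x * b)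
        rw [mul_smul_comm, map_smul]) }
    (FGModuleCat.hom_ext (LinearMap.ext fun f => LinearMap.ext fun x => by
      change f (x * 1) = f x
      rw [mul_one]))
    (fun b c => FGModuleCat.hom_ext (LinearMap.ext fun f => LinearMap.ext fun x => by
      change f (x * (b * c)) = f (x * b * c)
      rw [mul_assoc]))

/-- The morphism `y ↦ (x ↦ g(x y))` to the coregular representation given by a linear form. -/
def toCoregular {B : Type u} [Ring B] [Algebra k B] [Module.Finite k B] (Y : FinRep k B)
    (g : Module.Dual k Y.V) : Y ⟶ coregular k B where
  hom := FGModuleCat.ofHom ((LinearMap.compRight k g ∘ₗ (Y.toLin.toLinearMap.flip :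
    Y.V →ₗ[k] B →ₗ[k] Y.V) : Y.V →ₗ[k] Module.Dual k B))
  comm a := FGModuleCat.hom_ext (LinearMap.ext fun y => LinearMap.ext fun x => by
    change g (Y.toLin x (Y.toLin a y)) = g (Y.toLin (x * a) y)
    rw [map_mul]; rfl)

/-- Every representation embeds into a finite power of the coregular representation. -/
theorem exists_mono_coregular {B : Type u} [Ring B] [Algebra k B] [Module.Finite k B]
    (Y : FinRep k B) :
    ∃ (m : ℕ) (f : Y ⟶ ⨁ fun _ : Fin m => coregular k B), Mono f := by
  refine ⟨_, biproduct.lift fun i => toCoregular Y (Module.finBasis k (Module.Dual k Y.V) i),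
    Preadditive.mono_of_cancel_zero _ fun {Z} g hg => ?_⟩
  refine hom_ext (FGModuleCat.hom_ext (LinearMap.ext fun z => ?_))
  refine (Module.forall_dual_apply_eq_zero_iff k _).mp fun φ => ?_
  have h : ∀ i, Module.finBasis k (Module.Dual k Y.V) i (g.hom.hom.hom z) = 0 := fun i => by
    have h1 := congrArg (fun t => t ≫ biproduct.π _ i) hg
    simp only [Category.assoc, biproduct.lift_π, zero_comp] at h1
    have h2 := congrArg (fun t : Z ⟶ coregular k B => (show Module.Dual k B from t.hom.hom.hom z) 1) h1
    change Module.finBasis k (Module.Dual k Y.V) i (Y.toLin 1 (g.hom.hom.hom z)) = 0 at h2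
    rwa [map_one] at h2
  rw [← (Module.finBasis k (Module.Dual k Y.V)).sum_repr φ, LinearMap.sum_apply]
  exact Finset.sum_eq_zero fun i _ => by rw [LinearMap.smul_apply, h, smul_zero]

instance [Module.Finite k A] : (forget k A).ReflectsIsomorphisms :=
  reflectsIsomorphisms_of_reflectsMonomorphisms_of_reflectsEpimorphisms _

end

end FinRep

section Representability

open Limits

variable {k : Type u} [Field k] {C : Type w} [Category.{v} C]

section Exact

variable [Abelian C] (F : C ⥤ FGModuleCat.{u} k) [F.Additive]

/-- The linear map underlying the image of a morphism. -/
abbrev fmap {C : Type w} [Category.{v} C] (F : C ⥤ FGModuleCat.{u} k) {X Y : C} (f : X ⟶ Y) :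
    F.obj X →ₗ[k] F.obj Y := (F.map f).hom.hom

lemma fmap_comp {C : Type w} [Category.{v} C] (F : C ⥤ FGModuleCat.{u} k) {X Y Z : C}
    (f : X ⟶ Y) (g : Y ⟶ Z) (x : F.obj X) : fmap F (f ≫ g) x = fmap F g (fmap F f x) := by
  rw [fmap, F.map_comp]; rfl

lemma fmap_id {C : Type w} [Category.{v} C] (F : C ⥤ FGModuleCat.{u} k) {X : C}
    (x : F.obj X) : fmap F (𝟙 X) x = x := by
  rw [fmap, F.map_id]; rfl

lemma fmap_add {X Y : C} (f g : X ⟶ Y) (x : F.obj X) :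
    fmap F (f + g) x = fmap F f x + fmap F g x := by
  rw [fmap, F.map_add]; rfl

lemma fmap_zero {X Y : C} (x : F.obj X) : fmap F (0 : X ⟶ Y) x = 0 := by
  rw [fmap, F.map_zero]; rfl

lemma fmap_sum {X Y : C} {ι : Type} (s : Finset ι) (f : ι → (X ⟶ Y)) (x : F.obj X) :
    fmap F (∑ i ∈ s, f i) x = ∑ i ∈ s, fmap F (f i) x := by
  classical
  induction s using Finset.induction_on with
  | empty => simp only [Finset.sum_empty, fmap_zero]
  | insert i s hi ih => rw [Finset.sum_insert hi, Finset.sum_insert hi, fmap_add, ih]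

lemma fmap_injective [PreservesFiniteLimits F] {X Y : C} (f : X ⟶ Y) [Mono f] :
    Function.Injective (fmap F f) := by
  have h : Mono ((F ⋙ forget₂ (FGModuleCat.{u} k) (ModuleCat.{u} k)).map f) := inferInstance
  exact (ModuleCat.mono_iff_injective _).mp h

lemma exists_fmap_kernel_eq [PreservesFiniteLimits F] [PreservesFiniteColimits F] {X Y : C}
    (f : X ⟶ Y) (x : F.obj X) (hx : fmap F f x = 0) :
    ∃ y, fmap F (kernel.ι f) y = x := by
  have h1 : (ShortComplex.mk (kernel.ι f) f (kernel.condition f)).Exact :=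
    ShortComplex.exact_of_f_is_kernel _ (kernelIsKernel f)
  have h2 := h1.map (F ⋙ forget₂ (FGModuleCat.{u} k) (ModuleCat.{u} k))
  rw [ShortComplex.moduleCat_exact_iff] at h2
  exact h2 x hx

lemma isIso_of_fmap_bijective [F.Faithful] {X Y : C} (f : X ⟶ Y)
    (h : Function.Bijective (fmap F f)) : IsIso f := by
  have : IsIso (F.map f) := by
    have h1 : IsIso ((forget₂ (FGModuleCat.{u} k) (ModuleCat.{u} k)).map (F.map f)) :=
      (ConcreteCategory.isIso_iff_bijective _).mpr h
    exact isIso_of_reflects_iso (F.map f) (forget₂ (FGModuleCat.{u} k) (ModuleCat.{u} k))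
  have : F.ReflectsIsomorphisms :=
    reflectsIsomorphisms_of_reflectsMonomorphisms_of_reflectsEpimorphisms _
  exact isIso_of_reflects_iso f F

lemma epi_of_fmap_surjective [F.Faithful] {X Y : C} (f : X ⟶ Y)
    (h : Function.Surjective (fmap F f)) : Epi f := by
  have h1 : Epi ((F ⋙ forget₂ (FGModuleCat.{u} k) (ModuleCat.{u} k)).map f) :=
    (ModuleCat.epi_iff_surjective _).mpr h
  exact (F ⋙ forget₂ (FGModuleCat.{u} k) (ModuleCat.{u} k)).epi_of_epi_map h1

end Exact

/-- The pair `(P, p)` represents `F`: every element of `F X` is the image of `p` under a unique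
morphism `P ⟶ X`. -/
def Represents (F : C ⥤ FGModuleCat.{u} k) (P : C) (p : F.obj P) : Prop :=
  ∀ X, Function.Bijective (fun f : P ⟶ X => fmap F f p)

variable [Abelian C] [HasFiniteBiproducts C] [CategoryTheory.Linear k C]

lemma fmap_smul (F : C ⥤ FGModuleCat.{u} k) [F.Linear k] {X Y : C} (c : k) (f : X ⟶ Y)
    (x : F.obj X) : fmap F (c • f) x = c • fmap F f x := by
  rw [fmap, F.map_smul]; rfl

/-- An exact faithful functor to vector spaces on an abelian category in which every object embeds
into a power of a fixed object is representable. -/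
theorem exists_represents (F : C ⥤ FGModuleCat.{u} k) [F.Additive] [F.Linear k] [F.Faithful]
    [PreservesFiniteLimits F] [PreservesFiniteColimits F] (I : C)
    (hI : ∀ Y : C, ∃ (m : ℕ) (f : Y ⟶ ⨁ fun _ : Fin m => I), Mono f) :
    ∃ (P : C) (p : F.obj P), Represents F P p := by
  classical
  let b := Module.finBasis k (F.obj I)
  let Q := ⨁ fun _ : Fin (Module.finrank k (F.obj I)) => I
  let q : F.obj Q := ∑ i, fmap F (biproduct.ι _ i) (b i)
  have hq : ∀ i, fmap F (biproduct.π _ i) q = b i := fun i => by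
    rw [map_sum, Finset.sum_eq_single i]
    · rw [← fmap_comp, biproduct.ι_π_self, fmap_id]
    · intro j _ hj
      rw [← fmap_comp, biproduct.ι_π_ne _ hj, fmap_zero]
    · simp
  have hex : ∃ n, ∃ (P : C) (j : P ⟶ Q) (p : F.obj P), fmap F j p = q ∧
      Module.finrank k (F.obj P) = n := ⟨_, Q, 𝟙 Q, q, fmap_id F q, rfl⟩
  obtain ⟨P, j, p, hp, hn⟩ := Nat.find_spec hex
  have hmin : ∀ (P' : C) (m : P' ⟶ P) (p' : F.obj P'), Mono m → fmap F m p' = p → IsIso m := by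
    intro P' m p' _ hm
    have h1 : Module.finrank k (F.obj P) ≤ Module.finrank k (F.obj P') := by
      rw [hn]
      exact Nat.find_min' hex ⟨P', m ≫ j, p', by rw [fmap_comp, hm, hp], rfl⟩
    have h2 := LinearMap.finrank_le_finrank_of_injective (fmap_injective F m)
    exact isIso_of_fmap_bijective F m ⟨fmap_injective F m,
      (LinearMap.injective_iff_surjective_of_finrank_eq_finrank (le_antisymm h2 h1)).mp
        (fmap_injective F m)⟩
  have hinj : ∀ (X : C) (f : P ⟶ X), fmap F f p = 0 → f = 0 := by
    intro X f hf
    obtain ⟨y, hy⟩ := exists_fmap_kernel_eq F f p hf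
    have := hmin _ (kernel.ι f) y inferInstance hy
    rw [← cancel_epi (kernel.ι f), kernel.condition, comp_zero]
  have hI' : ∀ z : F.obj I, ∃ g : P ⟶ I, fmap F g p = z := by
    intro z
    refine ⟨∑ i, b.repr z i • (j ≫ biproduct.π _ i), ?_⟩
    rw [fmap_sum]
    conv_rhs => rw [← b.sum_repr z]
    refine Finset.sum_congr rfl fun i _ => ?_
    rw [fmap_smul, fmap_comp, hp, hq]
  refine ⟨P, p, fun X => ⟨fun f g h => ?_, fun y => ?_⟩⟩
  · rw [← sub_eq_zero]
    refine hinj X _ ?_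
    rw [sub_eq_add_neg, fmap_add, fmap, fmap, F.map_neg]
    change fmap F f p + - fmap F g p = 0
    rw [← sub_eq_add_neg, sub_eq_zero]
    exact h
  · obtain ⟨m, i, _⟩ := hI X
    choose g hg using fun j : Fin m => hI' (fmap F (biproduct.π _ j) (fmap F i y))
    have hG : fmap F (biproduct.lift g) p = fmap F i y := by
      have h1 : ∀ z : F.obj (⨁ fun _ : Fin m => I),
          z = ∑ j, fmap F (biproduct.π _ j ≫ biproduct.ι (fun _ : Fin m => I) j) z := fun z => by
        rw [← fmap_sum, biproduct.total, fmap_id]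
      rw [h1 (fmap F (biproduct.lift g) p), h1 (fmap F i y)]
      refine Finset.sum_congr rfl fun j _ => ?_
      rw [fmap_comp, ← fmap_comp F (biproduct.lift g), biproduct.lift_π, hg, ← fmap_comp]
    have h0 : biproduct.lift g ≫ cokernel.π i = 0 := hinj _ _ (by
      rw [fmap_comp, hG, ← fmap_comp, cokernel.condition, fmap_zero])
    refine ⟨Abelian.monoLift i (biproduct.lift g) h0, fmap_injective F i ?_⟩
    change fmap F i (fmap F _ p) = _
    rw [← fmap_comp, Abelian.monoLift_comp, hG]


section Comparison

variable {F : C ⥤ FGModuleCat.{u} k}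

lemma endApp_fmap {C : Type w} [Category.{v} C] {F : C ⥤ FGModuleCat.{u} k} (α : End F) {X Y : C}
    (f : X ⟶ Y) (x : F.obj X) :
    (endApp α Y).hom.hom (fmap F f x) = fmap F f ((endApp α X).hom.hom x) :=
  congrArg (fun g : F.obj X ⟶ F.obj Y => g.hom.hom x) (NatTrans.naturality α f)

variable {P : C} {p : F.obj P}

lemma Represents.exists_eq {C : Type w} [Category.{v} C] {F : C ⥤ FGModuleCat.{u} k} {P : C}
    {p : F.obj P} (hP : Represents F P p) {X : C} (x : F.obj X) : ∃ f : P ⟶ X, fmap F f p = x :=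
  (hP X).2 x

lemma Represents.end_ext {C : Type w} [Category.{v} C] {F : C ⥤ FGModuleCat.{u} k} {P : C}
    {p : F.obj P} (hP : Represents F P p) {α β : End F}
    (h : (endApp α P).hom.hom p = (endApp β P).hom.hom p) : α = β := by
  refine NatTrans.ext (funext fun X => FGModuleCat.hom_ext (LinearMap.ext fun x => ?_))
  obtain ⟨f, rfl⟩ := hP.exists_eq x
  change (endApp α X).hom.hom _ = (endApp β X).hom.hom _
  rw [endApp_fmap, endApp_fmap, h]

variable [F.Additive] [F.Linear k]

/-- The isomorphism `Hom(P, X) ≃ F X` given by a representing pair. -/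
noncomputable def Represents.homEquiv (hP : Represents F P p) (X : C) : (P ⟶ X) ≃ₗ[k] F.obj X :=
  LinearEquiv.ofBijective
    { toFun := fun f => fmap F f p
      map_add' := fun f g => fmap_add F f g p
      map_smul' := fun c f => fmap_smul F c f p } (hP X)

lemma Represents.homEquiv_apply (hP : Represents F P p) {X : C} (f : P ⟶ X) :
    hP.homEquiv X f = fmap F f p := rfl

/-- The natural endomorphism taking `p` to `z`. -/
noncomputable def Represents.toEnd (hP : Represents F P p) (z : F.obj P) : End F where
  app X := InducedCategory.homMk (ModuleCat.ofHom
    ({ toFun := fun f => fmap F f z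
       map_add' := fun f g => fmap_add F f g z
       map_smul' := fun c f => fmap_smul F c f z } ∘ₗ (hP.homEquiv X).symm.toLinearMap))
  naturality X Y g := FGModuleCat.hom_ext (LinearMap.ext fun x => by
    obtain ⟨f, rfl⟩ := hP.exists_eq x
    change fmap F ((hP.homEquiv Y).symm (fmap F g (fmap F f p))) z =
      fmap F g (fmap F ((hP.homEquiv X).symm (fmap F f p)) z)
    rw [← fmap_comp, ← fmap_comp, ← hP.homEquiv_apply, ← hP.homEquiv_apply,
      LinearEquiv.symm_apply_apply, LinearEquiv.symm_apply_apply])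

lemma Represents.toEnd_apply (hP : Represents F P p) (z : F.obj P) :
    (endApp (hP.toEnd z) P).hom.hom p = z := by
  have h : (hP.homEquiv P).symm p = 𝟙 P := (hP.homEquiv P).symm_apply_eq.mpr (fmap_id F p).symm
  change fmap F ((hP.homEquiv P).symm p) z = z
  rw [h, fmap_id]

/-- Evaluation at `p` is an isomorphism from `End F` to `F P`. -/
noncomputable def Represents.endEquiv (hP : Represents F P p) : End F ≃ₗ[k] F.obj P :=
  LinearEquiv.ofBijective
    ({ toFun := fun α => (endApp α P).hom.hom p
       map_add' := fun _ _ => rfl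
       map_smul' := fun _ _ => rfl } : End F →ₗ[k] F.obj P)
    ⟨fun _ _ h => hP.end_ext h, fun z => ⟨hP.toEnd z, hP.toEnd_apply z⟩⟩

lemma Represents.endEquiv_apply (hP : Represents F P p) (α : End F) :
    hP.endEquiv α = (endApp α P).hom.hom p := rfl

theorem Represents.finite_end (hP : Represents F P p) : Module.Finite k (End F) :=
  Module.Finite.equiv hP.endEquiv.symm

instance : (comparison F).Additive where
  map_add := FinRep.hom_ext F.map_add

instance [F.Faithful] : (comparison F).Faithful where
  map_injective h := F.map_injective (congrArg FinRep.Hom.hom h)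

/-- The canonical epimorphism from a power of the representing object. -/
noncomputable def Represents.cover (hP : Represents F P p) (X : C) :
    (⨁ fun _ : Fin (Module.finrank k (F.obj X)) => P) ⟶ X :=
  biproduct.desc fun i => (hP.homEquiv X).symm (Module.finBasis k (F.obj X) i)

lemma Represents.homEquiv_symm_spec (hP : Represents F P p) {X : C} (x : F.obj X) :
    fmap F ((hP.homEquiv X).symm x) p = x := (hP.homEquiv X).apply_symm_apply x

lemma Represents.fmap_desc (hP : Represents F P p) {X : C} {n : ℕ} (x : Fin n → F.obj X)
    (i : Fin n) : fmap F (biproduct.desc fun i => (hP.homEquiv X).symm (x i))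
      (fmap F (biproduct.ι (fun _ : Fin n => P) i) p) = x i := by
  rw [← fmap_comp, biproduct.ι_desc, hP.homEquiv_symm_spec]

lemma Represents.fmap_cover_surjective (hP : Represents F P p) (X : C) :
    Function.Surjective (fmap F (hP.cover X)) := by
  rw [← LinearMap.range_eq_top, eq_top_iff, ← (Module.finBasis k (F.obj X)).span_eq,
    Submodule.span_le]
  rintro _ ⟨i, rfl⟩
  exact ⟨_, hP.fmap_desc _ i⟩

/-- Two linear maps out of the image of a power of `P` agree if they agree on the translates of the
canonical generators. -/
lemma Represents.power_ext_linearMap (hP : Represents F P p) {n : ℕ} {M : Type*} [AddCommGroup M]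
    [Module k M] {φ ψ : F.obj (⨁ fun _ : Fin n => P) →ₗ[k] M}
    (h : ∀ (α : End F) (i : Fin n),
      φ ((endApp α _).hom.hom (fmap F (biproduct.ι (fun _ : Fin n => P) i) p)) =
        ψ ((endApp α _).hom.hom (fmap F (biproduct.ι (fun _ : Fin n => P) i) p))) : φ = ψ := by
  refine LinearMap.ext fun x => ?_
  have hx : x = ∑ j, fmap F (biproduct.π _ j ≫ biproduct.ι (fun _ : Fin n => P) j) x := by
    rw [← fmap_sum, biproduct.total, fmap_id]
  rw [hx, map_sum, map_sum]
  refine Finset.sum_congr rfl fun j _ => ?_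
  rw [fmap_comp, ← hP.toEnd_apply (fmap F (biproduct.π _ j) x), ← endApp_fmap]
  exact h _ j

/-- Two `End F`-linear maps out of the image of a power of `P` agree if they agree on the canonical
generators. -/
lemma Represents.power_ext (hP : Represents F P p) {n : ℕ} {M : FinRep k (End F)}
    {φ ψ : (comparison F).obj (⨁ fun _ : Fin n => P) ⟶ M}
    (h : ∀ i, φ.hom.hom.hom (fmap F (biproduct.ι (fun _ : Fin n => P) i) p) =
      ψ.hom.hom.hom (fmap F (biproduct.ι (fun _ : Fin n => P) i) p)) : φ = ψ := by
  have key : ∀ (χ : (comparison F).obj (⨁ fun _ : Fin n => P) ⟶ M) (α : End F)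
      (x : F.obj (⨁ fun _ : Fin n => P)), χ.hom.hom.hom ((endApp α _).hom.hom x) =
        (M.act α).hom.hom (χ.hom.hom.hom x) := fun χ α x =>
    congrArg (fun g : F.obj (⨁ fun _ : Fin n => P) ⟶ M.V => g.hom.hom x) (χ.comm α)
  refine FinRep.hom_ext (FGModuleCat.hom_ext (hP.power_ext_linearMap fun α j => ?_))
  exact (key φ _ _).trans ((congrArg _ (h j)).trans (key ψ _ _).symm)

variable [F.Faithful] [PreservesFiniteLimits F] [PreservesFiniteColimits F]

lemma Represents.epi_cover (hP : Represents F P p) (X : C) : Epi (hP.cover X) :=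
  epi_of_fmap_surjective F _ (hP.fmap_cover_surjective X)

theorem Represents.comparison_full (hP : Represents F P p) : (comparison F).Full where
  map_surjective {X Y} φ := by
    have := hP.epi_cover X
    let g : (⨁ fun _ : Fin (Module.finrank k (F.obj X)) => P) ⟶ Y :=
      biproduct.desc fun i =>
        (hP.homEquiv Y).symm (φ.hom.hom.hom (Module.finBasis k (F.obj X) i))
    have hg : (comparison F).map g = (comparison F).map (hP.cover X) ≫ φ := hP.power_ext fun i =>
      (hP.fmap_desc _ i).trans (congrArg φ.hom.hom.hom (hP.fmap_desc _ i)).symm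
    have h0 : kernel.ι (hP.cover X) ≫ g = 0 := (comparison F).map_injective (by
      rw [Functor.map_comp, hg, ← Functor.map_comp_assoc, kernel.condition, Functor.map_zero,
        Functor.map_zero, zero_comp])
    refine ⟨Abelian.epiDesc (hP.cover X) g h0, ?_⟩
    have h1 : (comparison F).map (hP.cover X) ≫ (comparison F).map (Abelian.epiDesc _ g h0) =
        (comparison F).map (hP.cover X) ≫ φ := by
      rw [← Functor.map_comp, Abelian.comp_epiDesc, hg]
    refine FinRep.hom_ext (FGModuleCat.hom_ext (LinearMap.ext fun x => ?_))
    obtain ⟨y, rfl⟩ := hP.fmap_cover_surjective X x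
    exact congrArg (fun t : (comparison F).obj _ ⟶ (comparison F).obj Y => t.hom.hom.hom y) h1

/-- The linear map `α ↦ α m` for an element `m` of a representation. -/
def _root_.FinRep.orbit {A : Type*} [Ring A] [Algebra k A] (M : FinRep k A) (m : M.V) :
    A →ₗ[k] M.V where
  toFun a := (M.act a).hom.hom m
  map_add' a b := by rw [FinRep.act_add]; rfl
  map_smul' c a := by rw [FinRep.act_smul]; rfl

/-- The linear map from a power of `P` to a representation with prescribed values on generators. -/
noncomputable def Represents.descLin (hP : Represents F P p) {n : ℕ} {M : FinRep k (End F)}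
    (m : Fin n → M.V) : F.obj (⨁ fun _ : Fin n => P) →ₗ[k] M.V :=
  ∑ i, (M.orbit (m i)) ∘ₗ hP.endEquiv.symm.toLinearMap ∘ₗ fmap F (biproduct.π _ i)

lemma Represents.descLin_apply (hP : Represents F P p) {n : ℕ} {M : FinRep k (End F)}
    (m : Fin n → M.V) (α : End F) (i : Fin n) :
    hP.descLin m ((endApp α _).hom.hom (fmap F (biproduct.ι (fun _ : Fin n => P) i) p)) =
      (M.act α).hom.hom (m i) := by
  rw [descLin, LinearMap.sum_apply, Finset.sum_eq_single i]
  · change M.orbit (m i) (hP.endEquiv.symm (fmap F _ _)) = _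
    rw [← endApp_fmap, ← fmap_comp, biproduct.ι_π_self, fmap_id, ← hP.endEquiv_apply,
      LinearEquiv.symm_apply_apply]
    rfl
  · intro j _ hj
    change M.orbit (m j) (hP.endEquiv.symm (fmap F _ _)) = _
    rw [← endApp_fmap, ← fmap_comp, biproduct.ι_π_ne _ hj.symm, fmap_zero, map_zero, map_zero,
      map_zero]
  · simp

/-- The `End F`-linear map from a power of `P` with prescribed values on the generators. -/
noncomputable def Represents.descRep (hP : Represents F P p) {n : ℕ} {M : FinRep k (End F)}
    (m : Fin n → M.V) : (comparison F).obj (⨁ fun _ : Fin n => P) ⟶ M where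
  hom := InducedCategory.homMk (ModuleCat.ofHom (hP.descLin m))
  comm α := FGModuleCat.hom_ext (hP.power_ext_linearMap fun β i => by
    change hP.descLin m ((endApp (α * β) _).hom.hom _) =
      (M.act α).hom.hom (hP.descLin m ((endApp β _).hom.hom _))
    rw [hP.descLin_apply, hP.descLin_apply, FinRep.act_mul]
    rfl)

lemma Represents.exists_descRep_surjective (hP : Represents F P p) (M : FinRep k (End F)) :
    ∃ (n : ℕ) (f : (comparison F).obj (⨁ fun _ : Fin n => P) ⟶ M),
      Function.Surjective f.hom.hom.hom := by
  refine ⟨_, hP.descRep (Module.finBasis k M.V), ?_⟩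
  change Function.Surjective (hP.descLin _)
  rw [← LinearMap.range_eq_top, eq_top_iff, ← (Module.finBasis k M.V).span_eq, Submodule.span_le]
  rintro _ ⟨i, rfl⟩
  refine ⟨_, (hP.descLin_apply _ 1 i).trans ?_⟩
  rw [FinRep.act_one]
  rfl

theorem Represents.comparison_essSurj (hP : Represents F P p) : (comparison F).EssSurj where
  mem_essImage M := by
    have := hP.finite_end
    have := hP.comparison_full
    have hepi : ∀ {X Y : FinRep k (End F)} (f : X ⟶ Y), Function.Surjective f.hom.hom.hom → Epi f :=
      fun f hf => epi_of_fmap_surjective (FinRep.forget k (End F)) f hf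
    obtain ⟨n, f, hf⟩ := hP.exists_descRep_surjective M
    obtain ⟨m, g, hg⟩ := hP.exists_descRep_surjective (kernel f)
    have := hepi f hf
    have := hepi g hg
    obtain ⟨h, hh⟩ := (comparison F).map_surjective (g ≫ kernel.ι f)
    have h1 : PreservesFiniteColimits (comparison F ⋙ FinRep.forget k (End F)) :=
      inferInstanceAs (PreservesFiniteColimits F)
    have : PreservesFiniteColimits (comparison F) :=
      have : ReflectsFiniteColimits (FinRep.forget k (End F)) :=
        { reflects := fun _ _ _ => reflectsColimitsOfShape_of_reflectsIsomorphisms }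
      preservesFiniteColimits_of_reflects_of_preserves _ (FinRep.forget k (End F))
    exact ⟨cokernel h, ⟨PreservesCokernel.iso (comparison F) h ≪≫ cokernelIsoOfEq hh ≪≫
      cokernelEpiComp g (kernel.ι f) ≪≫ asIso (Abelian.factorThruCoimage f)⟩⟩

theorem Represents.comparison_isEquivalence (hP : Represents F P p) :
    (comparison F).IsEquivalence where
  full := hP.comparison_full
  essSurj := hP.comparison_essSurj

end Comparison

end Representability

namespace FinRep

section TensorActions

variable {k : Type u} {A : Type w} [Field k] [Ring A] [Algebra k A]

/-- The action of `A ⊗ (A ⊗ A)` on a triple tensor product. -/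
def tripleAct (X Y Z : FinRep k A) : A ⊗[k] (A ⊗[k] A) →ₗ[k]
    (X.V ⊗ (Y.V ⊗ Z.V) ⟶ X.V ⊗ (Y.V ⊗ Z.V)) :=
  TensorProduct.lift (LinearMap.mk₂ k (fun a t => X.act a ⊗ₘ act₂ Y Z t)
    (by intro a b t; simp only [act_add, MonoidalPreadditive.add_tensor])
    (by intro c a t; simp only [act_smul, MonoidalCategory.tensorHom_def,
      MonoidalLinear.smul_whiskerRight, Linear.smul_comp])
    (by intro a s t; simp only [act₂_add, MonoidalPreadditive.tensor_add])
    (by intro c a t; simp only [act₂_smul, MonoidalCategory.tensorHom_def,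
      MonoidalLinear.whiskerLeft_smul, Linear.comp_smul]))

lemma tripleAct_tmul (X Y Z : FinRep k A) (a : A) (t : A ⊗[k] A) :
    tripleAct X Y Z (a ⊗ₜ t) = X.act a ⊗ₘ act₂ Y Z t := rfl

lemma tripleAct_mul (X Y Z : FinRep k A) (s t : A ⊗[k] (A ⊗[k] A)) :
    tripleAct X Y Z (s * t) = tripleAct X Y Z t ≫ tripleAct X Y Z s := by
  induction s with
  | zero => simp only [zero_mul, map_zero, Limits.comp_zero]
  | tmul a s =>
    induction t with
    | zero => simp only [mul_zero, map_zero, Limits.zero_comp]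
    | tmul b t =>
      rw [Algebra.TensorProduct.tmul_mul_tmul, tripleAct_tmul, tripleAct_tmul, tripleAct_tmul,
        MonoidalCategory.tensorHom_comp_tensorHom, act₂_mul, act_mul]
    | add x y hx hy => simp only [mul_add, map_add, hx, hy, Preadditive.add_comp]
  | add x y hx hy => simp only [add_mul, map_add, hx, hy, Preadditive.comp_add]

lemma tripleAct_assoc (X Y Z : FinRep k A) (t : A ⊗[k] A) (c : A) :
    tripleAct X Y Z (TensorProduct.assoc k A A A (t ⊗ₜ c)) =
      (α_ _ _ _).inv ≫ (act₂ X Y t ⊗ₘ Z.act c) ≫ (α_ _ _ _).hom := by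
  induction t with
  | zero => simp only [act₂_zero, MonoidalPreadditive.zero_tensor, TensorProduct.zero_tmul,
      map_zero, Limits.zero_comp, Limits.comp_zero]
  | tmul a b =>
    rw [TensorProduct.assoc_tmul, tripleAct_tmul, act₂_tmul, act₂_tmul,
      MonoidalCategory.associator_naturality, Iso.inv_hom_id_assoc]
  | add s t hs ht => simp only [act₂_add, MonoidalPreadditive.add_tensor, TensorProduct.add_tmul,
      map_add, Preadditive.add_comp, Preadditive.comp_add, hs, ht]

lemma tripleAct_lTensor (X Y Z W : FinRep k A) (Δ : A →ₗ[k] A ⊗[k] A) (m : Y.V ⊗ Z.V ⟶ W.V)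
    (d : W.V ⟶ Y.V ⊗ Z.V) (h : ∀ a, act₂ Y Z (Δ a) = m ≫ W.act a ≫ d) (t : A ⊗[k] A) :
    tripleAct X Y Z (LinearMap.lTensor A Δ t) = X.V ◁ m ≫ act₂ X W t ≫ X.V ◁ d := by
  induction t with
  | zero => simp only [act₂_zero, map_zero, Limits.zero_comp, Limits.comp_zero]
  | tmul a b =>
    rw [LinearMap.lTensor_tmul, tripleAct_tmul, act₂_tmul, h, ← id_tensorHom, ← id_tensorHom,
      tensorHom_comp_tensorHom, tensorHom_comp_tensorHom, Category.id_comp, Category.comp_id]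
  | add s t hs ht => simp only [map_add, act₂_add, hs, ht, Preadditive.add_comp,
      Preadditive.comp_add]

lemma tripleAct_rTensor (X Y Z W : FinRep k A) (Δ : A →ₗ[k] A ⊗[k] A) (m : X.V ⊗ Y.V ⟶ W.V)
    (d : W.V ⟶ X.V ⊗ Y.V) (h : ∀ a, act₂ X Y (Δ a) = m ≫ W.act a ≫ d) (t : A ⊗[k] A) :
    tripleAct X Y Z (TensorProduct.assoc k A A A (LinearMap.rTensor A Δ t)) =
      (α_ _ _ _).inv ≫ m ▷ Z.V ≫ act₂ W Z t ≫ d ▷ Z.V ≫ (α_ _ _ _).hom := by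
  induction t with
  | zero => simp only [act₂_zero, map_zero, Limits.zero_comp, Limits.comp_zero]
  | tmul a b =>
    rw [LinearMap.rTensor_tmul, tripleAct_assoc, act₂_tmul, h, ← tensorHom_id, ← tensorHom_id,
      tensorHom_comp_tensorHom_assoc, tensorHom_comp_tensorHom_assoc, Category.id_comp,
      Category.comp_id, Category.assoc]
  | add s t hs ht => simp only [map_add, act₂_add, hs, ht, Preadditive.add_comp,
      Preadditive.comp_add]

lemma act₂_tmul_apply (X Y : FinRep k A) (t : A ⊗[k] A) (x : X.V) (y : Y.V) :
    (act₂ X Y t).hom.hom (x ⊗ₜ[k] y) = TensorProduct.map (X.orbit x) (Y.orbit y) t := by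
  induction t with
  | zero => rw [act₂_zero, map_zero]; rfl
  | tmul a b => rw [act₂_tmul]; rfl
  | add s t hs ht => rw [map_add, ← hs, ← ht, act₂_add]; rfl

lemma tripleAct_tmul_apply (X Y Z : FinRep k A) (t : A ⊗[k] (A ⊗[k] A)) (x : X.V) (y : Y.V)
    (z : Z.V) : (tripleAct X Y Z t).hom.hom (x ⊗ₜ[k] (y ⊗ₜ[k] z)) =
      TensorProduct.map (X.orbit x) (TensorProduct.map (Y.orbit y) (Z.orbit z)) t := by
  induction t with
  | zero => rw [map_zero, map_zero]; rfl
  | tmul a b =>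
    rw [tripleAct_tmul, TensorProduct.map_tmul, ← act₂_tmul_apply]; rfl
  | add s t hs ht => rw [map_add, map_add, ← hs, ← ht]; rfl

lemma act₂_tmul_one (X Y : FinRep k A) (a : A) : act₂ X Y (a ⊗ₜ 1) = X.act a ▷ Y.V := by
  rw [act₂_tmul, act_one, tensorHom_id]

lemma act₂_one_tmul (X Y : FinRep k A) (a : A) : act₂ X Y (1 ⊗ₜ a) = X.V ◁ Y.act a := by
  rw [act₂_tmul, act_one, id_tensorHom]

section Counit

variable [CoalgebraStruct k A] {U : FinRep k A} {e : 𝟙_ _ ⟶ U.V} {h : U.V ⟶ 𝟙_ _}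

open CoalgebraStruct WeakBialgebra

lemma act_cL (he : ∀ a : A, counit (R := k) a • 𝟙 (𝟙_ (FGModuleCat.{u} k)) = e ≫ U.act a ≫ h)
    (X : FinRep k A) (t : A ⊗[k] A) :
    X.act (cL k A t) = (λ_ _).inv ≫ e ▷ X.V ≫ act₂ U X t ≫ h ▷ X.V ≫ (λ_ _).hom := by
  induction t with
  | zero => simp only [act₂_zero, act_zero, map_zero, Limits.zero_comp, Limits.comp_zero]
  | tmul a b =>
    have h1 : e ▷ X.V ≫ (U.act a ⊗ₘ X.act b) ≫ h ▷ X.V = counit (R := k) a • (𝟙_ _ ◁ X.act b) := by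
      rw [MonoidalCategory.tensorHom_def, Category.assoc, whisker_exchange, ← comp_whiskerRight_assoc,
        ← comp_whiskerRight_assoc, Category.assoc, ← he, MonoidalLinear.smul_whiskerRight,
        id_whiskerRight, Linear.smul_comp, Category.id_comp]
    have h2 := congrArg (fun f => (λ_ _).inv ≫ f ≫ (λ_ _).hom) h1
    simp only [Category.assoc, Linear.comp_smul, Linear.smul_comp, leftUnitor_naturality,
      Iso.inv_hom_id_assoc] at h2
    rw [cL_tmul, act_smul, act₂_tmul, h2]
  | add s t hs ht => simp only [map_add, act₂_add, act_add, hs, ht, Preadditive.add_comp,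
      Preadditive.comp_add]

lemma act_cR (he : ∀ a : A, counit (R := k) a • 𝟙 (𝟙_ (FGModuleCat.{u} k)) = e ≫ U.act a ≫ h)
    (X : FinRep k A) (t : A ⊗[k] A) :
    X.act (cR k A t) = (ρ_ _).inv ≫ X.V ◁ e ≫ act₂ X U t ≫ X.V ◁ h ≫ (ρ_ _).hom := by
  induction t with
  | zero => simp only [act₂_zero, act_zero, map_zero, Limits.zero_comp, Limits.comp_zero]
  | tmul a b =>
    have h1 : X.V ◁ e ≫ (X.act a ⊗ₘ U.act b) ≫ X.V ◁ h = counit (R := k) b • (X.act a ▷ 𝟙_ _) := by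
      rw [tensorHom_def', Category.assoc, ← whisker_exchange, ← whiskerLeft_comp_assoc,
        ← whiskerLeft_comp_assoc, Category.assoc, ← he, MonoidalLinear.whiskerLeft_smul,
        whiskerLeft_id, Linear.smul_comp, Category.id_comp]
    have h2 := congrArg (fun f => (ρ_ _).inv ≫ f ≫ (ρ_ _).hom) h1
    simp only [Category.assoc, Linear.comp_smul, Linear.smul_comp, rightUnitor_naturality,
      Iso.inv_hom_id_assoc] at h2
    rw [cR_tmul, act_smul, act₂_tmul, h2]
  | add s t hs ht => simp only [map_add, act₂_add, act_add, hs, ht, Preadditive.add_comp,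
      Preadditive.comp_add]

lemma counit_tensor_counit
    (he : ∀ a : A, counit (R := k) a • 𝟙 (𝟙_ (FGModuleCat.{u} k)) = e ≫ U.act a ≫ h)
    (f g : A →ₗ[k] A) (t : A ⊗[k] A) :
    LinearMap.mul' k k (TensorProduct.map (counit ∘ₗ f) (counit ∘ₗ g) t) • 𝟙 (𝟙_ (FGModuleCat.{u} k)) =
      (λ_ _).inv ≫ (e ⊗ₘ e) ≫ act₂ U U (TensorProduct.map f g t) ≫ (h ⊗ₘ h) ≫ (λ_ _).hom := by
  induction t with
  | zero => simp only [act₂_zero, zero_smul, map_zero, Limits.zero_comp, Limits.comp_zero]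
  | tmul a b =>
    rw [TensorProduct.map_tmul, TensorProduct.map_tmul, act₂_tmul,
      tensorHom_comp_tensorHom_assoc, tensorHom_comp_tensorHom_assoc, Category.assoc,
      Category.assoc, ← he, ← he, LinearMap.mul'_apply, MonoidalCategory.tensorHom_def,
      MonoidalLinear.smul_whiskerRight, MonoidalLinear.whiskerLeft_smul, id_whiskerRight,
      whiskerLeft_id, Linear.comp_smul, Linear.smul_comp, Linear.smul_comp, Category.comp_id,
      Linear.smul_comp, Linear.comp_smul, Linear.comp_smul, Category.id_comp, Iso.inv_hom_id,
      smul_smul, mul_comm]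
    rfl
  | add s t hs ht => simp only [map_add, act₂_add, add_smul, hs, ht, Preadditive.add_comp,
      Preadditive.comp_add]

end Counit

section Dual

variable {X XL : FinRep k A} {cv : 𝟙_ _ ⟶ X.V ⊗ XL.V} {ev : XL.V ⊗ X.V ⟶ 𝟙_ _} {S : A →ₗ[k] A}

lemma act_mul_lTensor (hS : ∀ a, X.act (S a) = (λ_ _).inv ≫ cv ▷ X.V ≫ (α_ _ _ _).hom ≫
      X.V ◁ (XL.act a ▷ X.V) ≫ X.V ◁ ev ≫ (ρ_ _).hom) (t : A ⊗[k] A) :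
    X.act (LinearMap.mul' k A (LinearMap.lTensor A S t)) =
      (λ_ _).inv ≫ (cv ≫ act₂ X XL t) ▷ X.V ≫ (α_ _ _ _).hom ≫ X.V ◁ ev ≫ (ρ_ _).hom := by
  induction t with
  | zero => simp only [act₂_zero, act_zero, map_zero, Limits.zero_comp, Limits.comp_zero,
      MonoidalPreadditive.zero_whiskerRight]
  | tmul a b =>
    rw [LinearMap.lTensor_tmul, LinearMap.mul'_apply, act_mul, hS, act₂_tmul, tensorHom_def']
    simp only [Category.assoc, comp_whiskerRight, ← rightUnitor_naturality,
      associator_naturality_left_assoc, whisker_exchange_assoc,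
      associator_naturality_middle_assoc]
  | add s t hs ht => simp only [map_add, act₂_add, act_add, hs, ht, Preadditive.add_comp,
      Preadditive.comp_add, MonoidalPreadditive.add_whiskerRight]

lemma act_mul_rTensor (hS : ∀ a, X.act (S a) = (λ_ _).inv ≫ cv ▷ X.V ≫ (α_ _ _ _).hom ≫
      X.V ◁ (XL.act a ▷ X.V) ≫ X.V ◁ ev ≫ (ρ_ _).hom) (t : A ⊗[k] A) :
    X.act (LinearMap.mul' k A (LinearMap.rTensor A S t)) =
      (λ_ _).inv ≫ cv ▷ X.V ≫ (α_ _ _ _).hom ≫ X.V ◁ (act₂ XL X t ≫ ev) ≫ (ρ_ _).hom := by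
  induction t with
  | zero => simp only [act₂_zero, act_zero, map_zero, Limits.zero_comp, Limits.comp_zero,
      MonoidalPreadditive.whiskerLeft_zero]
  | tmul a b =>
    rw [LinearMap.rTensor_tmul, LinearMap.mul'_apply, act_mul, hS, act₂_tmul, tensorHom_def',
      Category.assoc, whiskerLeft_comp, whiskerLeft_comp]
    simp only [Category.assoc, leftUnitor_inv_naturality_assoc,
      whisker_exchange_assoc, associator_naturality_right_assoc]
  | add s t hs ht => simp only [map_add, act₂_add, act_add, hs, ht, Preadditive.add_comp,
      Preadditive.comp_add, MonoidalPreadditive.whiskerLeft_add]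

end Dual

end TensorActions

end FinRep

/-- An action of an algebra `A` on a functor to vector spaces by natural endomorphisms. -/
structure NatAction (k : Type u) [Field k] (A : Type w') [Ring A] [Algebra k A] {C : Type w}
    [Category.{v} C] (F : C ⥤ FGModuleCat.{u} k) where
  ρ : ∀ X, A →ₐ[k] End (F.obj X)
  naturality' : ∀ {X Y : C} (f : X ⟶ Y) (a : A),
    F.map f ≫ (show F.obj Y ⟶ F.obj Y from ρ Y a) = (show F.obj X ⟶ F.obj X from ρ X a) ≫ F.map f

namespace NatAction

variable {k : Type u} [Field k] {A : Type w'} [Ring A] [Algebra k A] {C : Type w} [Category.{v} C]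
  {F : C ⥤ FGModuleCat.{u} k} (ρ : NatAction k A F)

/-- The representation of `A` on `F X`. -/
abbrev rep (X : C) : FinRep k A := ⟨F.obj X, ρ.ρ X⟩

/-- The action of an element on `F X`. -/
def app (a : A) (X : C) : F.obj X ⟶ F.obj X := ρ.ρ X a

/-- The action of `A ⊗ A` on `F X ⊗ F Y`. -/
def app₂ (t : A ⊗[k] A) (X Y : C) : F.obj X ⊗ F.obj Y ⟶ F.obj X ⊗ F.obj Y :=
  FinRep.act₂ (ρ.rep X) (ρ.rep Y) t

/-- The action of `A ⊗ (A ⊗ A)` on `F X ⊗ (F Y ⊗ F Z)`. -/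
def app₃ (t : A ⊗[k] (A ⊗[k] A)) (X Y Z : C) :
    F.obj X ⊗ (F.obj Y ⊗ F.obj Z) ⟶ F.obj X ⊗ (F.obj Y ⊗ F.obj Z) :=
  FinRep.tripleAct (ρ.rep X) (ρ.rep Y) (ρ.rep Z) t

lemma app_add (a b : A) (X : C) : ρ.app (a + b) X = ρ.app a X + ρ.app b X := map_add (ρ.ρ X) a b
lemma app_smul (c : k) (a : A) (X : C) : ρ.app (c • a) X = c • ρ.app a X := map_smul (ρ.ρ X) c a
lemma app_one (X : C) : ρ.app 1 X = 𝟙 _ := map_one (ρ.ρ X)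
lemma app_mul (a b : A) (X : C) : ρ.app (a * b) X = ρ.app b X ≫ ρ.app a X := map_mul (ρ.ρ X) a b

lemma naturality (a : A) {X Y : C} (f : X ⟶ Y) :
    F.map f ≫ ρ.app a Y = ρ.app a X ≫ F.map f := ρ.naturality' f a

lemma naturality_assoc (a : A) {X Y : C} (f : X ⟶ Y) {M : FGModuleCat.{u} k} (g : F.obj Y ⟶ M) :
    F.map f ≫ ρ.app a Y ≫ g = ρ.app a X ≫ F.map f ≫ g := by
  rw [← Category.assoc, ρ.naturality, Category.assoc]

lemma app₂_add (s t : A ⊗[k] A) (X Y : C) : ρ.app₂ (s + t) X Y = ρ.app₂ s X Y + ρ.app₂ t X Y :=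
  FinRep.act₂_add _ _ s t
lemma app₂_smul (c : k) (t : A ⊗[k] A) (X Y : C) : ρ.app₂ (c • t) X Y = c • ρ.app₂ t X Y :=
  FinRep.act₂_smul _ _ c t
lemma app₂_mul (s t : A ⊗[k] A) (X Y : C) :
    ρ.app₂ (s * t) X Y = ρ.app₂ t X Y ≫ ρ.app₂ s X Y := FinRep.act₂_mul _ _ s t
lemma app₂_tmul_one (a : A) (X Y : C) : ρ.app₂ (a ⊗ₜ 1) X Y = ρ.app a X ▷ F.obj Y :=
  FinRep.act₂_tmul_one _ _ a
lemma app₂_one_tmul (a : A) (X Y : C) : ρ.app₂ (1 ⊗ₜ a) X Y = F.obj X ◁ ρ.app a Y :=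
  FinRep.act₂_one_tmul _ _ a

/-- The action as a functor to representations. -/
def toRep : C ⥤ FinRep k A where
  obj := ρ.rep
  map f := ⟨F.map f, fun a => (ρ.naturality a f).symm⟩
  map_id X := FinRep.hom_ext (F.map_id X)
  map_comp f g := FinRep.hom_ext (F.map_comp f g)

lemma app₂_naturality (t : A ⊗[k] A) {X X' Y Y' : C} (f : X ⟶ X') (g : Y ⟶ Y') :
    ρ.app₂ t X Y ≫ (F.map f ⊗ₘ F.map g) = (F.map f ⊗ₘ F.map g) ≫ ρ.app₂ t X' Y' :=
  FinRep.act₂_natural (ρ.toRep.map f) (ρ.toRep.map g) t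

/-- The algebra consists of all natural endomorphisms of the functor, and its tensor powers act
faithfully on tensor powers of the functor, with full image for the tensor square. -/
structure IsFull : Prop where
  ext : ∀ {a b : A}, (∀ X, ρ.app a X = ρ.app b X) → a = b
  ext₂ : ∀ {s t : A ⊗[k] A}, (∀ X Y, ρ.app₂ s X Y = ρ.app₂ t X Y) → s = t
  ext₃ : ∀ {s t : A ⊗[k] (A ⊗[k] A)}, (∀ X Y Z, ρ.app₃ s X Y Z = ρ.app₃ t X Y Z) → s = t
  exists_app : ∀ β : ∀ X : C, F.obj X ⟶ F.obj X,
    (∀ {X Y : C} (f : X ⟶ Y), F.map f ≫ β Y = β X ≫ F.map f) → ∃ a, ∀ X, ρ.app a X = β X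
  exists_app₂ : ∀ β : ∀ X Y : C, F.obj X ⊗ F.obj Y ⟶ F.obj X ⊗ F.obj Y,
    (∀ {X X' Y Y' : C} (f : X ⟶ X') (g : Y ⟶ Y'),
      β X Y ≫ (F.map f ⊗ₘ F.map g) = (F.map f ⊗ₘ F.map g) ≫ β X' Y') →
    ∃ t, ∀ X Y, ρ.app₂ t X Y = β X Y

end NatAction

section ReconstructedCoalgebra

variable {k : Type u} [Field k] {A : Type w'} [Ring A] [Algebra k A] {C : Type w} [Category.{v} C]
  [MonoidalCategory C] {F : C ⥤ FGModuleCat.{u} k} [F.LaxMonoidal] [F.OplaxMonoidal]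
  (ρ : NatAction k A F)

open Functor.LaxMonoidal Functor.OplaxMonoidal WeakBialgebra

lemma smul_id_unit (f : 𝟙_ (FGModuleCat.{u} k) ⟶ 𝟙_ (FGModuleCat.{u} k)) :
    (f.hom.hom (1 : k) : k) • 𝟙 (𝟙_ (FGModuleCat.{u} k)) = f :=
  FGModuleCat.hom_ext (LinearMap.ext_ring (by
    change (f.hom.hom (1 : k) : k) • (1 : k) = f.hom.hom (1 : k)
    rw [smul_eq_mul, mul_one]))

lemma unit_smul_injective {a b : k}
    (h : a • 𝟙 (𝟙_ (FGModuleCat.{u} k)) = b • 𝟙 (𝟙_ (FGModuleCat.{u} k))) : a = b := by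
  have h1 : (a • (1 : k)) = b • (1 : k) := congrArg
    (fun f : 𝟙_ (FGModuleCat.{u} k) ⟶ 𝟙_ (FGModuleCat.{u} k) => (f.hom.hom (1 : k) : k)) h
  simpa using h1

/-- The comultiplication and the counit on `A` are determined by the separable Frobenius functor
`F`. -/
structure IsReconstructedCoalgebra [CoalgebraStruct k A] : Prop where
  comul : ∀ (α : A) (X Y : C),
    ρ.app₂ (CoalgebraStruct.comul (R := k) α) X Y = μ F X Y ≫ ρ.app α (X ⊗ Y) ≫ δ F X Y
  counit : ∀ α : A, CoalgebraStruct.counit (R := k) α • 𝟙 (𝟙_ (FGModuleCat.{u} k)) =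
    ε F ≫ ρ.app α (𝟙_ C) ≫ η F

variable [CoalgebraStruct k A]

namespace IsReconstructedCoalgebra

variable {ρ} (h : IsReconstructedCoalgebra ρ)

include h

lemma comul_one (X Y : C) : ρ.app₂ (CoalgebraStruct.comul (R := k) (1 : A)) X Y = μ F X Y ≫ δ F X Y := by
  rw [h.comul, ρ.app_one, Category.id_comp]

lemma endApp_cL (t : A ⊗[k] A) (X : C) : ρ.app (cL k A t) X =
    (λ_ _).inv ≫ ε F ▷ F.obj X ≫ ρ.app₂ t (𝟙_ C) X ≫ η F ▷ F.obj X ≫ (λ_ _).hom :=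
  FinRep.act_cL (U := ρ.rep (𝟙_ C)) h.counit (ρ.rep X) t

lemma endApp_cR (t : A ⊗[k] A) (X : C) : ρ.app (cR k A t) X =
    (ρ_ _).inv ≫ F.obj X ◁ ε F ≫ ρ.app₂ t X (𝟙_ C) ≫ F.obj X ◁ η F ≫ (ρ_ _).hom :=
  FinRep.act_cR (U := ρ.rep (𝟙_ C)) h.counit (ρ.rep X) t

lemma cL_comul (hρ : ρ.IsFull) (α : A) : cL k A (CoalgebraStruct.comul (R := k) α) = α := hρ.ext fun X => by
  rw [h.endApp_cL, h.comul]
  simp only [Category.assoc, left_unitality_hom, left_unitality_inv_assoc]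
  rw [← ρ.naturality, ← F.map_comp_assoc, Iso.inv_hom_id, F.map_id, Category.id_comp]

lemma cR_comul (hρ : ρ.IsFull) (α : A) : cR k A (CoalgebraStruct.comul (R := k) α) = α := hρ.ext fun X => by
  rw [h.endApp_cR, h.comul]
  simp only [Category.assoc, right_unitality_hom, right_unitality_inv_assoc]
  rw [← ρ.naturality, ← F.map_comp_assoc, Iso.inv_hom_id, F.map_id, Category.id_comp]

/-- `εˡʳ(α)` acts by multiplication by the element `α(1)` of `F 1`. -/
lemma endApp_epsLR (α : A) (X : C) : ρ.app (epsLR k A α) X =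
    (λ_ _).inv ≫ (ε F ≫ ρ.app α (𝟙_ C)) ▷ F.obj X ≫ μ F (𝟙_ C) X ≫ F.map (λ_ X).hom := by
  rw [epsLR_apply, h.endApp_cL, ρ.app₂_mul, h.comul_one,
    ρ.app₂_tmul_one]
  simp only [Category.assoc, left_unitality_hom, comp_whiskerRight]

lemma endApp_epsRL (α : A) (X : C) : ρ.app (epsRL k A α) X =
    F.map (ρ_ X).inv ≫ δ F X (𝟙_ C) ≫ F.obj X ◁ (ρ.app α (𝟙_ C) ≫ η F) ≫ (ρ_ _).hom := by
  rw [epsRL_apply, h.endApp_cR, ρ.app₂_mul, h.comul_one,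
    ρ.app₂_one_tmul]
  simp only [Category.assoc, right_unitality_inv_assoc, MonoidalCategory.whiskerLeft_comp]

lemma counit_tensor_counit (f g : A →ₗ[k] A) (t : A ⊗[k] A) :
    LinearMap.mul' k k (TensorProduct.map (CoalgebraStruct.counit ∘ₗ f)
      (CoalgebraStruct.counit ∘ₗ g) t) • 𝟙 (𝟙_ (FGModuleCat.{u} k)) =
    (λ_ _).inv ≫ (ε F ⊗ₘ ε F) ≫ ρ.app₂ (TensorProduct.map f g t) (𝟙_ C) (𝟙_ C) ≫
      (η F ⊗ₘ η F) ≫ (λ_ _).hom :=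
  FinRep.counit_tensor_counit (U := ρ.rep (𝟙_ C)) h.counit f g t

lemma counit_mul_left (x y z : A) :
    LinearMap.mul' k k (TensorProduct.map (CoalgebraStruct.counit ∘ₗ LinearMap.mulLeft k x)
      (CoalgebraStruct.counit ∘ₗ LinearMap.mulRight k z) (CoalgebraStruct.comul (R := k) y)) =
    CoalgebraStruct.counit (R := k) (x * y * z) := by
  apply unit_smul_injective
  have h1 : TensorProduct.map (LinearMap.mulLeft k x) (LinearMap.mulRight k z)
      (CoalgebraStruct.comul (R := k) y) =
      x ⊗ₜ 1 * (CoalgebraStruct.comul (R := k) y * 1 ⊗ₜ z) := by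
    generalize CoalgebraStruct.comul (R := k) y = t
    induction t with
    | zero => rw [map_zero, zero_mul, mul_zero]
    | tmul a b => simp only [TensorProduct.map_tmul, LinearMap.mulLeft_apply,
        LinearMap.mulRight_apply, Algebra.TensorProduct.tmul_mul_tmul, one_mul, mul_one]
    | add s t hs ht => rw [map_add, add_mul, mul_add, hs, ht]
  rw [h.counit_tensor_counit, h1, h.counit, ρ.app₂_mul, ρ.app₂_mul, h.comul,
    ρ.app₂_one_tmul, ρ.app₂_tmul_one, ρ.app_mul, ρ.app_mul]
  have h2 : (ε F ⊗ₘ ε F) ≫ F.obj (𝟙_ C) ◁ ρ.app z (𝟙_ C) ≫ μ F (𝟙_ C) (𝟙_ C) =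
      (λ_ _).hom ≫ ε F ≫ ρ.app z (𝟙_ C) ≫ F.map (λ_ (𝟙_ C)).inv := by
    rw [tensorHom_def', Category.assoc, ← whisker_exchange_assoc, ← left_unitality_inv]
    rw [← cancel_epi (λ_ (𝟙_ (FGModuleCat.{u} k))).inv, Iso.inv_hom_id_assoc]
    simp only [leftUnitor_inv_naturality_assoc]
  have h3 : δ F (𝟙_ C) (𝟙_ C) ≫ ρ.app x (𝟙_ C) ▷ F.obj (𝟙_ C) ≫ (η F ⊗ₘ η F) ≫ (λ_ _).hom =
      F.map (ρ_ (𝟙_ C)).hom ≫ ρ.app x (𝟙_ C) ≫ η F := by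
    rw [tensorHom_def', Category.assoc, ← whisker_exchange_assoc, unitors_equal,
      rightUnitor_naturality, rightUnitor_naturality_assoc, right_unitality_hom_assoc]
  simp only [Category.assoc] at h2 h3 ⊢
  rw [reassoc_of% h2, h3, Iso.inv_hom_id_assoc, ← unitors_equal, ρ.naturality_assoc y, ← F.map_comp_assoc, Iso.inv_hom_id, F.map_id, Category.id_comp]

lemma counit_mul_right (x y z : A) :
    LinearMap.mul' k k (TensorProduct.map (CoalgebraStruct.counit ∘ₗ LinearMap.mulRight k z)
      (CoalgebraStruct.counit ∘ₗ LinearMap.mulLeft k x) (CoalgebraStruct.comul (R := k) y)) = CoalgebraStruct.counit (R := k) (x * y * z) := by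
  apply unit_smul_injective
  have h1 : TensorProduct.map (LinearMap.mulRight k z) (LinearMap.mulLeft k x) (CoalgebraStruct.comul (R := k) y) =
      1 ⊗ₜ x * (CoalgebraStruct.comul (R := k) y * z ⊗ₜ 1) := by
    generalize CoalgebraStruct.comul (R := k) y = t
    induction t with
    | zero => rw [map_zero, zero_mul, mul_zero]
    | tmul a b => simp only [TensorProduct.map_tmul, LinearMap.mulLeft_apply,
        LinearMap.mulRight_apply, Algebra.TensorProduct.tmul_mul_tmul, one_mul, mul_one]
    | add s t hs ht => rw [map_add, add_mul, mul_add, hs, ht]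
  rw [h.counit_tensor_counit, h1, h.counit, ρ.app₂_mul, ρ.app₂_mul, h.comul,
    ρ.app₂_tmul_one,
    ρ.app₂_one_tmul, ρ.app_mul, ρ.app_mul]
  have h2 : (ε F ⊗ₘ ε F) ≫ ρ.app z (𝟙_ C) ▷ F.obj (𝟙_ C) ≫ μ F (𝟙_ C) (𝟙_ C) =
      (ρ_ _).hom ≫ ε F ≫ ρ.app z (𝟙_ C) ≫ F.map (ρ_ (𝟙_ C)).inv := by
    rw [MonoidalCategory.tensorHom_def, Category.assoc, whisker_exchange_assoc, ← right_unitality_inv]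
    rw [← cancel_epi (ρ_ (𝟙_ (FGModuleCat.{u} k))).inv, Iso.inv_hom_id_assoc]
    simp only [rightUnitor_inv_naturality_assoc]
  have h3 : δ F (𝟙_ C) (𝟙_ C) ≫ F.obj (𝟙_ C) ◁ ρ.app x (𝟙_ C) ≫ (η F ⊗ₘ η F) ≫ (λ_ _).hom =
      F.map (λ_ (𝟙_ C)).hom ≫ ρ.app x (𝟙_ C) ≫ η F := by
    rw [MonoidalCategory.tensorHom_def, Category.assoc, whisker_exchange_assoc,
      leftUnitor_naturality, leftUnitor_naturality_assoc, left_unitality_hom_assoc]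
  simp only [Category.assoc] at h2 h3 ⊢
  rw [reassoc_of% h2, h3, ← unitors_equal, Iso.inv_hom_id_assoc, unitors_equal (C := C),
    ρ.naturality_assoc y, ← F.map_comp_assoc, Iso.inv_hom_id, F.map_id, Category.id_comp]

end IsReconstructedCoalgebra

end ReconstructedCoalgebra

section ReconstructedWeakBialgebra

variable {k : Type u} [Field k] {A : Type w'} [Ring A] [Algebra k A] {C : Type w} [Category.{v} C]
  [MonoidalCategory C] {F : C ⥤ FGModuleCat.{u} k} [F.LaxMonoidal] [F.OplaxMonoidal]
  {ρ : NatAction k A F}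

open Functor.LaxMonoidal Functor.OplaxMonoidal WeakBialgebra

namespace IsReconstructedCoalgebra

variable [CoalgebraStruct k A] (h : IsReconstructedCoalgebra ρ)

include h

lemma app₃_lTensor_comul (t : A ⊗[k] A) (X Y Z : C) :
    ρ.app₃ (LinearMap.lTensor A CoalgebraStruct.comul t) X Y Z =
      F.obj X ◁ μ F Y Z ≫ ρ.app₂ t X (Y ⊗ Z) ≫ F.obj X ◁ δ F Y Z :=
  FinRep.tripleAct_lTensor (ρ.rep X) (ρ.rep Y) (ρ.rep Z) (ρ.rep (Y ⊗ Z)) _ _ _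
    (fun a => h.comul a Y Z) t

lemma app₃_rTensor_comul (t : A ⊗[k] A) (X Y Z : C) :
    ρ.app₃ (TensorProduct.assoc k A A A (LinearMap.rTensor A CoalgebraStruct.comul t)) X Y Z =
      (α_ _ _ _).inv ≫ μ F X Y ▷ F.obj Z ≫ ρ.app₂ t (X ⊗ Y) Z ≫ δ F X Y ▷ F.obj Z ≫
        (α_ _ _ _).hom :=
  FinRep.tripleAct_rTensor (ρ.rep X) (ρ.rep Y) (ρ.rep Z) (ρ.rep (X ⊗ Y)) _ _ _
    (fun a => h.comul a X Y) t

lemma app₃_lTensor_comul_comul (α : A) (X Y Z : C) :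
    ρ.app₃ (LinearMap.lTensor A CoalgebraStruct.comul (CoalgebraStruct.comul (R := k) α)) X Y Z =
      F.obj X ◁ μ F Y Z ≫ μ F X (Y ⊗ Z) ≫ ρ.app α (X ⊗ Y ⊗ Z) ≫ δ F X (Y ⊗ Z) ≫
        F.obj X ◁ δ F Y Z := by
  rw [h.app₃_lTensor_comul, h.comul]
  simp only [Category.assoc]

lemma coassoc (hρ : ρ.IsFull) (α : A) :
    TensorProduct.assoc k A A A (LinearMap.rTensor A CoalgebraStruct.comul
      (CoalgebraStruct.comul (R := k) α)) =
    LinearMap.lTensor A CoalgebraStruct.comul (CoalgebraStruct.comul (R := k) α) :=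
  hρ.ext₃ fun X Y Z => by
    rw [h.app₃_lTensor_comul_comul, h.app₃_rTensor_comul, h.comul]
    simp only [Category.assoc]
    rw [oplax_associativity, ← cancel_epi (α_ (F.obj X) (F.obj Y) (F.obj Z)).hom,
      Iso.hom_inv_id_assoc, ← ρ.naturality_assoc, Functor.LaxMonoidal.associativity_assoc]

lemma comul_mul (hρ : ρ.IsFull) (hF : IsSeparableFrobenius F) (x y : A) :
    CoalgebraStruct.comul (R := k) (x * y) =
      CoalgebraStruct.comul (R := k) x * CoalgebraStruct.comul (R := k) y :=
  hρ.ext₂ fun X Y => by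
    rw [ρ.app₂_mul, h.comul, h.comul, h.comul, ρ.app_mul]
    simp only [Category.assoc]
    rw [reassoc_of% hF.separable X Y]

lemma app₃_assoc_tmul_one (t : A ⊗[k] A) (X Y Z : C) :
    ρ.app₃ (TensorProduct.assoc k A A A (t ⊗ₜ (1 : A))) X Y Z =
      (α_ _ _ _).inv ≫ ρ.app₂ t X Y ▷ F.obj Z ≫ (α_ _ _ _).hom := by
  refine (FinRep.tripleAct_assoc (ρ.rep X) (ρ.rep Y) (ρ.rep Z) t 1).trans ?_
  rw [FinRep.act_one, tensorHom_id]
  rfl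

lemma app₃_one_tmul (t : A ⊗[k] A) (X Y Z : C) :
    ρ.app₃ ((1 : A) ⊗ₜ t) X Y Z = F.obj X ◁ ρ.app₂ t Y Z := by
  refine (FinRep.tripleAct_tmul (ρ.rep X) (ρ.rep Y) (ρ.rep Z) 1 t).trans ?_
  rw [FinRep.act_one, id_tensorHom]
  rfl

lemma app₃_mul (s t : A ⊗[k] (A ⊗[k] A)) (X Y Z : C) :
    ρ.app₃ (s * t) X Y Z = ρ.app₃ t X Y Z ≫ ρ.app₃ s X Y Z :=
  FinRep.tripleAct_mul (ρ.rep X) (ρ.rep Y) (ρ.rep Z) s t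

lemma comul_one_left (hρ : ρ.IsFull) (hF : IsSeparableFrobenius F) :
    TensorProduct.assoc k A A A (CoalgebraStruct.comul (R := k) (1 : A) ⊗ₜ[k] (1 : A)) *
      ((1 : A) ⊗ₜ[k] CoalgebraStruct.comul (R := k) (1 : A)) =
        LinearMap.lTensor A CoalgebraStruct.comul (CoalgebraStruct.comul (R := k) (1 : A)) :=
  hρ.ext₃ fun X Y Z => by
    rw [h.app₃_lTensor_comul_comul, h.app₃_mul, h.app₃_assoc_tmul_one, h.app₃_one_tmul,
      h.comul_one, h.comul_one, ρ.app_one, Category.id_comp, MonoidalCategory.whiskerLeft_comp,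
      comp_whiskerRight]
    simp only [Category.assoc]
    rw [reassoc_of% hF.frobenius_right X Y Z, oplax_associativity, ← F.map_comp_assoc,
      Iso.inv_hom_id, F.map_id, Category.id_comp]

lemma comul_one_right (hρ : ρ.IsFull) (hF : IsSeparableFrobenius F) :
    ((1 : A) ⊗ₜ[k] CoalgebraStruct.comul (R := k) (1 : A)) *
      TensorProduct.assoc k A A A (CoalgebraStruct.comul (R := k) (1 : A) ⊗ₜ[k] (1 : A)) =
        LinearMap.lTensor A CoalgebraStruct.comul (CoalgebraStruct.comul (R := k) (1 : A)) :=
  hρ.ext₃ fun X Y Z => by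
    rw [h.app₃_lTensor_comul_comul, h.app₃_mul, h.app₃_assoc_tmul_one, h.app₃_one_tmul,
      h.comul_one, h.comul_one, ρ.app_one, Category.id_comp, MonoidalCategory.whiskerLeft_comp,
      comp_whiskerRight]
    simp only [Category.assoc]
    rw [reassoc_of% hF.frobenius_left X Y Z, Functor.LaxMonoidal.associativity_assoc,
      Iso.inv_hom_id_assoc]

/-- The reconstructed coalgebra structure makes `A` a weak bialgebra. -/
@[reducible]
def weakBialgebra (hρ : ρ.IsFull) (hF : IsSeparableFrobenius F) : WeakBialgebra k A where
  coassoc := LinearMap.ext fun α => h.coassoc hρ α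
  rTensor_counit_comp_comul := LinearMap.ext fun α =>
    (TensorProduct.lid k A).injective ((h.cL_comul hρ α).trans (by simp))
  lTensor_counit_comp_comul := LinearMap.ext fun α =>
    (TensorProduct.rid k A).injective ((h.cR_comul hρ α).trans (by simp))
  comul_mul := h.comul_mul hρ hF
  counit_mul_left := h.counit_mul_left
  counit_mul_right := h.counit_mul_right
  comul_one_left := h.comul_one_left hρ hF
  comul_one_right := h.comul_one_right hρ hF

end IsReconstructedCoalgebra

lemma NatAction.IsFull.exists_isReconstructedCoalgebra (hρ : ρ.IsFull) :
    ∃ _ : CoalgebraStruct k A, IsReconstructedCoalgebra ρ := by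
  have hΔ (α : A) : ∃ t, ∀ X Y, ρ.app₂ t X Y = μ F X Y ≫ ρ.app α (X ⊗ Y) ≫ δ F X Y :=
    hρ.exists_app₂ _ fun f g => by
      simp only [Category.assoc]
      rw [δ_natural, ← ρ.naturality_assoc, μ_natural_assoc]
  choose Δ hΔ using hΔ
  let _ : CoalgebraStruct k A :=
  { comul :=
      { toFun := Δ
        map_add' := fun a b => hρ.ext₂ fun X Y => by
          rw [ρ.app₂_add, hΔ, hΔ, hΔ, ρ.app_add, Preadditive.add_comp, Preadditive.comp_add]
        map_smul' := fun c a => hρ.ext₂ fun X Y => by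
          rw [RingHom.id_apply, ρ.app₂_smul, hΔ, hΔ, ρ.app_smul, Linear.smul_comp,
            Linear.comp_smul] }
    counit :=
      { toFun := fun a => (ε F ≫ ρ.app a (𝟙_ C) ≫ η F).hom.hom (1 : k)
        map_add' := fun a b => by
          rw [ρ.app_add, Preadditive.add_comp, Preadditive.comp_add]; rfl
        map_smul' := fun c a => by
          rw [ρ.app_smul, Linear.smul_comp, Linear.comp_smul]; rfl } }
  exact ⟨inferInstance, { comul := hΔ, counit := fun α => smul_id_unit (ε F ≫ ρ.app α (𝟙_ C) ≫ η F) }⟩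

end ReconstructedWeakBialgebra

section Antipode

open Functor.LaxMonoidal Functor.OplaxMonoidal WeakBialgebra

/-- Dinaturality of the transpose of an endomorphism with respect to evaluations and
coevaluations. -/
lemma transpose_dinatural {V : Type w} [Category.{v} V] [MonoidalCategory V] {X XL Y YL : V}
    {cX : 𝟙_ V ⟶ X ⊗ XL} {eX : XL ⊗ X ⟶ 𝟙_ V} {cY : 𝟙_ V ⟶ Y ⊗ YL} {eY : YL ⊗ Y ⟶ 𝟙_ V}
    {f : X ⟶ Y} {g : YL ⟶ XL} {aX : XL ⟶ XL} {aY : YL ⟶ YL}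
    (hc : cY ≫ Y ◁ g = cX ≫ f ▷ XL) (he : g ▷ X ≫ eX = YL ◁ f ≫ eY) (ha : g ≫ aX = aY ≫ g) :
    ((λ_ X).inv ≫ cX ▷ X ≫ (α_ X XL X).hom ≫ X ◁ aX ▷ X ≫ X ◁ eX ≫ (ρ_ X).hom) ≫ f =
      f ≫ (λ_ Y).inv ≫ cY ▷ Y ≫ (α_ Y YL Y).hom ≫ Y ◁ aY ▷ Y ≫ Y ◁ eY ≫ (ρ_ Y).hom := by
  have h1 : Y ◁ g ▷ X ≫ Y ◁ aX ▷ X ≫ Y ◁ eX = Y ◁ YL ◁ f ≫ Y ◁ aY ▷ Y ≫ Y ◁ eY := by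
    rw [← whiskerLeft_comp, ← whiskerLeft_comp, ← whiskerLeft_comp, ← whiskerLeft_comp,
      ← comp_whiskerRight_assoc, ha, comp_whiskerRight_assoc, he, whisker_exchange_assoc]
  have h2 : cY ▷ X ≫ (Y ◁ g) ▷ X = cX ▷ X ≫ (f ▷ XL) ▷ X := by
    rw [← comp_whiskerRight, hc, comp_whiskerRight]
  simp only [Category.assoc]
  rw [← rightUnitor_naturality, whisker_exchange_assoc, whisker_exchange_assoc,
    ← associator_naturality_left_assoc, ← reassoc_of% h2, associator_naturality_middle_assoc,
    reassoc_of% h1, ← associator_naturality_right_assoc, ← whisker_exchange_assoc,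
    leftUnitor_inv_naturality_assoc]

variable {k : Type u} [Field k] {A : Type w'} [Ring A] [Algebra k A] {C : Type w} [Category.{v} C]
  [MonoidalCategory C] {F : C ⥤ FGModuleCat.{u} k} [F.LaxMonoidal] [F.OplaxMonoidal]
  {ρ : NatAction k A F}

lemma NatAction.app₂_zero (X Y : C) : ρ.app₂ 0 X Y = 0 := FinRep.act₂_zero _ _

lemma NatAction.app₂_tmul (a b : A) (X Y : C) :
    ρ.app₂ (a ⊗ₜ b) X Y = ρ.app a X ⊗ₘ ρ.app b Y := FinRep.act₂_tmul _ _ _ _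

variable (ρ) in
/-- The transpose of the action on a left dual. -/
def NatAction.transpose (α : A) (X XL : C) [ExactPairing X XL] : F.obj X ⟶ F.obj X :=
  (λ_ (F.obj X)).inv ≫ coevF F X XL ▷ F.obj X ≫ (α_ (F.obj X) (F.obj XL) (F.obj X)).hom ≫
    F.obj X ◁ ρ.app α XL ▷ F.obj X ≫ F.obj X ◁ evF F X XL ≫ (ρ_ (F.obj X)).hom

lemma NatAction.transpose_naturality (α : A) {X Y : C} (f : X ⟶ Y) (XL YL : C)
    [iX : ExactPairing X XL] [iY : ExactPairing Y YL] :
    F.map f ≫ ρ.transpose α Y YL = ρ.transpose α X XL ≫ F.map f := by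
  let _ : HasRightDual X := ⟨XL⟩
  let _ : HasRightDual Y := ⟨YL⟩
  let g : YL ⟶ XL := fᘁ
  have h1 : η_ Y YL ≫ Y ◁ g = η_ X XL ≫ f ▷ XL := coevaluation_comp_rightAdjointMate f
  have h2 : g ▷ X ≫ ε_ X XL = YL ◁ f ≫ ε_ Y YL := rightAdjointMate_comp_evaluation f
  refine (transpose_dinatural (g := F.map g) ?_ ?_ (ρ.naturality α g)).symm
  · simp only [coevF, Category.assoc]
    rw [δ_natural_right, δ_natural_left, ← F.map_comp_assoc, h1, F.map_comp_assoc]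
  · simp only [evF]
    rw [μ_natural_left_assoc, μ_natural_right_assoc, ← F.map_comp_assoc, h2, F.map_comp_assoc]

lemma NatAction.transpose_eq (α : A) (X XL XL' : C) [ExactPairing X XL] [ExactPairing X XL'] :
    ρ.transpose α X XL = ρ.transpose α X XL' := by
  simpa using (ρ.transpose_naturality α (𝟙 X) XL' XL)

/-- The composite of a coevaluation and an evaluation, with the unit and counit of `F` replaced by
arbitrary morphisms. -/
lemma IsSeparableFrobenius.coev_ev (hF : IsSeparableFrobenius F) (X XL : C) [ExactPairing X XL]
    (u : 𝟙_ (FGModuleCat.{u} k) ⟶ F.obj (𝟙_ C)) (w : F.obj (𝟙_ C) ⟶ 𝟙_ (FGModuleCat.{u} k)) :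
    (u ≫ F.map (η_ X XL) ≫ δ F X XL) ▷ F.obj X ≫ (α_ (F.obj X) (F.obj XL) (F.obj X)).hom ≫
      F.obj X ◁ (μ F XL X ≫ F.map (ε_ X XL) ≫ w) =
    u ▷ F.obj X ≫ μ F (𝟙_ C) X ≫ F.map (λ_ X).hom ≫ F.map (ρ_ X).inv ≫ δ F X (𝟙_ C) ≫
      F.obj X ◁ w := by
  have h := ExactPairing.evaluation_coevaluation X XL
  simp only [comp_whiskerRight, MonoidalCategory.whiskerLeft_comp, Category.assoc]
  rw [reassoc_of% hF.frobenius_left X XL X, δ_natural_right_assoc, μ_natural_left_assoc,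
    ← F.map_comp_assoc, ← F.map_comp_assoc, Category.assoc, h, F.map_comp_assoc]

/-- Right and left multiplication by an element of `F 1` agree on `μ`. -/
lemma unit_middle (X Y : C) (u : 𝟙_ (FGModuleCat.{u} k) ⟶ F.obj (𝟙_ C)) :
    F.obj Y ◁ ((λ_ _).inv ≫ u ▷ F.obj X ≫ μ F (𝟙_ C) X ≫ F.map (λ_ X).hom) ≫ μ F Y X =
      ((ρ_ _).inv ≫ F.obj Y ◁ u ≫ μ F Y (𝟙_ C) ≫ F.map (ρ_ Y).hom) ▷ F.obj X ≫ μ F Y X := by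
  simp only [comp_whiskerRight, MonoidalCategory.whiskerLeft_comp, Category.assoc]
  rw [μ_natural_right, μ_natural_left, ← MonoidalCategory.triangle, F.map_comp,
    Functor.LaxMonoidal.associativity_assoc, associator_naturality_middle_assoc]
  simp only [triangle_assoc_comp_right_inv_assoc]

variable [CoalgebraStruct k A]

namespace IsReconstructedCoalgebra

variable (h : IsReconstructedCoalgebra ρ) (hρ : ρ.IsFull) (hF : IsSeparableFrobenius F)
  {S : A →ₗ[k] A} (hS : ∀ X : C, ∃ (XL : C) (_ : ExactPairing X XL),
    ∀ α, ρ.app (S α) X = ρ.transpose α X XL)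

include h hF

lemma coevF_app₂ (α : A) (X XL : C) [ExactPairing X XL] :
    coevF F X XL ≫ ρ.app₂ (CoalgebraStruct.comul (R := k) α) X XL =
      (ε F ≫ ρ.app α (𝟙_ C)) ≫ F.map (η_ X XL) ≫ δ F X XL := by
  rw [h.comul, coevF]
  simp only [Category.assoc]
  rw [reassoc_of% hF.separable X XL, ρ.naturality_assoc]

lemma app₂_evF (α : A) (X XL : C) [ExactPairing X XL] :
    ρ.app₂ (CoalgebraStruct.comul (R := k) α) XL X ≫ evF F X XL =
      μ F XL X ≫ F.map (ε_ X XL) ≫ ρ.app α (𝟙_ C) ≫ η F := by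
  rw [h.comul, evF]
  simp only [Category.assoc]
  rw [reassoc_of% hF.separable XL X, ρ.naturality_assoc]

omit hF in
lemma app₂_lTensor_epsLR (t : A ⊗[k] A) (X Y : C) :
    ρ.app₂ (LinearMap.lTensor A (epsLR k A) t) Y X ≫ μ F Y X =
      ((ρ_ _).inv ≫ F.obj Y ◁ ε F ≫ ρ.app₂ t Y (𝟙_ C) ≫ μ F Y (𝟙_ C) ≫ F.map (ρ_ Y).hom) ▷
        F.obj X ≫ μ F Y X := by
  induction t with
  | zero => simp only [map_zero, ρ.app₂_zero, Limits.zero_comp, Limits.comp_zero,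
      MonoidalPreadditive.zero_whiskerRight]
  | tmul a b =>
    rw [LinearMap.lTensor_tmul, ρ.app₂_tmul, ρ.app₂_tmul, MonoidalCategory.tensorHom_def,
      MonoidalCategory.tensorHom_def, Category.assoc, h.endApp_epsLR, unit_middle]
    simp only [Category.assoc, whisker_exchange_assoc, MonoidalCategory.whiskerLeft_comp,
      comp_whiskerRight, ← rightUnitor_inv_naturality_assoc]
  | add s t hs ht => simp only [map_add, ρ.app₂_add, hs, ht, Preadditive.add_comp,
      Preadditive.comp_add, MonoidalPreadditive.add_whiskerRight]

include hS hρ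

lemma mul_antipode (α : A) :
    LinearMap.mul' k A (LinearMap.lTensor A S (CoalgebraStruct.comul α)) = epsLR k A α :=
  hρ.ext fun X => by
    obtain ⟨XL, _, hX⟩ := hS X
    refine (FinRep.act_mul_lTensor (X := ρ.rep X) (XL := ρ.rep XL) hX _).trans ?_
    change (λ_ (F.obj X)).inv ≫ (coevF F X XL ≫
      ρ.app₂ (CoalgebraStruct.comul (R := k) α) X XL) ▷ F.obj X ≫
        (α_ (F.obj X) (F.obj XL) (F.obj X)).hom ≫ F.obj X ◁ evF F X XL ≫ (ρ_ (F.obj X)).hom = _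
    rw [h.coevF_app₂ hF, evF, reassoc_of% hF.coev_ev X XL, right_unitality_hom, h.endApp_epsLR,
      ← F.map_comp, Iso.inv_hom_id, F.map_id, Category.comp_id]

lemma antipode_mul (α : A) :
    LinearMap.mul' k A (LinearMap.rTensor A S (CoalgebraStruct.comul α)) = epsRL k A α :=
  hρ.ext fun X => by
    obtain ⟨XL, _, hX⟩ := hS X
    refine (FinRep.act_mul_rTensor (X := ρ.rep X) (XL := ρ.rep XL) hX _).trans ?_
    change (λ_ (F.obj X)).inv ≫ coevF F X XL ▷ F.obj X ≫
        (α_ (F.obj X) (F.obj XL) (F.obj X)).hom ≫ F.obj X ◁ (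
      ρ.app₂ (CoalgebraStruct.comul (R := k) α) XL X ≫ evF F X XL) ≫ (ρ_ (F.obj X)).hom = _
    rw [h.app₂_evF hF, coevF, reassoc_of% hF.coev_ev X XL, left_unitality_inv_assoc,
      h.endApp_epsRL, ← F.map_comp_assoc, Iso.inv_hom_id, F.map_id, Category.id_comp]

lemma antipode_mul_antipode (α : A) :
    LinearMap.mul' k A (TensorProduct.map S
      (LinearMap.mul' k A ∘ₗ LinearMap.lTensor A S ∘ₗ CoalgebraStruct.comul)
        (CoalgebraStruct.comul α)) = S α := by
  have h1 : LinearMap.mul' k A ∘ₗ LinearMap.lTensor A S ∘ₗ CoalgebraStruct.comul = epsLR k A :=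
    LinearMap.ext fun β => h.mul_antipode hρ hF hS β
  have h2 : TensorProduct.map S (epsLR k A) (CoalgebraStruct.comul (R := k) α) =
      LinearMap.rTensor A S (LinearMap.lTensor A (epsLR k A) (CoalgebraStruct.comul (R := k) α)) := 
    (LinearMap.congr_fun (LinearMap.rTensor_comp_lTensor A S (epsLR k A)) _).symm
  rw [h1, h2]
  refine hρ.ext fun X => ?_
  obtain ⟨XL, _, hX⟩ := hS X
  refine (FinRep.act_mul_rTensor (X := ρ.rep X) (XL := ρ.rep XL) hX _).trans ?_
  rw [hX]
  change (λ_ (F.obj X)).inv ≫ coevF F X XL ▷ F.obj X ≫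
      (α_ (F.obj X) (F.obj XL) (F.obj X)).hom ≫ F.obj X ◁ (ρ.app₂ (LinearMap.lTensor A (epsLR k A)
        (CoalgebraStruct.comul (R := k) α)) XL X ≫ evF F X XL) ≫ (ρ_ (F.obj X)).hom = _
  rw [evF, reassoc_of% h.app₂_lTensor_epsLR, h.comul, NatAction.transpose, evF]
  simp only [Category.assoc]
  rw [reassoc_of% hF.separable XL (𝟙_ C), ← ρ.naturality, ← Functor.LaxMonoidal.right_unitality_assoc,
    Iso.inv_hom_id_assoc, MonoidalCategory.whiskerLeft_comp, Category.assoc]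

/-- The reconstructed weak Hopf algebra structure. -/
@[reducible]
def weakHopfAlgebra : WeakHopfAlgebra k A where
  toWeakBialgebra := h.weakBialgebra hρ hF
  antipode := S
  mul_antipode := h.mul_antipode hρ hF hS
  antipode_mul := h.antipode_mul hρ hF hS
  antipode_mul_antipode := h.antipode_mul_antipode hρ hF hS

end IsReconstructedCoalgebra

lemma NatAction.IsFull.exists_antipode (hρ : ρ.IsFull) [RightRigidCategory C] :
    ∃ S : A →ₗ[k] A, ∀ (α : A) (X XL : C) [ExactPairing X XL],
      ρ.app (S α) X = ρ.transpose α X XL := by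
  have hS (α : A) : ∃ β, ∀ X, ρ.app β X = ρ.transpose α X Xᘁ :=
    hρ.exists_app _ fun f => ρ.transpose_naturality α f _ _
  choose S hS using hS
  refine ⟨{ toFun := S
            map_add' := fun a b => hρ.ext fun X => ?_
            map_smul' := fun c a => hρ.ext fun X => ?_ }, fun α X XL _ => ?_⟩
  · rw [ρ.app_add, hS, hS, hS]
    simp only [NatAction.transpose, ρ.app_add, MonoidalPreadditive.add_whiskerRight,
      MonoidalPreadditive.whiskerLeft_add, Preadditive.comp_add, Preadditive.add_comp]
  · rw [RingHom.id_apply, ρ.app_smul, hS, hS]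
    simp only [NatAction.transpose, ρ.app_smul, MonoidalLinear.smul_whiskerRight,
      MonoidalLinear.whiskerLeft_smul, Linear.comp_smul, Linear.smul_comp]
  · exact (hS α X).trans (ρ.transpose_eq α X _ XL)

end Antipode

section FullAction

variable {k : Type u} [Field k] {A : Type w'} [Ring A] [Algebra k A] {C : Type w} [Category.{v} C]
  {F : C ⥤ FGModuleCat.{u} k} {ρ : NatAction k A F} {P : C} {p : F.obj P}

lemma NatAction.app_fmap (ρ : NatAction k A F) (a : A) {X Y : C} (f : X ⟶ Y) (x : F.obj X) :
    (ρ.app a Y).hom.hom (fmap F f x) = fmap F f ((ρ.app a X).hom.hom x) :=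
  congrArg (fun g : F.obj X ⟶ F.obj Y => g.hom.hom x) (ρ.naturality a f)

/-- An action is full if evaluation at the universal element of a representing object is
bijective. -/
theorem Represents.isFull (hP : Represents F P p) (e : A ≃ₗ[k] F.obj P)
    (he : ∀ a, (ρ.app a P).hom.hom p = e a) : ρ.IsFull := by
  have ho : FinRep.orbit (ρ.rep P) p = e.toLinearMap := LinearMap.ext he
  have h₂ (t : A ⊗[k] A) : (ρ.app₂ t P P).hom.hom (p ⊗ₜ[k] p) = TensorProduct.congr e e t := by
    refine (FinRep.act₂_tmul_apply (ρ.rep P) (ρ.rep P) t p p).trans ?_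
    rw [ho]; rfl
  have h₃ (t : A ⊗[k] (A ⊗[k] A)) : (ρ.app₃ t P P P).hom.hom (p ⊗ₜ[k] (p ⊗ₜ[k] p)) =
      TensorProduct.congr e (TensorProduct.congr e e) t := by
    refine (FinRep.tripleAct_tmul_apply (ρ.rep P) (ρ.rep P) (ρ.rep P) t p p p).trans ?_
    rw [ho]; rfl
  refine ⟨fun {a b} h => ?_, fun {s t} h => ?_, fun {s t} h => ?_, fun β hβ => ?_, fun β hβ => ?_⟩
  · apply e.injective
    rw [← he, ← he, h]
  · apply (TensorProduct.congr e e).injective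
    rw [← h₂, ← h₂, h]
  · apply (TensorProduct.congr e (TensorProduct.congr e e)).injective
    rw [← h₃, ← h₃, h]
  · refine ⟨e.symm ((β P).hom.hom p), fun X => FGModuleCat.hom_ext (LinearMap.ext fun x => ?_)⟩
    obtain ⟨f, rfl⟩ := hP.exists_eq x
    have h1 : (β X).hom.hom (fmap F f p) = fmap F f ((β P).hom.hom p) :=
      congrArg (fun g : F.obj P ⟶ F.obj X => g.hom.hom p) (hβ f)
    rw [ρ.app_fmap, he, e.apply_symm_apply, h1]
  · refine ⟨(TensorProduct.congr e e).symm ((β P P).hom.hom (p ⊗ₜ[k] p)), fun X Y => ?_⟩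
    apply FinRep.tensor_hom_ext
    intro x y
    obtain ⟨f, rfl⟩ := hP.exists_eq x
    obtain ⟨g, rfl⟩ := hP.exists_eq y
    have h1 : (β X Y).hom.hom (fmap F f p ⊗ₜ[k] fmap F g p) =
        (F.map f ⊗ₘ F.map g).hom.hom ((β P P).hom.hom (p ⊗ₜ[k] p)) :=
      (congrArg (fun h : F.obj P ⊗ F.obj P ⟶ F.obj X ⊗ F.obj Y => h.hom.hom (p ⊗ₜ[k] p))
        (hβ f g)).symm
    have h2 (t : A ⊗[k] A) : (ρ.app₂ t X Y).hom.hom (fmap F f p ⊗ₜ[k] fmap F g p) =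
        (F.map f ⊗ₘ F.map g).hom.hom ((ρ.app₂ t P P).hom.hom (p ⊗ₜ[k] p)) :=
      (congrArg (fun h : F.obj P ⊗ F.obj P ⟶ F.obj X ⊗ F.obj Y => h.hom.hom (p ⊗ₜ[k] p))
        (ρ.app₂_naturality t f g)).symm
    refine (h2 _).trans (Eq.trans ?_ h1.symm)
    rw [h₂, LinearEquiv.apply_symm_apply]

/-- The tautological action of the algebra of natural endomorphisms. -/
def evalAction (F : C ⥤ FGModuleCat.{u} k) : NatAction k (End F) F where
  ρ := evalEnd F
  naturality' f α := NatTrans.naturality α f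

end FullAction

section Reconstruction

variable {k : Type u} [Field k] {C : Type w} [Category.{v} C] [Preadditive C]
  [CategoryTheory.Linear k C] {F : C ⥤ FGModuleCat.{u} k} {P : C} {p : F.obj P}

open Limits

/-- A faithful exact linear functor from a finite linear category to vector spaces is representable,
and its comparison functor is an equivalence. -/
theorem IsFiniteLinearCategory.exists_represents (hC : IsFiniteLinearCategory k C)
    [F.Additive] [F.Linear k] [F.Faithful]
    [PreservesFiniteLimits F] [PreservesFiniteColimits F] :
    ∃ (P : C) (p : F.obj P), Represents F P p ∧ (evalAction F).IsFull ∧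
      (comparison F).IsEquivalence ∧ Module.Finite k (End F) := by
  obtain ⟨B, _, _, _, E, _, _, _⟩ := hC
  have : HasFiniteBiproducts C := by
    have := hasFiniteProducts_of_hasFiniteLimits (FinRep k B)
    have : HasFiniteProducts C := ⟨fun n => Adjunction.hasLimitsOfShape_of_equivalence E⟩
    exact HasFiniteBiproducts.of_hasFiniteProducts
  let _ : Abelian C := abelianOfEquivalence E
  obtain ⟨P, p, hP⟩ := _root_.exists_represents F (E.inv.obj (FinRep.coregular k B)) fun Y => by
    obtain ⟨m, f, hf⟩ := FinRep.exists_mono_coregular (E.obj Y)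
    have : E.asEquivalence.functor.Additive := ‹E.Additive›
    have : E.inv.Additive := inferInstanceAs E.asEquivalence.inverse.Additive
    have h1 : Mono (E.inv.map f) := inferInstance
    let e := E.inv.mapBiproduct fun _ : Fin m => FinRep.coregular k B
    have h2 : Mono (E.inv.map f ≫ e.hom) := by
      have : Mono e.hom := inferInstance
      exact mono_comp (E.inv.map f) e.hom
    have h3 : Mono (E.asEquivalence.unitIso.hom.app Y) := inferInstance
    exact ⟨m, _, @mono_comp _ _ _ _ _ _ h3 _ h2⟩
  exact ⟨P, p, hP, hP.isFull hP.endEquiv fun _ => rfl, hP.comparison_isEquivalence, hP.finite_end⟩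

end Reconstruction

section WeakHopf

variable {k : Type u} [Field k] {C : Type w} [Category.{v} C] [MonoidalCategory C]
  {F : C ⥤ FGModuleCat.{u} k} [F.LaxMonoidal] [F.OplaxMonoidal]

lemma IsReconstructed.isReconstructedCoalgebra {W : WeakHopfAlgebra k (End F)}
    (hW : IsReconstructed F W) : IsReconstructedCoalgebra (evalAction F) where
  comul := hW.comul
  counit α := by
    rw [hW.counit α]
    exact smul_id_unit _

/-- The reconstructed weak Hopf algebra structure exists. -/
theorem exists_isReconstructed (hρ : (evalAction F).IsFull) (hF : IsSeparableFrobenius F)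
    [RightRigidCategory C] : ∃ W : WeakHopfAlgebra k (End F), IsReconstructed F W := by
  obtain ⟨_, h⟩ := hρ.exists_isReconstructedCoalgebra
  obtain ⟨S, hS⟩ := hρ.exists_antipode
  refine ⟨h.weakHopfAlgebra hρ hF fun X => ⟨Xᘁ, inferInstance, fun α => hS α X Xᘁ⟩,
    h.comul, fun α => ?_, fun α X XL _ => hS α X XL⟩
  exact unit_smul_injective ((h.counit α).trans (smul_id_unit _).symm)

lemma WeakHopfAlgebra.eq_of_comul_counit_antipode {A : Type w} [Ring A] [Algebra k A]
    {W W' : WeakHopfAlgebra k A} (h1 : W.comul = W'.comul) (h2 : W.counit = W'.counit)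
    (h3 : W.antipode = W'.antipode) : W = W' := by
  obtain @⟨@⟨@⟨⟨c, e⟩, _, _, _⟩, _, _, _, _, _⟩, S, _, _, _⟩ := W
  obtain @⟨@⟨@⟨⟨c', e'⟩, _, _, _⟩, _, _, _, _, _⟩, S', _, _, _⟩ := W'
  obtain rfl : c = c' := h1
  obtain rfl : e = e' := h2
  obtain rfl : S = S' := h3
  rfl

/-- The reconstructed weak Hopf algebra structure is unique. -/
theorem IsReconstructed.unique (hρ : (evalAction F).IsFull) [RightRigidCategory C]
    {W W' : WeakHopfAlgebra k (End F)} (hW : IsReconstructed F W) (hW' : IsReconstructed F W') :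
    W = W' := by
  apply WeakHopfAlgebra.eq_of_comul_counit_antipode
  · exact LinearMap.ext fun α => hρ.ext₂ fun X Y =>
      (hW.comul α X Y).trans (hW'.comul α X Y).symm
  · exact LinearMap.ext fun α => (hW.counit α).trans (hW'.counit α).symm
  · exact LinearMap.ext fun α => hρ.ext fun X =>
      (hW.antipode α X Xᘁ).trans (hW'.antipode α X Xᘁ).symm

end WeakHopf

noncomputable section MonoidalComparison

variable {k : Type u} [Field k] {A : Type w'} [Ring A] [Algebra k A] {C : Type w} [Category.{v} C]
  [MonoidalCategory C] {F : C ⥤ FGModuleCat.{u} k} [F.LaxMonoidal] [F.OplaxMonoidal]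
  {ρ : NatAction k A F} [WeakBialgebra k A] [Module.Finite k A]

open Functor.LaxMonoidal Functor.OplaxMonoidal WeakBialgebra CoalgebraStruct

/-- Left and right multiplication by an element of `F 1` agree on the unit. -/
lemma unit_mul_unit (u : 𝟙_ (FGModuleCat.{u} k) ⟶ F.obj (𝟙_ C)) :
    ε F ≫ (λ_ _).inv ≫ u ▷ F.obj (𝟙_ C) ≫ μ F (𝟙_ C) (𝟙_ C) ≫ F.map (λ_ (𝟙_ C)).hom = u := by
  rw [leftUnitor_inv_naturality_assoc, whisker_exchange_assoc, unitors_equal (C := C),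
    ← Functor.LaxMonoidal.right_unitality, rightUnitor_naturality, ← unitors_equal,
    Iso.inv_hom_id_assoc]

namespace IsReconstructedCoalgebra

variable (h : IsReconstructedCoalgebra ρ) (hρ : ρ.IsFull) (hF : IsSeparableFrobenius F)

include h

lemma ε_app_epsLR (a : A) : ε F ≫ ρ.app (epsLR k A a) (𝟙_ C) = ε F ≫ ρ.app a (𝟙_ C) := by
  rw [h.endApp_epsLR, unit_mul_unit]

lemma app_epsRR (a : A) (X : C) : ρ.app (epsRR k A a) X =
    (ρ_ _).inv ≫ F.obj X ◁ (ε F ≫ ρ.app a (𝟙_ C)) ≫ μ F X (𝟙_ C) ≫ F.map (ρ_ X).hom := by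
  rw [epsRR_apply, h.endApp_cR, ρ.app₂_mul, h.comul_one, ρ.app₂_one_tmul]
  simp only [Category.assoc, right_unitality_hom, MonoidalCategory.whiskerLeft_comp]

lemma e_rep (X Y : C) : FinRep.e (ρ.rep X) (ρ.rep Y) = μ F X Y ≫ δ F X Y := h.comul_one X Y

include hF

/-- The comparison isomorphism for tensor products. -/
def tensorIso (X Y : C) : ρ.toRep.obj X ⊗ ρ.toRep.obj Y ≅ ρ.toRep.obj (X ⊗ Y) :=
  FinRep.mkIso (X := FinRep.tensor (ρ.rep X) (ρ.rep Y)) (Y := ρ.rep (X ⊗ Y))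
    ⟨FinRep.ι (ρ.rep X) (ρ.rep Y) ≫ μ F X Y, fun a => by
      have h1 : FinRep.act₂ (ρ.rep X) (ρ.rep Y) (CoalgebraStruct.comul a) = μ F X Y ≫ ρ.app a (X ⊗ Y) ≫ δ F X Y :=
        h.comul a X Y
      rw [FinRep.tensor_act_ι_assoc, h1]
      simp only [Category.assoc]
      rw [hF.separable X Y]
      exact congrArg _ (congrArg _ (Category.comp_id _))⟩
    (δ F X Y ≫ FinRep.π (ρ.rep X) (ρ.rep Y))
    (by
      simp only [Category.assoc]
      rw [← reassoc_of% h.e_rep X Y, FinRep.e_π, FinRep.ι_π])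
    (by
      simp only [Category.assoc]
      rw [FinRep.π_ι_assoc, h.e_rep X Y, Category.assoc, reassoc_of% hF.separable X Y,
        hF.separable X Y])

lemma π_tensorIso (X Y : C) : FinRep.π (ρ.rep X) (ρ.rep Y) ≫ (h.tensorIso hF X Y).hom.hom =
    μ F X Y := by
  change FinRep.π (ρ.rep X) (ρ.rep Y) ≫ FinRep.ι (ρ.rep X) (ρ.rep Y) ≫ μ F X Y = _
  rw [FinRep.π_ι_assoc, h.e_rep X Y, Category.assoc, hF.separable X Y, Category.comp_id]

lemma tensorIso_ι (X Y : C) : (h.tensorIso hF X Y).inv.hom ≫ FinRep.ι (ρ.rep X) (ρ.rep Y) =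
    δ F X Y := by
  change (δ F X Y ≫ FinRep.π (ρ.rep X) (ρ.rep Y)) ≫ FinRep.ι (ρ.rep X) (ρ.rep Y) = _
  rw [Category.assoc, FinRep.π_ι, h.e_rep X Y, reassoc_of% hF.separable X Y]

omit hF in
variable (ρ) in
/-- The comparison morphism for units, `α ↦ α(1)`, as a linear map. -/
def unitLin : (FinRep.unit k A).V →ₗ[k] F.obj (𝟙_ C) :=
  (ρ.rep (𝟙_ C)).orbit ((ε F).hom.hom (1 : k)) ∘ₗ FinRep.unitIncl k A

omit hF in
/-- The comparison morphism for units, `α ↦ α(1)`. -/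
def unitHom : 𝟙_ (FinRep k A) ⟶ ρ.toRep.obj (𝟙_ C) where
  hom := FGModuleCat.ofHom (unitLin ρ)
  comm a := FGModuleCat.hom_ext (LinearMap.ext fun y => by
    have h1 := congrArg (fun f : 𝟙_ (FGModuleCat.{u} k) ⟶ F.obj (𝟙_ C) => f.hom.hom (1 : k))
      (h.ε_app_epsLR (a * FinRep.unitIncl k A y))
    rw [ρ.app_mul] at h1
    refine Eq.trans ?_ h1
    change (ρ.app (FinRep.unitIncl k A (FinRep.unitProj k A (a * FinRep.unitIncl k A y)))
      (𝟙_ C)).hom.hom ((ε F).hom.hom (1 : k)) = _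
    rw [FinRep.unitIncl_unitProj]
    rfl)

omit hF in
lemma epsLR_congr (hρ : ρ.IsFull) {a b : A} (hab : ε F ≫ ρ.app a (𝟙_ C) = ε F ≫ ρ.app b (𝟙_ C)) :
    epsLR k A a = epsLR k A b := hρ.ext fun X => by
  rw [h.endApp_epsLR, h.endApp_epsLR, hab]

omit hF in
include hρ in
lemma unitLin_bijective : Function.Bijective (unitLin ρ) := by
  constructor
  · intro y z hyz
    have h1 := h.epsLR_congr hρ (a := FinRep.unitIncl k A y) (b := FinRep.unitIncl k A z)
      (FGModuleCat.hom_ext (LinearMap.ext_ring hyz))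
    rw [FinRep.epsLR_unitIncl, FinRep.epsLR_unitIncl] at h1
    rw [← FinRep.unitProj_unitIncl y, ← FinRep.unitProj_unitIncl z, h1]
  · intro z
    let u : 𝟙_ (FGModuleCat.{u} k) ⟶ F.obj (𝟙_ C) :=
      FGModuleCat.ofHom (LinearMap.toSpanSingleton k _ z)
    obtain ⟨a, ha⟩ := hρ.exists_app
      (fun X => (λ_ (F.obj X)).inv ≫ u ▷ F.obj X ≫ μ F (𝟙_ C) X ≫ F.map (λ_ X).hom)
      fun {X Y} f => by
        simp only [Category.assoc]
        rw [leftUnitor_inv_naturality_assoc, whisker_exchange_assoc, μ_natural_right_assoc,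
          ← F.map_comp, ← F.map_comp, leftUnitor_naturality]
    have h1 : ε F ≫ ρ.app a (𝟙_ C) = u := by rw [ha, unit_mul_unit]
    refine ⟨FinRep.unitProj k A a, ?_⟩
    change (ρ.app (FinRep.unitIncl k A (FinRep.unitProj k A a)) (𝟙_ C)).hom.hom
      ((ε F).hom.hom (1 : k)) = z
    rw [FinRep.unitIncl_unitProj]
    refine (congrArg (fun f : 𝟙_ (FGModuleCat.{u} k) ⟶ F.obj (𝟙_ C) => f.hom.hom (1 : k))
      ((h.ε_app_epsLR a).trans h1)).trans ?_
    change (1 : k) • z = z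
    rw [one_smul]

omit hF in
/-- The comparison isomorphism for units. -/
def unitIso : 𝟙_ (FinRep k A) ≅ ρ.toRep.obj (𝟙_ C) :=
  have : IsIso h.unitHom := isIso_of_fmap_bijective (FinRep.forget k A) _ (h.unitLin_bijective hρ)
  asIso h.unitHom

omit hF in
lemma unitIso_hom : (h.unitIso hρ).hom.hom = FGModuleCat.ofHom (unitLin ρ) := rfl

omit hF in
lemma unitMap_unitIso : FinRep.unitMap k A ≫ (h.unitIso hρ).hom.hom = ε F := by
  rw [unitIso_hom]
  refine FGModuleCat.hom_ext (LinearMap.ext_ring ?_)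
  change unitLin ρ ((1 : k) • FinRep.unitProj k A 1) = (ε F).hom.hom (1 : k)
  rw [one_smul]
  change (ρ.app (FinRep.unitIncl k A (FinRep.unitProj k A 1)) (𝟙_ C)).hom.hom
    ((ε F).hom.hom (1 : k)) = _
  rw [FinRep.unitIncl_unitProj_one, ρ.app_one]
  rfl

omit hF in
lemma unitIso_η : (h.unitIso hρ).hom.hom ≫ η F = FinRep.unitCounit k A := by
  rw [unitIso_hom]
  refine FGModuleCat.hom_ext (LinearMap.ext fun y => ?_)
  have h1 := congrArg (fun f : 𝟙_ (FGModuleCat.{u} k) ⟶ 𝟙_ (FGModuleCat.{u} k) =>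
    (f.hom.hom (1 : k) : k)) (h.counit (FinRep.unitIncl k A y))
  refine h1.symm.trans ?_
  change (CoalgebraStruct.counit (R := k) (FinRep.unitIncl k A y) : k) • (1 : k) = _
  rw [smul_eq_mul, mul_one]
  rfl

omit hF in
lemma lt_rep (X : C) : FinRep.lt (ρ.rep X) =
    (h.unitIso hρ).hom.hom ▷ F.obj X ≫ μ F (𝟙_ C) X ≫ F.map (λ_ X).hom := by
  rw [unitIso_hom]
  apply FinRep.tensor_hom_ext
  intro y v
  have h1 := h.endApp_epsLR (FinRep.unitIncl k A y) X
  rw [FinRep.epsLR_unitIncl] at h1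
  refine (congrArg (fun f : F.obj X ⟶ F.obj X => f.hom.hom v) h1).trans ?_
  rfl

omit hF in
lemma rt_rep (X : C) : FinRep.rt (ρ.rep X) =
    F.obj X ◁ (h.unitIso hρ).hom.hom ≫ μ F X (𝟙_ C) ≫ F.map (ρ_ X).hom := by
  rw [unitIso_hom]
  apply FinRep.tensor_hom_ext
  intro v y
  have h1 := h.app_epsRR (FinRep.unitIncl k A y) X
  refine (congrArg (fun f : F.obj X ⟶ F.obj X => f.hom.hom v) h1).trans ?_
  rfl

instance (X Y : FinRep k A) : Epi (μ (FinRep.forget k A) X Y) := inferInstanceAs (Epi (FinRep.π X Y))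

lemma μ_tensorIso (X Y : C) : μ (FinRep.forget k A) (ρ.toRep.obj X) (ρ.toRep.obj Y) ≫
    (FinRep.forget k A).map (h.tensorIso hF X Y).hom = μ F X Y := h.π_tensorIso hF X Y

lemma μ_tensorIso_assoc (X Y : C) {M : FGModuleCat.{u} k}
    (g : (FinRep.forget k A).obj (ρ.toRep.obj (X ⊗ Y)) ⟶ M) :
    μ (FinRep.forget k A) (ρ.toRep.obj X) (ρ.toRep.obj Y) ≫
      (FinRep.forget k A).map (h.tensorIso hF X Y).hom ≫ g = (μ F X Y ≫ g : _) :=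
  (Category.assoc _ _ _).symm.trans (congrArg (· ≫ g) (h.μ_tensorIso hF X Y))

/-- The strong monoidal structure of the comparison functor. -/
def coreMonoidal : ρ.toRep.CoreMonoidal where
  εIso := h.unitIso hρ
  μIso := h.tensorIso hF
  μIso_hom_natural_left {X Y} f X' := (FinRep.forget k A).map_injective (by
    rw [← cancel_epi (μ (FinRep.forget k A) _ _), Functor.map_comp, Functor.map_comp,
      ← μ_natural_left_assoc, h.μ_tensorIso hF, h.μ_tensorIso_assoc hF]
    exact μ_natural_left F f X')
  μIso_hom_natural_right {X Y} X' f := (FinRep.forget k A).map_injective (by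
    rw [← cancel_epi (μ (FinRep.forget k A) _ _), Functor.map_comp, Functor.map_comp,
      ← μ_natural_right_assoc, h.μ_tensorIso hF, h.μ_tensorIso_assoc hF]
    exact μ_natural_right F X' f)
  associativity X Y Z := (FinRep.forget k A).map_injective (by
    have : Epi (μ (FinRep.forget k A) (ρ.toRep.obj X) (ρ.toRep.obj Y) ▷
        (FinRep.forget k A).obj (ρ.toRep.obj Z)) := 
        (SplitEpi.mk (FinRep.ι (ρ.rep X) (ρ.rep Y) ▷ F.obj Z)
          ((comp_whiskerRight _ _ _).symm.trans ((congrArg (fun f => f ▷ F.obj Z)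
            (FinRep.ι_π (ρ.rep X) (ρ.rep Y))).trans (id_whiskerRight _ _)))).epi
    rw [← cancel_epi (μ (FinRep.forget k A) _ _),
      ← cancel_epi (μ (FinRep.forget k A) (ρ.toRep.obj X) (ρ.toRep.obj Y) ▷
        (FinRep.forget k A).obj (ρ.toRep.obj Z))]
    simp only [Functor.map_comp]
    rw [← μ_natural_left_assoc, ← comp_whiskerRight_assoc, Functor.LaxMonoidal.associativity_assoc,
      ← μ_natural_right_assoc, ← MonoidalCategory.whiskerLeft_comp_assoc, h.μ_tensorIso hF,
      h.μ_tensorIso hF, h.μ_tensorIso hF, h.μ_tensorIso_assoc hF]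
    exact Functor.LaxMonoidal.associativity F X Y Z)
  left_unitality X := (FinRep.forget k A).map_injective (by
    rw [← cancel_epi (μ (FinRep.forget k A) _ _)]
    simp only [Functor.map_comp]
    rw [← μ_natural_left_assoc, h.μ_tensorIso_assoc hF]
    refine Eq.trans ?_ (h.lt_rep hρ X)
    change FinRep.π _ _ ≫ FinRep.ι _ _ ≫ FinRep.lt (ρ.rep X) = FinRep.lt (ρ.rep X)
    rw [FinRep.π_ι_assoc, FinRep.e_lt])
  right_unitality X := (FinRep.forget k A).map_injective (by
    rw [← cancel_epi (μ (FinRep.forget k A) _ _)]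
    simp only [Functor.map_comp]
    rw [← μ_natural_right_assoc, h.μ_tensorIso_assoc hF]
    refine Eq.trans ?_ (h.rt_rep hρ X)
    change FinRep.π _ _ ≫ FinRep.ι _ _ ≫ FinRep.rt (ρ.rep X) = FinRep.rt (ρ.rep X)
    rw [FinRep.π_ι_assoc, FinRep.e_rt])

include hρ in
/-- The comparison functor is strong monoidal, compatibly with the forgetful functor. -/
theorem exists_monoidal : ∃ _ : ρ.toRep.Monoidal,
    ε (ρ.toRep ⋙ FinRep.forget k A) = ε F ∧
    (∀ X Y : C, μ (ρ.toRep ⋙ FinRep.forget k A) X Y = μ F X Y) ∧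
    η (ρ.toRep ⋙ FinRep.forget k A) = η F ∧
    (∀ X Y : C, δ (ρ.toRep ⋙ FinRep.forget k A) X Y = δ F X Y) := by
  refine ⟨(h.coreMonoidal hρ hF).toMonoidal, h.unitMap_unitIso hρ, h.π_tensorIso hF, ?_,
    h.tensorIso_ι hF⟩
  have h2 : (h.unitIso hρ).inv.hom ≫ (h.unitIso hρ).hom.hom = 𝟙 _ :=
    congrArg FinRep.Hom.hom (h.unitIso hρ).inv_hom_id
  change (h.unitIso hρ).inv.hom ≫ FinRep.unitCounit k A = η F
  rw [← h.unitIso_η hρ]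
  exact (Category.assoc _ _ _).symm.trans
    ((congrArg (fun f => f ≫ η F) h2).trans (Category.id_comp (η F)))

end IsReconstructedCoalgebra

end MonoidalComparison

section MonoidalComparison

variable {k : Type u} [Field k] {C : Type w} [Category.{v} C]
  [MonoidalCategory C] {F : C ⥤ FGModuleCat.{u} k} [F.LaxMonoidal] [F.OplaxMonoidal]

theorem IsReconstructed.isMonoidalComparison [Preadditive C] [CategoryTheory.Linear k C]
    [Module.Finite k (End F)] {W : WeakHopfAlgebra k (End F)} (hW : IsReconstructed F W)
    (hρ : (evalAction F).IsFull) (hF : IsSeparableFrobenius F) [F.Additive] [F.Linear k]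
    (hE : (comparison F).IsEquivalence) : IsMonoidalComparison F :=
  ⟨hE, ⟨FinRep.hom_ext F.map_add⟩, ⟨fun f c => FinRep.hom_ext (F.map_smul c f)⟩,
    hW.isReconstructedCoalgebra.exists_monoidal hρ hF⟩

end MonoidalComparison

namespace WeakBialgebra

open CoalgebraStruct

section

variable {k : Type u} {A : Type w} [Field k] [Ring A] [Algebra k A] [WeakBialgebra k A]

variable (k A) in
/-- `1₍₂₎ ε(x 1₍₁₎)` -/
def epsLL : A →ₗ[k] A :=
  cL k A ∘ₗ LinearMap.mulRight k (comul (R := k) (1 : A)) ∘ₗ (TensorProduct.mk k A A).flip 1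

lemma epsLL_apply (a : A) : epsLL k A a = cL k A (a ⊗ₜ 1 * comul (R := k) (1 : A)) := rfl

lemma epsRL_one : epsRL k A 1 = 1 := by
  rw [epsRL_apply, ← Algebra.TensorProduct.one_def, one_mul, cR_comul]

/-- `1₁ ⊗ εˡʳ(1₂) = 1₁ ⊗ 1₂` -/
lemma lTensor_epsLR_comul_one :
    LinearMap.lTensor A (epsLR k A) (comul (1 : A)) = comul (R := k) (1 : A) := by
  have h := congrArg (LinearMap.lTensor A (cL k A)) (comul_one_right (k := k) (A := A))
  have h1 (z : A) : LinearMap.lTensor A (cL k A)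
      (LinearMap.lTensor A comul (comul (R := k) z)) = comul (R := k) z := by
    rw [← LinearMap.lTensor_comp_apply, show cL k A ∘ₗ comul = LinearMap.id from
      LinearMap.ext cL_comul, LinearMap.lTensor_id_apply]
  rw [h1] at h
  refine Eq.trans ?_ h
  have h2 (s t : A ⊗[k] A) : LinearMap.lTensor A (cL k A ∘ₗ LinearMap.mulLeft k s ∘ₗ
      (TensorProduct.mk k A A).flip 1) t =
      LinearMap.lTensor A (cL k A) (((1 : A) ⊗ₜ[k] s) * TensorProduct.assoc k A A A (t ⊗ₜ[k] 1)) := by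
    induction t with
    | zero => simp
    | tmul p q =>
      rw [TensorProduct.assoc_tmul, Algebra.TensorProduct.tmul_mul_tmul, LinearMap.lTensor_tmul,
        LinearMap.lTensor_tmul, one_mul]
      rfl
    | add x y hx hy => simp only [map_add, TensorProduct.add_tmul, mul_add, hx, hy]
  exact h2 _ _

/-- `a₁ ⊗ εˡʳ(a₂) = 1₁ a ⊗ 1₂` -/
lemma lTensor_epsLR_comul (a : A) :
    LinearMap.lTensor A (epsLR k A) (comul a) = comul (R := k) (1 : A) * a ⊗ₜ 1 := by
  have h1 (s t : A ⊗[k] A) : LinearMap.lTensor A (cL k A ∘ₗ LinearMap.mulLeft k s ∘ₗ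
      (TensorProduct.mk k A A).flip 1) t =
      LinearMap.rTensor A (cR k A ∘ₗ LinearMap.mulRight k t ∘ₗ TensorProduct.mk k A A 1) s := by
    induction t with
    | zero =>
      rw [map_zero]
      induction s with
      | zero => simp
      | tmul p q => simp
      | add x y hx hy => rw [map_add, ← hx, ← hy, add_zero]
    | tmul p q =>
      induction s with
      | zero => simp
      | tmul b c => simp [TensorProduct.smul_tmul]
      | add x y hx hy =>
        rw [map_add, ← hx, ← hy]
        simp [add_mul, TensorProduct.tmul_add]
    | add x y hx hy =>
      rw [map_add, hx, hy]
      have : cR k A ∘ₗ LinearMap.mulRight k (x + y) ∘ₗ TensorProduct.mk k A A 1 =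
          cR k A ∘ₗ LinearMap.mulRight k x ∘ₗ TensorProduct.mk k A A 1 +
          cR k A ∘ₗ LinearMap.mulRight k y ∘ₗ TensorProduct.mk k A A 1 :=
        LinearMap.ext fun b => by simp [mul_add]
      rw [this, LinearMap.rTensor_add, LinearMap.add_apply]
  have h2 (s : A ⊗[k] A) : LinearMap.rTensor A (cR k A ∘ₗ LinearMap.mulRight k (comul (R := k) a) ∘ₗ
      TensorProduct.mk k A A 1) s =
      LinearMap.rTensor A (cR k A ∘ₗ LinearMap.mulRight k (comul (R := k) (1 : A)) ∘ₗ
        TensorProduct.mk k A A 1) s * a ⊗ₜ 1 := by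
    induction s with
    | zero => simp
    | tmul b c =>
      simp only [LinearMap.rTensor_tmul, LinearMap.comp_apply, TensorProduct.mk_apply,
        LinearMap.mulRight_apply, Algebra.TensorProduct.tmul_mul_tmul, mul_one]
      rw [cR_mul_comul, cR_mul_right]
    | add x y hx hy => simp only [map_add, add_mul, hx, hy]
  refine (h1 _ _).trans ((h2 _).trans ?_)
  rw [← h1]
  exact congrArg (fun t => t * a ⊗ₜ[k] (1 : A)) lTensor_epsLR_comul_one

/-- `εʳˡ(a₁) ⊗ a₂ = 1₁ ⊗ a 1₂` -/
lemma rTensor_epsRL_comul (a : A) :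
    LinearMap.rTensor A (epsRL k A) (comul a) = 1 ⊗ₜ a * comul (R := k) (1 : A) := by
  have h1 (s t : A ⊗[k] A) : LinearMap.rTensor A (cR k A ∘ₗ LinearMap.mulRight k s ∘ₗ
      TensorProduct.mk k A A 1) t =
      LinearMap.lTensor A (cL k A ∘ₗ LinearMap.mulLeft k t ∘ₗ (TensorProduct.mk k A A).flip 1) s := by
    induction s with
    | zero =>
      rw [map_zero]
      induction t with
      | zero => simp
      | tmul p q => simp
      | add x y hx hy => rw [map_add, hx, hy, add_zero]
    | tmul p q =>
      induction t with
      | zero => simp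
      | tmul b c => simp [TensorProduct.smul_tmul]
      | add x y hx hy =>
        rw [map_add, hx, hy]
        simp [add_mul, TensorProduct.tmul_add]
    | add x y hx hy =>
      have : cR k A ∘ₗ LinearMap.mulRight k (x + y) ∘ₗ TensorProduct.mk k A A 1 =
          cR k A ∘ₗ LinearMap.mulRight k x ∘ₗ TensorProduct.mk k A A 1 +
          cR k A ∘ₗ LinearMap.mulRight k y ∘ₗ TensorProduct.mk k A A 1 :=
        LinearMap.ext fun b => by simp [mul_add]
      rw [map_add, this, LinearMap.rTensor_add, LinearMap.add_apply, hx, hy]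
  have h2 : cL k A ∘ₗ LinearMap.mulLeft k (comul (R := k) a) ∘ₗ (TensorProduct.mk k A A).flip 1 =
      LinearMap.mulLeft k a ∘ₗ epsLR k A := LinearMap.ext fun c => cL_comul_mul a c
  refine (h1 _ _).trans ?_
  rw [h2, LinearMap.lTensor_comp_apply, lTensor_epsLR_comul_one]
  generalize comul (R := k) (1 : A) = t
  induction t with
  | zero => simp
  | tmul p q => simp
  | add x y hx hy => simp only [map_add, mul_add, hx, hy]

/-- `Δ(w) = 1₁ ⊗ w 1₂` for `w = εʳˡ(x)` -/
lemma comul_epsRL (x : A) :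
    comul (R := k) (epsRL k A x) = 1 ⊗ₜ epsRL k A x * comul (R := k) (1 : A) := by
  have h := congrArg (LinearMap.lTensor A (cR k A ∘ₗ LinearMap.mulLeft k (1 ⊗ₜ x)))
    (comul_one_right (k := k) (A := A))
  rw [← coassoc'] at h
  have h1 (t : A ⊗[k] A) : LinearMap.lTensor A (cR k A ∘ₗ LinearMap.mulLeft k (1 ⊗ₜ x))
      (TensorProduct.assoc k A A A (LinearMap.rTensor A comul t)) =
      comul (R := k) (cR k A (1 ⊗ₜ x * t)) := by
    induction t with
    | zero => simp
    | tmul p q =>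
      rw [LinearMap.rTensor_tmul]
      have h2 (r : A ⊗[k] A) : LinearMap.lTensor A (cR k A ∘ₗ LinearMap.mulLeft k (1 ⊗ₜ x))
          (TensorProduct.assoc k A A A (r ⊗ₜ q)) = counit (R := k) (x * q) • r := by
        induction r with
        | zero => simp
        | tmul a b => simp
        | add x y hx hy => simp only [map_add, TensorProduct.add_tmul, hx, hy, smul_add]
      rw [h2]
      simp
    | add x y hx hy => simp only [map_add, mul_add, hx, hy]
  have h3 (s t : A ⊗[k] A) : LinearMap.lTensor A (cR k A ∘ₗ LinearMap.mulLeft k (1 ⊗ₜ x))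
      ((1 : A) ⊗ₜ[k] s * TensorProduct.assoc k A A A (t ⊗ₜ[k] (1 : A))) =
      1 ⊗ₜ (cR k A (1 ⊗ₜ x * s)) * t := by
    induction t with
    | zero => simp
    | tmul p q =>
      induction s with
      | zero => simp
      | tmul b c => simp
      | add x y hx hy =>
        simp only [map_add, mul_add, TensorProduct.tmul_add, add_mul] at hx hy ⊢
        rw [hx, hy]
    | add x y hx hy => simp only [map_add, mul_add, TensorProduct.add_tmul, hx, hy]
  rw [h1, h3] at h
  exact h.symm

/-- Elements of the images of `εˡʳ` and `εʳˡ` commute. -/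
lemma epsLR_mul_epsRL (x y : A) : epsLR k A x * epsRL k A y = epsRL k A y * epsLR k A x := by
  have h := congrArg (cL k A ∘ₗ LinearMap.mulRight k (x ⊗ₜ 1) ∘ₗ
    LinearMap.lTensor A (cR k A ∘ₗ LinearMap.mulLeft k (1 ⊗ₜ y)))
      ((comul_one_left (k := k) (A := A)).trans (comul_one_right (k := k) (A := A)).symm)
  have h1 (s t : A ⊗[k] A) : (cL k A ∘ₗ LinearMap.mulRight k (x ⊗ₜ 1) ∘ₗ
      LinearMap.lTensor A (cR k A ∘ₗ LinearMap.mulLeft k (1 ⊗ₜ y)))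
      (TensorProduct.assoc k A A A (t ⊗ₜ[k] (1 : A)) * (1 : A) ⊗ₜ[k] s) =
      cL k A (t * x ⊗ₜ 1) * cR k A (1 ⊗ₜ y * s) := by
    induction t with
    | zero => simp
    | tmul p q =>
      induction s with
      | zero => simp
      | tmul b c => simp [smul_smul]
      | add x y hx hy => simp only [map_add, mul_add, TensorProduct.tmul_add, hx, hy]
    | add x y hx hy => simp only [map_add, add_mul, TensorProduct.add_tmul, hx, hy]
  have h2 (s t : A ⊗[k] A) : (cL k A ∘ₗ LinearMap.mulRight k (x ⊗ₜ 1) ∘ₗ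
      LinearMap.lTensor A (cR k A ∘ₗ LinearMap.mulLeft k (1 ⊗ₜ y)))
      ((1 : A) ⊗ₜ[k] s * TensorProduct.assoc k A A A (t ⊗ₜ[k] (1 : A))) =
      cR k A (1 ⊗ₜ y * s) * cL k A (t * x ⊗ₜ 1) := by
    induction t with
    | zero => simp
    | tmul p q =>
      induction s with
      | zero => simp
      | tmul b c => simp [smul_smul, mul_comm]
      | add x y hx hy => simp only [map_add, mul_add, add_mul, TensorProduct.tmul_add, hx, hy]
    | add x y hx hy => simp only [map_add, mul_add, add_mul, TensorProduct.add_tmul, hx, hy]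
  rw [h1, h2] at h
  exact h

/-- `ε(εʳˡ(x) z) = ε(x z)` -/
lemma counit_epsRL_mul (x z : A) :
    counit (R := k) (epsRL k A x * z) = counit (R := k) (x * z) := by
  have h := counit_mul_right (k := k) x 1 z
  rw [mul_one] at h
  rw [← h, epsRL_apply]
  generalize comul (R := k) (1 : A) = t
  induction t with
  | zero => simp
  | tmul p q => simp [mul_comm]
  | add x y hx hy => simp only [map_add, mul_add, add_mul, hx, hy]

/-- `εʳˡ(εʳˡ(x) y) = εʳˡ(x y)` -/
lemma epsRL_epsRL_mul (x y : A) : epsRL k A (epsRL k A x * y) = epsRL k A (x * y) := by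
  rw [epsRL_apply, epsRL_apply (x * y)]
  generalize comul (R := k) (1 : A) = t
  induction t with
  | zero => simp
  | tmul p q => simp [mul_assoc, counit_epsRL_mul]
  | add x y hx hy => simp only [map_add, mul_add, hx, hy]

/-- `εʳˡ(z) 1₁ ⊗ 1₂ = 1₁ ⊗ εˡˡ(z) 1₂` -/
lemma epsRL_tmul_one_mul_comul_one (z : A) :
    epsRL k A z ⊗ₜ 1 * comul (R := k) (1 : A) = 1 ⊗ₜ epsLL k A z * comul (R := k) (1 : A) := by
  have h1 (p : A) : epsRL k A z * p = cR k A (1 ⊗ₜ z * comul (R := k) p) := by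
    rw [cR_mul_comul, cR_mul_right, epsRL_apply]
  have h2 (p : A) : epsLL k A z * p = cL k A (z ⊗ₜ 1 * comul (R := k) p) := by
    rw [cL_mul_comul, cL_mul_right, epsLL_apply]
  have h3 : ∀ s : A ⊗[k] A, epsRL k A z ⊗ₜ 1 * s =
      LinearMap.rTensor A (cR k A ∘ₗ LinearMap.mulLeft k (1 ⊗ₜ z))
        (LinearMap.rTensor A comul s) := by
    intro s
    induction s with
    | zero => simp
    | tmul p q => simp [h1]
    | add x y hx hy => simp only [map_add, mul_add, hx, hy]
  have h4 : ∀ s : A ⊗[k] A, 1 ⊗ₜ epsLL k A z * s =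
      LinearMap.lTensor A (cL k A ∘ₗ LinearMap.mulLeft k (z ⊗ₜ 1))
        (LinearMap.lTensor A comul s) := by
    intro s
    induction s with
    | zero => simp
    | tmul p q => simp [h2]
    | add x y hx hy => simp only [map_add, mul_add, hx, hy]
  rw [h3, h4, ← coassoc']
  generalize LinearMap.rTensor A comul (comul (R := k) (1 : A)) = t
  induction t with
  | zero => simp
  | tmul r q =>
    induction r with
    | zero => simp
    | tmul p p' => simp [TensorProduct.smul_tmul]
    | add x y hx hy => simp only [map_add, TensorProduct.add_tmul, hx, hy]
  | add x y hx hy => simp only [map_add, hx, hy]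

end

end WeakBialgebra

namespace WeakHopfAlgebra

open CoalgebraStruct WeakBialgebra Coalgebra

section

variable {k : Type u} {A : Type w} [Field k] [Ring A] [Algebra k A]

lemma _root_.Coalgebra.Repr.mul'_map [CoalgebraStruct k A] {ι : Type*} {x : A} (r : Coalgebra.Repr k x ι)
    (f g : A →ₗ[k] A) : LinearMap.mul' k A (TensorProduct.map f g (comul x)) =
      ∑ i ∈ r.index, f (r.left i) * g (r.right i) := by
  rw [← r.eq]
  simp

variable [WeakHopfAlgebra k A]

local notation "S" => antipode (k := k) (A := A)

lemma mul'_map_antipode_epsLR (x : A) :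
    LinearMap.mul' k A (TensorProduct.map S (epsLR k A) (comul x)) = S x := by
  have h : LinearMap.mul' k A ∘ₗ LinearMap.lTensor A S ∘ₗ comul = epsLR k A :=
    LinearMap.ext mul_antipode
  rw [← antipode_mul_antipode (k := k) x, h]

lemma antipode_one : S 1 = 1 := by
  rw [← mul'_map_antipode_epsLR, ← LinearMap.rTensor_comp_lTensor, LinearMap.comp_apply,
    lTensor_epsLR_comul_one, antipode_mul, epsRL_one]

lemma mul'_map_epsRL_antipode (x : A) :
    LinearMap.mul' k A (TensorProduct.map (epsRL k A) S (comul x)) = S x := by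
  have h1 : epsRL k A = LinearMap.mul' k A ∘ₗ LinearMap.rTensor A S ∘ₗ comul :=
    LinearMap.ext fun x => (antipode_mul x).symm
  have h2 : epsLR k A = LinearMap.mul' k A ∘ₗ LinearMap.lTensor A S ∘ₗ comul :=
    LinearMap.ext fun x => (mul_antipode x).symm
  have h3 := mul_assoc (WithConv.toConv S) (WithConv.toConv (LinearMap.id (R := k) (M := A))) (WithConv.toConv S)
  have h4 := congrArg (fun f => f x) h3
  rw [h1, ← mul'_map_antipode_epsLR, h2]
  exact h4

lemma mul_epsLR_mul_antipode (x z : A) :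
    LinearMap.mul' k A (TensorProduct.map (LinearMap.mulRight k (epsLR k A z)) S (comul x)) =
      epsLR k A (x * z) := by
  rw [← epsLR_mul_epsLR, ← mul_antipode (x * epsLR k A z), comul_mul, comul_epsLR, ← mul_assoc, comul_mul_one]
  generalize comul (R := k) x = t
  induction t with
  | zero => simp
  | tmul p q => simp
  | add x y hx hy => simp only [map_add, add_mul, hx, hy]

lemma antipode_mul_epsRL_mul (x w : A) :
    LinearMap.mul' k A (TensorProduct.map S (LinearMap.mulLeft k (epsRL k A w)) (comul x)) =
      epsRL k A (w * x) := by
  rw [← epsRL_epsRL_mul, ← antipode_mul (epsRL k A w * x), comul_mul, comul_epsRL, mul_assoc, comul_one_mul]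
  generalize comul (R := k) x = t
  induction t with
  | zero => simp
  | tmul p q => simp
  | add x y hx hy => simp only [map_add, mul_add, hx, hy]

lemma antipode_sandwich (x z : A) :
    LinearMap.mul' k A (TensorProduct.map S (LinearMap.mul' k A ∘ₗ
      TensorProduct.map (LinearMap.mulRight k (epsLR k A z)) S ∘ₗ comul) (comul x)) =
      epsLR k A z * S x := by
  have h3 := mul_assoc (WithConv.toConv S) (WithConv.toConv (LinearMap.mulRight k (epsLR k A z)))
    (WithConv.toConv S)
  have h4 := congrArg (fun f => f x) h3
  refine h4.symm.trans ?_
  have h5 : LinearMap.mul' k A ∘ₗ TensorProduct.map S (LinearMap.mulRight k (epsLR k A z)) ∘ₗ comul =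
      LinearMap.mulLeft k (epsLR k A z) ∘ₗ epsRL k A := by
    refine LinearMap.ext fun y => ?_
    change LinearMap.mul' k A (TensorProduct.map S (LinearMap.mulRight k (epsLR k A z)) (comul y)) =
      epsLR k A z * epsRL k A y
    rw [epsLR_mul_epsRL, ← antipode_mul y]
    generalize comul (R := k) y = t
    induction t with
    | zero => simp
    | tmul p q => simp [mul_assoc]
    | add x y hx hy => simp only [map_add, add_mul, hx, hy]
  change LinearMap.mul' k A (TensorProduct.map (LinearMap.mul' k A ∘ₗ
    TensorProduct.map S (LinearMap.mulRight k (epsLR k A z)) ∘ₗ comul) S (comul x)) = _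
  rw [h5, ← mul'_map_epsRL_antipode x]
  generalize comul (R := k) x = t
  induction t with
  | zero => simp
  | tmul p q => simp [mul_assoc]
  | add x y hx hy => simp only [map_add, mul_add, hx, hy]

lemma conv_tmul_apply {ι κ : Type*} {x y : A} (r : Coalgebra.Repr k x ι) (s : Coalgebra.Repr k y κ)
    (f g : WithConv (A ⊗[k] A →ₗ[k] A)) : (f * g) (x ⊗ₜ y) =
      ∑ j ∈ s.index, ∑ i ∈ r.index, f (r.left i ⊗ₜ s.left j) * g (r.right i ⊗ₜ s.right j) := by
  rw [LinearMap.convMul_apply, TensorProduct.comul_tmul, ← r.eq, ← s.eq]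
  simp [TensorProduct.sum_tmul, TensorProduct.tmul_sum]

lemma repr_mul {ι κ : Type*} {x y : A} (r : Coalgebra.Repr k x ι) (s : Coalgebra.Repr k y κ)
    (f g : A →ₗ[k] A) : LinearMap.mul' k A (TensorProduct.map f g (comul (x * y))) =
      ∑ j ∈ s.index, ∑ i ∈ r.index, f (r.left i * s.left j) * g (r.right i * s.right j) := by
  rw [comul_mul, ← r.eq, ← s.eq, Finset.sum_mul_sum, Finset.sum_comm]
  simp

lemma conv_ext {f g : WithConv (A ⊗[k] A →ₗ[k] A)} (h : ∀ x y : A, f (x ⊗ₜ y) = g (x ⊗ₜ y)) : f = g :=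
  congrArg WithConv.toConv (TensorProduct.ext' h : f.ofConv = g.ofConv)

/-- The antipode is antimultiplicative. -/
lemma antipode_mul_rev (x y : A) : S (x * y) = S y * S x := by
  let f : WithConv (A ⊗[k] A →ₗ[k] A) := WithConv.toConv (S ∘ₗ LinearMap.mul' k A)
  let h : WithConv (A ⊗[k] A →ₗ[k] A) := WithConv.toConv (LinearMap.mul' k A)
  let g : WithConv (A ⊗[k] A →ₗ[k] A) := WithConv.toConv (LinearMap.mul' k A ∘ₗ TensorProduct.map S S ∘ₗ
    (TensorProduct.comm k A A).toLinearMap)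
  let l : WithConv (A ⊗[k] A →ₗ[k] A) := WithConv.toConv (epsLR k A ∘ₗ LinearMap.mul' k A)
  let r : WithConv (A ⊗[k] A →ₗ[k] A) := WithConv.toConv (epsRL k A ∘ₗ LinearMap.mul' k A)
  have f_apply (x y : A) : f (x ⊗ₜ y) = S (x * y) := rfl
  have h_apply (x y : A) : h (x ⊗ₜ y) = x * y := rfl
  have g_apply (x y : A) : g (x ⊗ₜ y) = S y * S x := rfl
  have l_apply (x y : A) : l (x ⊗ₜ y) = epsLR k A (x * y) := rfl
  have r_apply (x y : A) : r (x ⊗ₜ y) = epsRL k A (x * y) := rfl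
  have fh : f * h = r := conv_ext fun x y => by
    let rx := Coalgebra.Repr.arbitrary k x
    let ry := Coalgebra.Repr.arbitrary k y
    rw [conv_tmul_apply rx ry, r_apply, ← antipode_mul (x * y)]
    exact (repr_mul rx ry S LinearMap.id).symm
  have hf : h * f = l := conv_ext fun x y => by
    let rx := Coalgebra.Repr.arbitrary k x
    let ry := Coalgebra.Repr.arbitrary k y
    rw [conv_tmul_apply rx ry, l_apply, ← mul_antipode (x * y)]
    exact (repr_mul rx ry LinearMap.id S).symm
  have rf : r * f = f := conv_ext fun x y => by
    let rx := Coalgebra.Repr.arbitrary k x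
    let ry := Coalgebra.Repr.arbitrary k y
    rw [conv_tmul_apply rx ry, f_apply, ← mul'_map_epsRL_antipode (x * y)]
    exact (repr_mul rx ry (epsRL k A) S).symm
  have hg : h * g = l := conv_ext fun x y => by
    let rx := Coalgebra.Repr.arbitrary k x
    let ry := Coalgebra.Repr.arbitrary k y
    rw [conv_tmul_apply rx ry, l_apply, Finset.sum_comm, ← mul_epsLR_mul_antipode, rx.mul'_map]
    refine Finset.sum_congr rfl fun i _ => ?_
    rw [LinearMap.mulRight_apply, ← mul_antipode y, LinearMap.lTensor, ry.mul'_map,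
      Finset.mul_sum, Finset.sum_mul]
    exact Finset.sum_congr rfl fun j _ => by simp only [h_apply, g_apply, mul_assoc, LinearMap.id_apply]
  have gh : g * h = r := conv_ext fun x y => by
    let rx := Coalgebra.Repr.arbitrary k x
    let ry := Coalgebra.Repr.arbitrary k y
    rw [conv_tmul_apply rx ry, r_apply, ← antipode_mul_epsRL_mul, ry.mul'_map]
    refine Finset.sum_congr rfl fun j _ => ?_
    rw [LinearMap.mulLeft_apply, ← antipode_mul x, LinearMap.rTensor, rx.mul'_map,
      Finset.sum_mul, Finset.mul_sum]
    exact Finset.sum_congr rfl fun i _ => by simp only [h_apply, g_apply, mul_assoc, LinearMap.id_apply]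
  have gl : g * l = g := conv_ext fun x y => by
    let rx := Coalgebra.Repr.arbitrary k x
    let ry := Coalgebra.Repr.arbitrary k y
    rw [conv_tmul_apply rx ry, g_apply, ← mul'_map_antipode_epsLR y, ry.mul'_map, Finset.sum_mul]
    refine Finset.sum_congr rfl fun j _ => ?_
    rw [mul_assoc, ← antipode_sandwich, rx.mul'_map, Finset.mul_sum]
    refine Finset.sum_congr rfl fun i _ => ?_
    rw [g_apply, l_apply, ← mul_epsLR_mul_antipode, mul_assoc]
    rfl
  have key : f = g := by
    rw [← rf, ← gh, mul_assoc, hf, gl]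
  exact congrArg (fun φ => φ (x ⊗ₜ y)) key

lemma antipode_epsRR (z : A) : S (epsRR k A z) = epsLR k A z := by
  have h := congrArg (fun t => LinearMap.mul' k A (LinearMap.rTensor A S t)) (triangle_aux (k := k) z)
  have h1 (t : A ⊗[k] A) : LinearMap.mul' k A (LinearMap.rTensor A S (t * epsRR k A z ⊗ₜ 1)) =
      S (epsRR k A z) * LinearMap.mul' k A (LinearMap.rTensor A S t) := by
    induction t with
    | zero => simp
    | tmul p q => simp [antipode_mul_rev, mul_assoc]
    | add x y hx hy => simp only [map_add, mul_add, add_mul, hx, hy]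
  have h2 (t : A ⊗[k] A) : LinearMap.mul' k A (LinearMap.rTensor A S (t * 1 ⊗ₜ epsLR k A z)) =
      LinearMap.mul' k A (LinearMap.rTensor A S t) * epsLR k A z := by
    induction t with
    | zero => simp
    | tmul p q => simp [mul_assoc]
    | add x y hx hy => simp only [map_add, add_mul, hx, hy]
  simpa only [h1, h2, antipode_mul, epsRL_one, one_mul, mul_one] using h

lemma antipode_epsLL (z : A) : S (epsLL k A z) = epsRL k A z := by
  have h := congrArg (fun t => LinearMap.mul' k A (LinearMap.lTensor A S t))
    (epsRL_tmul_one_mul_comul_one (k := k) z)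
  have h1 (t : A ⊗[k] A) : LinearMap.mul' k A (LinearMap.lTensor A S (epsRL k A z ⊗ₜ 1 * t)) =
      epsRL k A z * LinearMap.mul' k A (LinearMap.lTensor A S t) := by
    induction t with
    | zero => simp
    | tmul p q => simp [mul_assoc]
    | add x y hx hy => simp only [map_add, mul_add, hx, hy]
  have h2 (t : A ⊗[k] A) : LinearMap.mul' k A (LinearMap.lTensor A S (1 ⊗ₜ epsLL k A z * t)) =
      LinearMap.mul' k A (LinearMap.lTensor A S t) * S (epsLL k A z) := by
    induction t with
    | zero => simp
    | tmul p q => simp [antipode_mul_rev, mul_assoc]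
    | add x y hx hy => simp only [map_add, mul_add, add_mul, hx, hy]
  simpa only [h1, h2, mul_antipode, epsLR_one, one_mul, mul_one] using h.symm

/-- `S(a₁) 1₁ a₂ ⊗ 1₂ = 1₁ ⊗ εˡʳ(a 1₂)` -/
lemma antipode_mul_comul_one_mul (a : A) :
    LinearMap.rTensor A (LinearMap.mul' k A ∘ₗ LinearMap.rTensor A S)
      ((TensorProduct.assoc k A A A).symm (LinearMap.lTensor A
        (LinearMap.mulLeft k (comul (R := k) (1 : A)) ∘ₗ (TensorProduct.mk k A A).flip 1)
          (comul (R := k) a))) =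
      LinearMap.lTensor A (epsLR k A ∘ₗ LinearMap.mulLeft k a) (comul (R := k) (1 : A)) := by
  have h : LinearMap.mulLeft k (comul (R := k) (1 : A)) ∘ₗ (TensorProduct.mk k A A).flip 1 =
      LinearMap.lTensor A (epsLR k A) ∘ₗ comul :=
    LinearMap.ext fun q => (lTensor_epsLR_comul (k := k) q).symm
  have h1 (t : A ⊗[k] A ⊗[k] A) : LinearMap.rTensor A (LinearMap.mul' k A ∘ₗ LinearMap.rTensor A S)
      ((TensorProduct.assoc k A A A).symm (LinearMap.lTensor A (LinearMap.lTensor A (epsLR k A))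
        (TensorProduct.assoc k A A A t))) =
      LinearMap.lTensor A (epsLR k A) (LinearMap.rTensor A (LinearMap.mul' k A ∘ₗ
        LinearMap.rTensor A S) t) := by
    induction t with
    | zero => simp
    | tmul t q =>
      induction t with
      | zero => simp
      | tmul p q => simp
      | add x y hx hy => simp only [map_add, TensorProduct.add_tmul, hx, hy]
    | add x y hx hy => simp only [map_add, hx, hy]
  have h2 : (LinearMap.mul' k A ∘ₗ LinearMap.rTensor A S) ∘ₗ comul = epsRL k A :=
    LinearMap.ext antipode_mul
  have h3 (t : A ⊗[k] A) : LinearMap.lTensor A (epsLR k A) (1 ⊗ₜ a * t) =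
      LinearMap.lTensor A (epsLR k A ∘ₗ LinearMap.mulLeft k a) t := by
    induction t with
    | zero => simp
    | tmul p q => simp
    | add x y hx hy => simp only [map_add, mul_add, hx, hy]
  rw [h, LinearMap.lTensor_comp_apply, ← coassoc', h1, ← LinearMap.rTensor_comp_apply, h2,
    rTensor_epsRL_comul, h3]

/-- `εʳʳ(1₂) 1₁ = 1` -/
lemma _root_.WeakBialgebra.epsRR_comul_one :
    LinearMap.mul' k A (TensorProduct.comm k A A (LinearMap.lTensor A (epsRR k A)
      (comul (R := k) (1 : A)))) = 1 := by
  have h (t : A ⊗[k] A) : LinearMap.mul' k A (TensorProduct.comm k A A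
      (LinearMap.lTensor A (epsRR k A) t)) = cR k A (comul (R := k) (1 : A) * t) := by
    induction t with
    | zero => simp
    | tmul p q =>
      rw [LinearMap.lTensor_tmul, TensorProduct.comm_tmul, LinearMap.mul'_apply, epsRR_apply,
        ← cR_mul_right, mul_assoc, Algebra.TensorProduct.tmul_mul_tmul, one_mul, mul_one]
    | add x y hx hy => simp only [map_add, mul_add, hx, hy]
  rw [h, comul_mul_one, cR_comul]

end

end WeakHopfAlgebra

namespace FinRep

open CoalgebraStruct WeakBialgebra WeakHopfAlgebra

noncomputable section

variable {k : Type u} {A : Type w} [Field k] [Ring A] [Algebra k A] [Module.Finite k A]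
  [WeakHopfAlgebra k A]

/-- The dual representation `(a f)(v) = f(S(a) v)`. -/
def dual (X : FinRep k A) : FinRep k A where
  V := FGModuleCat.of k (Module.Dual k X.V)
  ρ := AlgHom.ofLinearMap
    { toFun := fun a => FGModuleCat.ofHom (actV X (antipode (k := k) a)).dualMap
      map_add' := fun a b => FGModuleCat.hom_ext (LinearMap.ext fun f => LinearMap.ext fun v => by
        change f (actV X (antipode (a + b)) v) = f (actV X (antipode a) v) + f (actV X (antipode b) v)
        rw [map_add, map_add, LinearMap.add_apply, map_add])
      map_smul' := fun c a => FGModuleCat.hom_ext (LinearMap.ext fun f => LinearMap.ext fun v => by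
        change f (actV X (antipode (c • a)) v) = c • f (actV X (antipode a) v)
        rw [map_smul, map_smul, LinearMap.smul_apply, map_smul]) }
    (FGModuleCat.hom_ext (LinearMap.ext fun f => LinearMap.ext fun v => by
      change f (actV X (antipode 1) v) = f v
      rw [antipode_one, actV_one]))
    (fun a b => FGModuleCat.hom_ext (LinearMap.ext fun f => LinearMap.ext fun v => by
      change f (actV X (antipode (a * b)) v) = f (actV X (antipode b) (actV X (antipode a) v))
      rw [antipode_mul_rev, actV_mul]))

/-- The identification `V ⊗ V* ≅ End V`. -/
def tensorDualEquiv (X : FinRep k A) : X.V ⊗[k] (dual X).V ≃ₗ[k] (X.V →ₗ[k] X.V) :=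
  (TensorProduct.comm k X.V (Module.Dual k X.V)).trans (dualTensorHomEquiv k X.V X.V)

lemma tensorDualEquiv_tmul (X : FinRep k A) (v w : X.V) (f : Module.Dual k X.V) :
    tensorDualEquiv X (v ⊗ₜ f) w = f w • v :=
  dualTensorHom_apply f w v

lemma tensorDualEquiv_act₂ (X : FinRep k A) (a b : A) (t : X.V ⊗[k] (dual X).V) :
    tensorDualEquiv X ((act₂ X (dual X) (a ⊗ₜ b)).hom.hom t) =
      actV X a ∘ₗ tensorDualEquiv X t ∘ₗ actV X (antipode (k := k) b) := by
  induction t with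
  | zero => rw [map_zero, map_zero, LinearMap.zero_comp, LinearMap.comp_zero]
  | tmul v f =>
    rw [act₂_apply]
    refine LinearMap.ext fun w => ?_
    rw [LinearMap.comp_apply, LinearMap.comp_apply]
    erw [tensorDualEquiv_tmul, tensorDualEquiv_tmul]
    rw [map_smul]
    rfl
  | add s t hs ht =>
    rw [map_add, map_add, hs, ht, map_add, LinearMap.add_comp, LinearMap.comp_add]

/-- The coevaluation `Aˡ → V ⊗ V*`, corresponding to the action `Aˡ → End V`. -/
def coevLin (X : FinRep k A) : (unit k A).V ⟶ X.V ⊗ (dual X).V :=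
  FGModuleCat.ofHom ((tensorDualEquiv X).symm.toLinearMap ∘ₗ actV X ∘ₗ unitIncl k A)

lemma tensorDualEquiv_coevLin (X : FinRep k A) (y : (unit k A).V) :
    tensorDualEquiv X ((coevLin X).hom.hom y) = actV X (unitIncl k A y) :=
  (tensorDualEquiv X).apply_symm_apply _

lemma coevLin_act₂ (X : FinRep k A) (a : A) :
    coevLin X ≫ act₂ X (dual X) (comul a) = (unit k A).act a ≫ coevLin X := by
  refine FGModuleCat.hom_ext (LinearMap.ext fun y => (tensorDualEquiv X).injective ?_)
  have h (t : A ⊗[k] A) : tensorDualEquiv X ((act₂ X (dual X) t).hom.hom ((coevLin X).hom.hom y)) =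
      actV X (LinearMap.mul' k A (TensorProduct.map
        (LinearMap.mulRight k (epsLR k A (unitIncl k A y))) (antipode (k := k)) t)) := by
    induction t with
    | zero => rw [act₂_zero, map_zero, map_zero, map_zero]; exact map_zero _
    | tmul p q =>
      rw [tensorDualEquiv_act₂, tensorDualEquiv_coevLin, epsLR_unitIncl]
      refine LinearMap.ext fun v => ?_
      rw [TensorProduct.map_tmul, LinearMap.mul'_apply, actV_mul, LinearMap.mulRight_apply, actV_mul]
      rfl
    | add s t hs ht =>
      rw [map_add, map_add, map_add, ← hs, ← ht, act₂_add, ← map_add]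
      rfl
  refine (h _).trans ?_
  rw [mul_epsLR_mul_antipode]
  refine Eq.trans ?_ (tensorDualEquiv_coevLin X _).symm
  rw [← unitIncl_unitProj]
  rfl

/-- `f ↦ v ↦ t ↦ f(t₁ v) t₂` -/
def coeffSlice {M : Type*} [AddCommGroup M] [Module k M] (ρ : A →ₗ[k] M →ₗ[k] M) :
    Module.Dual k M →ₗ[k] M →ₗ[k] A ⊗[k] A →ₗ[k] A :=
  LinearMap.mk₂ k (fun f v => (TensorProduct.lid k A).toLinearMap ∘ₗ
      LinearMap.rTensor A (f ∘ₗ ρ.flip v))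
    (fun f g v => TensorProduct.ext' fun p q => by simp [add_smul])
    (fun c f v => TensorProduct.ext' fun p q => by simp [mul_smul])
    (fun f v w => TensorProduct.ext' fun p q => by simp [add_smul])
    (fun c f v => TensorProduct.ext' fun p q => by simp [mul_smul])

lemma coeffSlice_tmul {M : Type*} [AddCommGroup M] [Module k M] (ρ : A →ₗ[k] M →ₗ[k] M)
    (f : Module.Dual k M) (v : M) (a b : A) :
    coeffSlice ρ f v (a ⊗ₜ b) = f (ρ a v) • b := by
  simp [coeffSlice]

lemma coeffSlice_lTensor {M : Type*} [AddCommGroup M] [Module k M] (ρ : A →ₗ[k] M →ₗ[k] M)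
    (f : Module.Dual k M) (v : M) (g : A →ₗ[k] A) (t : A ⊗[k] A) :
    coeffSlice ρ f v (LinearMap.lTensor A g t) = g (coeffSlice ρ f v t) := by
  induction t with
  | zero => simp
  | tmul p q => simp [coeffSlice_tmul]
  | add x y hx hy => simp only [map_add, hx, hy]

/-- The evaluation `V* ⊗ V → Aˡ`, `f ⊗ v ↦ f(1₁ v) 1₂`. -/
def evLin (X : FinRep k A) : (dual X).V ⊗ X.V ⟶ (unit k A).V :=
  FGModuleCat.ofHom (TensorProduct.lift ((coeffSlice (actV X)).compr₂
    (unitProj k A ∘ₗ LinearMap.applyₗ (comul (R := k) (1 : A)))))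

lemma evLin_apply (X : FinRep k A) (f : Module.Dual k X.V) (v : X.V) :
    (evLin X).hom.hom (f ⊗ₜ[k] v) = unitProj k A (coeffSlice (actV X) f v (comul 1)) := rfl

lemma unitIncl_evLin (X : FinRep k A) (f : Module.Dual k X.V) (v : X.V) :
    unitIncl k A ((evLin X).hom.hom (f ⊗ₜ[k] v)) = coeffSlice (actV X) f v (comul 1) := by
  rw [evLin_apply, unitIncl_unitProj, ← coeffSlice_lTensor, lTensor_epsLR_comul_one]

lemma act₂_evLin (X : FinRep k A) (a : A) :
    act₂ (dual X) X (comul a) ≫ evLin X = evLin X ≫ (unit k A).act a := by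
  suffices h : ∀ (f : Module.Dual k X.V) (v : X.V),
      (evLin X).hom.hom ((act₂ (dual X) X (comul a)).hom.hom (f ⊗ₜ[k] v)) =
        unitProj k A (a * unitIncl k A ((evLin X).hom.hom (f ⊗ₜ[k] v))) from tensor_hom_ext h
  intro f v
  have h1 (s : A ⊗[k] A) (p q : A) :
      coeffSlice (actV X) (f ∘ₗ actV X (antipode (k := k) p)) (actV X q v) s =
      coeffSlice (actV X) f v (LinearMap.rTensor A (LinearMap.mul' k A ∘ₗ LinearMap.rTensor A antipode)
        ((TensorProduct.assoc k A A A).symm (p ⊗ₜ (s * q ⊗ₜ 1)))) := by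
    induction s with
    | zero => simp
    | tmul x y =>
      simp only [Algebra.TensorProduct.tmul_mul_tmul, TensorProduct.assoc_symm_tmul,
        LinearMap.rTensor_tmul, LinearMap.comp_apply, LinearMap.mul'_apply, coeffSlice_tmul, mul_one]
      rw [actV_mul, actV_mul]
    | add x y hx hy => simp only [map_add, hx, hy, add_mul, TensorProduct.tmul_add]
  have h2 (t : A ⊗[k] A) : (evLin X).hom.hom ((act₂ (dual X) X t).hom.hom (f ⊗ₜ[k] v)) =
      unitProj k A (coeffSlice (actV X) f v
        (LinearMap.rTensor A (LinearMap.mul' k A ∘ₗ LinearMap.rTensor A (antipode (k := k)))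
      ((TensorProduct.assoc k A A A).symm (LinearMap.lTensor A
        (LinearMap.mulLeft k (comul (R := k) (1 : A)) ∘ₗ (TensorProduct.mk k A A).flip 1) t)))) := by
    induction t with
    | zero => rw [act₂_zero]; simp only [map_zero]; exact map_zero _
    | tmul p q =>
      refine (congrArg (evLin X).hom.hom (act₂_apply (dual X) X p q f v)).trans ?_
      exact congrArg (unitProj k A) (h1 _ p q)
    | add s t hs ht => simp only [map_add, ← hs, ← ht, act₂_add]; exact map_add _ _ _
  rw [h2, antipode_mul_comul_one_mul, coeffSlice_lTensor, unitIncl_evLin, LinearMap.comp_apply,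
    unitProj_epsLR, LinearMap.mulLeft_apply]

lemma e_evLin (X : FinRep k A) : e (dual X) X ≫ evLin X = evLin X := by
  refine (act₂_evLin X 1).trans ?_
  rw [act_one]
  exact Category.comp_id _

/-- The coevaluation as a morphism of representations. -/
def coev (X : FinRep k A) : 𝟙_ (FinRep k A) ⟶ X ⊗ dual X where
  hom := coevLin X ≫ π X (dual X)
  comm a := by
    refine Eq.trans ?_ (Category.assoc _ _ _).symm
    refine Eq.trans ?_ (congrArg (coevLin X ≫ ·) (π_tensor_act X (dual X) a).symm)
    refine (Category.assoc _ _ _).symm.trans ((congrArg (· ≫ π X (dual X))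
      (coevLin_act₂ X a).symm).trans (Category.assoc _ _ _))

/-- The evaluation as a morphism of representations. -/
def ev (X : FinRep k A) : dual X ⊗ X ⟶ 𝟙_ (FinRep k A) where
  hom := ι (dual X) X ≫ evLin X
  comm a := by
    refine (tensor_act_ι_assoc (dual X) X a _).trans ?_
    rw [act₂_evLin]
    exact (Category.assoc _ _ _).symm

lemma π_coev_whiskerRight (X Y : FinRep k A) :
    π (unit k A) Y ≫ (coev X ▷ Y).hom = coevLin X ▷ Y.V ≫ qL X (dual X) Y := by
  refine (π_tensorMap (coev X) (𝟙 Y)).trans ?_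
  rw [id_hom, MonoidalCategory.tensorHom_id, qL, ← MonoidalCategory.comp_whiskerRight_assoc]
  rfl

lemma π_whiskerLeft_coev (X Y : FinRep k A) :
    π Y (unit k A) ≫ (Y ◁ coev X).hom = Y.V ◁ coevLin X ≫ qR Y X (dual X) := by
  refine (π_tensorMap (𝟙 Y) (coev X)).trans ?_
  rw [id_hom, MonoidalCategory.id_tensorHom, qR, ← MonoidalCategory.whiskerLeft_comp_assoc]
  rfl

lemma qR_whiskerLeft_ev (X Y : FinRep k A) :
    qR Y (dual X) X ≫ (Y ◁ ev X).hom = Y.V ◁ evLin X ≫ π Y (unit k A) := by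
  rw [qR, Category.assoc]
  refine (congrArg (Y.V ◁ π (dual X) X ≫ ·) (π_tensorMap (𝟙 Y) (ev X))).trans ?_
  rw [id_hom, MonoidalCategory.id_tensorHom]
  refine (MonoidalCategory.whiskerLeft_comp_assoc _ _ _ _).symm.trans ?_
  congr 2
  change π (dual X) X ≫ ι (dual X) X ≫ evLin X = _
  rw [π_ι_assoc, e_evLin]

lemma qL_ev_whiskerRight (X Y : FinRep k A) :
    qL (dual X) X Y ≫ (ev X ▷ Y).hom = evLin X ▷ Y.V ≫ π (unit k A) Y := by
  rw [qL, Category.assoc]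
  refine (congrArg (π (dual X) X ▷ Y.V ≫ ·) (π_tensorMap (ev X) (𝟙 Y))).trans ?_
  rw [id_hom, MonoidalCategory.tensorHom_id]
  refine (MonoidalCategory.comp_whiskerRight_assoc _ _ _ _).symm.trans ?_
  congr 2
  change π (dual X) X ≫ ι (dual X) X ≫ evLin X = _
  rw [π_ι_assoc, e_evLin]

lemma qR_assocInv (X Y Z : FinRep k A) :
    qR X Y Z ≫ assocInv X Y Z = (α_ X.V Y.V Z.V).inv ≫ qL X Y Z := by
  rw [← cancel_epi (α_ X.V Y.V Z.V).hom, ← Category.assoc, ← qL_assocHom, Category.assoc,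
    Iso.hom_inv_id_assoc]
  exact (congrArg (qL X Y Z ≫ ·) (congrArg Hom.hom (assoc X Y Z).hom_inv_id)).trans (Category.comp_id _)

/-- The element `Σ vᵢ ⊗ fⁱ` of `V ⊗ V*`. -/
def coevOne (X : FinRep k A) : 𝟙_ (FGModuleCat.{u} k) ⟶ X.V ⊗ (dual X).V := unitMap k A ≫ coevLin X

lemma tensorDualEquiv_coevOne (X : FinRep k A) :
    tensorDualEquiv X ((coevOne X).hom.hom (1 : k)) = LinearMap.id := by
  refine (tensorDualEquiv_coevLin X _).trans (LinearMap.ext fun v => ?_)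
  change actV X (unitIncl k A ((1 : k) • unitProj k A 1)) v = v
  rw [one_smul, unitIncl_unitProj_one, actV_one]

lemma coevOne_evLin_rt (X : FinRep k A) :
    (λ_ X.V).inv ≫ coevOne X ▷ X.V ≫ (α_ X.V (dual X).V X.V).hom ≫ X.V ◁ evLin X ≫ rt X = 𝟙 X.V := by
  refine FGModuleCat.hom_ext (LinearMap.ext fun w => ?_)
  let Φ : X.V ⊗[k] (dual X).V →ₗ[k] X.V := (rt X).hom.hom ∘ₗ (X.V ◁ evLin X).hom.hom ∘ₗ
    (α_ X.V (dual X).V X.V).hom.hom.hom ∘ₗ (TensorProduct.mk k (X.V ⊗[k] (dual X).V) X.V).flip w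
  let Ψ (s : A ⊗[k] A) (φ : X.V →ₗ[k] X.V) : X.V :=
    TensorProduct.lift ((actV X).flip.compl₁₂ (φ ∘ₗ (actV X).flip w) (epsRR k A)) s
  have Ψ_add (s t φ) : Ψ (s + t) φ = Ψ s φ + Ψ t φ := map_add _ _ _
  have hΨ (s : A ⊗[k] A) (v : X.V) (f : Module.Dual k X.V) :
      actV X (epsRR k A (coeffSlice (actV X) f w s)) v = Ψ s (tensorDualEquiv X (v ⊗ₜ f)) := by
    induction s with
    | zero => simp [Ψ]
    | tmul p q =>
      change _ = actV X (epsRR k A q) (tensorDualEquiv X (v ⊗ₜ f) (actV X p w))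
      rw [coeffSlice_tmul, tensorDualEquiv_tmul]
      simp
    | add x y hx hy => simp only [map_add, hx, hy, LinearMap.add_apply, Ψ]
  have h (t : X.V ⊗[k] (dual X).V) : Φ t = Ψ (comul 1) (tensorDualEquiv X t) := by
    induction t with
    | zero =>
      rw [map_zero, map_zero]
      generalize comul (R := k) (1 : A) = s
      induction s with
      | zero => simp [Ψ]
      | tmul p q => simp [Ψ]
      | add x y hx hy => simp only [Ψ, map_add, ← hx, ← hy, add_zero]
    | tmul v f =>
      exact (congrArg (fun a => actV X (epsRR k A a) v) (unitIncl_evLin X f w)).trans (hΨ _ v f)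
    | add s t hs ht =>
      rw [map_add, map_add, hs, ht]
      generalize comul (R := k) (1 : A) = s
      induction s with
      | zero => simp [Ψ]
      | tmul p q => simp [Ψ]
      | add x y hx hy => rw [Ψ_add, Ψ_add, Ψ_add, ← hx, ← hy]; abel
  refine (h _).trans ?_
  rw [tensorDualEquiv_coevOne]
  have h3 (s : A ⊗[k] A) : Ψ s LinearMap.id =
      actV X (LinearMap.mul' k A (TensorProduct.comm k A A (LinearMap.lTensor A (epsRR k A) s))) w := by
    induction s with
    | zero => simp [Ψ]
    | tmul p q => simp [Ψ, actV_mul]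
    | add x y hx hy => simp only [Ψ, map_add, LinearMap.add_apply] at hx hy ⊢; rw [hx, hy]
  rw [h3, epsRR_comul_one, actV_one]
  rfl

lemma coevOne_evLin_lt (X : FinRep k A) :
    (ρ_ (dual X).V).inv ≫ (dual X).V ◁ coevOne X ≫ (α_ (dual X).V X.V (dual X).V).inv ≫
      evLin X ▷ (dual X).V ≫ lt (dual X) = 𝟙 (dual X).V := by
  suffices h : ∀ (f : Module.Dual k X.V), ((lt (dual X)).hom.hom ((evLin X ▷ (dual X).V).hom.hom
      ((α_ (dual X).V X.V (dual X).V).inv.hom.hom (f ⊗ₜ[k] (coevOne X).hom.hom (1 : k)))) :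
        Module.Dual k X.V) = f from FGModuleCat.hom_ext (LinearMap.ext h)
  intro f
  refine LinearMap.ext fun w => ?_
  let Φ : X.V ⊗[k] (dual X).V →ₗ[k] Module.Dual k X.V := (lt (dual X)).hom.hom ∘ₗ
    (evLin X ▷ (dual X).V).hom.hom ∘ₗ (α_ (dual X).V X.V (dual X).V).inv.hom.hom ∘ₗ
      TensorProduct.mk k (Module.Dual k X.V) (X.V ⊗[k] (dual X).V) f
  let Ψ (s : A ⊗[k] A) (φ : X.V →ₗ[k] X.V) : k := f (TensorProduct.lift
    ((actV X).compl₂ (φ ∘ₗ (actV X).flip w ∘ₗ antipode (k := k))) s)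
  have Ψ_add (s t φ) : Ψ (s + t) φ = Ψ s φ + Ψ t φ := by simp [Ψ]
  have hΨ (s : A ⊗[k] A) (v : X.V) (g : Module.Dual k X.V) :
      g (actV X (antipode (k := k) (coeffSlice (actV X) f v s)) w) = Ψ s (tensorDualEquiv X (v ⊗ₜ g)) := by
    induction s with
    | zero => simp [Ψ]
    | tmul p q =>
      change _ = f (actV X p (tensorDualEquiv X (v ⊗ₜ g) (actV X (antipode (k := k) q) w)))
      rw [coeffSlice_tmul, tensorDualEquiv_tmul]
      simp [mul_comm]
    | add x y hx hy => simp only [map_add, hx, hy, LinearMap.add_apply, Ψ]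
  have h (t : X.V ⊗[k] (dual X).V) : Φ t w = Ψ (comul 1) (tensorDualEquiv X t) := by
    induction t with
    | zero =>
      rw [map_zero, map_zero, LinearMap.zero_apply]
      generalize comul (R := k) (1 : A) = s
      induction s with
      | zero => simp [Ψ]
      | tmul p q => simp [Ψ]
      | add x y hx hy => simp only [Ψ, map_add, ← hx, ← hy, add_zero]
    | tmul v g =>
      exact (congrArg (fun a => (show Module.Dual k X.V from g) (actV X (antipode (k := k) a) w)) (unitIncl_evLin X f v)).trans (hΨ _ v g)
    | add s t hs ht =>
      rw [map_add, map_add, LinearMap.add_apply, hs, ht]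
      generalize comul (R := k) (1 : A) = s
      induction s with
      | zero => simp [Ψ]
      | tmul p q => simp [Ψ]
      | add x y hx hy => rw [Ψ_add, Ψ_add, Ψ_add, ← hx, ← hy]; abel
  refine (h _).trans ?_
  rw [tensorDualEquiv_coevOne]
  have h3 (s : A ⊗[k] A) : Ψ s LinearMap.id =
      f (actV X (LinearMap.mul' k A (LinearMap.lTensor A (antipode (k := k)) s)) w) := by
    induction s with
    | zero => simp [Ψ]
    | tmul p q => simp [Ψ, actV_mul]
    | add x y hx hy => simp only [Ψ, map_add, LinearMap.add_apply] at hx hy ⊢; rw [hx, hy]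
  rw [h3, mul_antipode, epsLR_one, actV_one]

/-- A zigzag through the unit and the associator, computed on the ambient tensor products. -/
lemma zigzag_eq {C : Type*} [Category* C] {a b c d e f b' d' f' g h i : C} {l : a ⟶ b} {u : b ⟶ c}
    {p : c ⟶ d} {η : d ⟶ e} {q : b' ⟶ e} {y : c ⟶ b'} {A : e ⟶ f} {α : b' ⟶ d'} {q' : d' ⟶ f}
    {ε : f ⟶ g} {p' : f' ⟶ g} {x : d' ⟶ f'} {j : g ⟶ h} {z : f' ⟶ h} {r : h ⟶ i}
    {r' : f' ⟶ i}
    (h₁ : p ≫ η = y ≫ q) (h₂ : q ≫ A = α ≫ q') (h₃ : q' ≫ ε = x ≫ p') (h₄ : p' ≫ j = z)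
    (h₅ : z ≫ r = r') :
    (l ≫ u ≫ p) ≫ (η ≫ A ≫ ε) ≫ j ≫ r = l ≫ (u ≫ y) ≫ α ≫ x ≫ r' := by
  simp only [Category.assoc]
  rw [reassoc_of% h₁, reassoc_of% h₂, reassoc_of% h₃, reassoc_of% h₄, h₅]

/-- The dual representation is a dual object. -/
instance (X : FinRep k A) : ExactPairing X (dual X) where
  coevaluation' := coev X
  evaluation' := ev X
  evaluation_coevaluation' := by
    rw [← Iso.inv_comp_eq, ← cancel_mono (ρ_ X).hom, Iso.inv_hom_id, Category.assoc]
    apply hom_ext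
    refine (zigzag_eq (π_coev_whiskerRight X X) (qL_assocHom X (dual X) X) (qR_whiskerLeft_ev X X)
      (π_ι X (unit k A)) (e_rt X)).trans ?_
    rw [← MonoidalCategory.comp_whiskerRight]
    exact coevOne_evLin_rt X
  coevaluation_evaluation' := by
    rw [← Iso.inv_comp_eq, ← cancel_mono (λ_ (dual X)).hom, Iso.inv_hom_id, Category.assoc]
    apply hom_ext
    refine (zigzag_eq (π_whiskerLeft_coev X (dual X)) (qR_assocInv (dual X) X (dual X))
      (qL_ev_whiskerRight X (dual X)) (π_ι (unit k A) (dual X)) (e_lt (dual X))).trans ?_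
    rw [← MonoidalCategory.whiskerLeft_comp]
    exact coevOne_evLin_lt X

end
end FinRep

open MvPolynomial in
/-- A linear self-map of `Hom(A, B)` which preserves the set of algebra homomorphisms and is
injective on it is surjective on it, by the Ax–Grothendieck theorem. -/
lemma AlgHom.exists_preimage_of_injOn {k : Type*} {A : Type*} {B : Type*} [Field k] [IsAlgClosed k]
    [Ring A] [Algebra k A] [Module.Finite k A] [Ring B] [Algebra k B] [Module.Finite k B]
    (L : (A →ₗ[k] B) →ₗ[k] (A →ₗ[k] B))
    (hL : ∀ φ : A →ₐ[k] B, ∃ φ' : A →ₐ[k] B, L φ.toLinearMap = φ'.toLinearMap)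
    (hinj : ∀ φ φ' : A →ₐ[k] B, L φ.toLinearMap = L φ'.toLinearMap → φ = φ') (ψ : A →ₐ[k] B) :
    ∃ φ : A →ₐ[k] B, L φ.toLinearMap = ψ.toLinearMap := by
  let b := Module.finBasis k (A →ₗ[k] B)
  let E := b.equivFun
  let p (i) : MvPolynomial _ k := ∑ j, C (b.repr (L (b j)) i) * X j
  let q₁ (f : Module.Dual k B) : MvPolynomial (Fin (Module.finrank k (A →ₗ[k] B))) k :=
    ∑ i, C (f (b i 1)) * X i - C (f 1)
  let q₂ (t : A × A × Module.Dual k B) : MvPolynomial (Fin (Module.finrank k (A →ₗ[k] B))) k :=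
    ∑ i, C (t.2.2 (b i (t.1 * t.2.1))) * X i -
      ∑ i, ∑ j, C (t.2.2 (b i t.1 * b j t.2.1)) * X i * X j
  have E_symm (x) : E.symm x = ∑ i, x i • b i := b.equivFun_symm_apply x
  have hp (x) : (fun i => eval x (p i)) = E (L (E.symm x)) := by
    funext i
    simp [p, E_symm, E, mul_comm]
  have hq₁ (f x) : aeval x (q₁ f) = f (E.symm x 1) - f 1 := by
    simp [q₁, E_symm, mul_comm]
  have hq₂ (t x) : aeval x (q₂ t) = t.2.2 (E.symm x (t.1 * t.2.1)) -
      t.2.2 (E.symm x t.1 * E.symm x t.2.1) := by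
    simp [q₂, E_symm, Finset.sum_mul_sum, mul_comm]
  let I := Ideal.span (Set.range q₁ ∪ Set.range q₂)
  have hI (x) : x ∈ zeroLocus k I ↔ ∃ φ : A →ₐ[k] B, E φ.toLinearMap = x := by
    rw [zeroLocus_span]
    constructor
    · intro h
      have h1 : E.symm x 1 = 1 := by
        rw [← sub_eq_zero, ← Module.forall_dual_apply_eq_zero_iff k]
        intro f
        rw [map_sub, ← hq₁]
        exact h _ (Or.inl ⟨f, rfl⟩)
      have h2 (a a') : E.symm x (a * a') = E.symm x a * E.symm x a' := by
        rw [← sub_eq_zero, ← Module.forall_dual_apply_eq_zero_iff k]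
        intro f
        rw [map_sub, ← hq₂ (a, a', f)]
        exact h _ (Or.inr ⟨_, rfl⟩)
      exact ⟨AlgHom.ofLinearMap (E.symm x) h1 h2, E.apply_symm_apply x⟩
    · rintro ⟨φ, rfl⟩ r (⟨f, rfl⟩ | ⟨t, rfl⟩)
      · rw [hq₁, E.symm_apply_apply, AlgHom.toLinearMap_apply, map_one, sub_self]
      · simp only [hq₂, E.symm_apply_apply, AlgHom.toLinearMap_apply, map_mul, sub_self]
  have key := ax_grothendieck_zeroLocus I p
  rw [show (fun v i => eval v (p i)) = fun x => E (L (E.symm x)) from funext hp] at key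
  obtain ⟨x, hx, hx'⟩ := key
    (fun x hx => by
      obtain ⟨φ, rfl⟩ := (hI x).1 hx
      obtain ⟨φ', h⟩ := hL φ
      exact (hI _).2 ⟨φ', by simp only [E.symm_apply_apply, h]⟩)
    (fun x hx y hy h => by
      obtain ⟨φ, rfl⟩ := (hI x).1 hx
      obtain ⟨φ', rfl⟩ := (hI y).1 hy
      simp only [E.symm_apply_apply] at h
      rw [hinj φ φ' (E.injective h)])
    ((hI (E ψ.toLinearMap)).2 ⟨ψ, rfl⟩)
  obtain ⟨φ, rfl⟩ := (hI x).1 hx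
  simp only [E.symm_apply_apply] at hx'
  exact ⟨φ, E.injective hx'⟩

namespace WeakHopfAlgebra

open CoalgebraStruct WeakBialgebra

section

variable {k : Type u} {A : Type w} [Field k] [Ring A] [Algebra k A]

lemma _root_.WeakBialgebra.mul'_map_epsLR_id [WeakBialgebra k A] (x : A) :
    LinearMap.mul' k A (TensorProduct.map (epsLR k A) LinearMap.id (comul (R := k) x)) = x := by
  have h (t : A ⊗[k] A) : LinearMap.mul' k A (TensorProduct.map (epsLR k A) LinearMap.id t) =
      cL k A (comul (R := k) (1 : A) * t) := by
    induction t with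
    | zero => simp
    | tmul p q =>
      rw [TensorProduct.map_tmul, LinearMap.mul'_apply, epsLR_apply, LinearMap.id_apply,
        ← cL_mul_right, mul_assoc, Algebra.TensorProduct.tmul_mul_tmul, one_mul, mul_one]
    | add x y hx hy => simp only [map_add, mul_add, hx, hy]
  rw [h, comul_one_mul, cL_comul]

lemma _root_.WeakBialgebra.mul'_map_id_epsRL [WeakBialgebra k A] (x : A) :
    LinearMap.mul' k A (TensorProduct.map LinearMap.id (epsRL k A) (comul (R := k) x)) = x := by
  have h (t : A ⊗[k] A) : LinearMap.mul' k A (TensorProduct.map LinearMap.id (epsRL k A) t) =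
      cR k A (t * comul (R := k) (1 : A)) := by
    induction t with
    | zero => simp
    | tmul p q =>
      rw [TensorProduct.map_tmul, LinearMap.mul'_apply, epsRL_apply, LinearMap.id_apply,
        ← cR_mul_left, ← mul_assoc, Algebra.TensorProduct.tmul_mul_tmul, one_mul, mul_one]
    | add x y hx hy => simp only [map_add, add_mul, hx, hy]
  rw [h, comul_mul_one, cR_comul]

variable [WeakHopfAlgebra k A] {B : Type*} [Ring B] [Algebra k B]

/-- An algebra homomorphism on a weak Hopf algebra is determined by its composite with the
antipode. -/
lemma algHom_ext_antipode {φ ψ : A →ₐ[k] B} (h : ∀ a, φ (antipode (k := k) a) = ψ (antipode (k := k) a)) :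
    φ = ψ := by
  have conv (φ : A →ₐ[k] B) (f g : A →ₗ[k] A) :
      WithConv.toConv (φ.toLinearMap ∘ₗ f) * WithConv.toConv (φ.toLinearMap ∘ₗ g) =
        WithConv.toConv (φ.toLinearMap ∘ₗ LinearMap.mul' k A ∘ₗ TensorProduct.map f g ∘ₗ comul) := by
    refine congrArg WithConv.toConv (LinearMap.ext fun a => ?_)
    change LinearMap.mul' k B (TensorProduct.map _ _ (comul a)) =
      φ (LinearMap.mul' k A (TensorProduct.map f g (comul a)))
    generalize comul (R := k) a = t
    induction t with
    | zero => simp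
    | tmul p q => simp
    | add x y hx hy => simp only [map_add, hx, hy]
  have hS : φ.toLinearMap ∘ₗ antipode = ψ.toLinearMap ∘ₗ antipode (k := k) := LinearMap.ext h
  have hLR : φ.toLinearMap ∘ₗ epsLR k A = ψ.toLinearMap ∘ₗ epsLR k A := LinearMap.ext fun a => by
    simp only [LinearMap.comp_apply, ← antipode_epsRR]
    exact h _
  have hRL : φ.toLinearMap ∘ₗ epsRL k A = ψ.toLinearMap ∘ₗ epsRL k A := LinearMap.ext fun a => by
    simp only [LinearMap.comp_apply, ← antipode_epsLL]
    exact h _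
  have h1 : LinearMap.mul' k A ∘ₗ TensorProduct.map antipode LinearMap.id ∘ₗ comul = epsRL k A :=
    LinearMap.ext antipode_mul
  have h2 : LinearMap.mul' k A ∘ₗ TensorProduct.map LinearMap.id antipode ∘ₗ comul = epsLR k A :=
    LinearMap.ext mul_antipode
  have h3 : LinearMap.mul' k A ∘ₗ TensorProduct.map (epsLR k A) LinearMap.id ∘ₗ comul = LinearMap.id :=
    LinearMap.ext mul'_map_epsLR_id
  have h4 : LinearMap.mul' k A ∘ₗ TensorProduct.map LinearMap.id (epsRL k A) ∘ₗ comul = LinearMap.id :=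
    LinearMap.ext mul'_map_id_epsRL
  have key := mul_assoc (WithConv.toConv (φ.toLinearMap ∘ₗ LinearMap.id))
    (WithConv.toConv (φ.toLinearMap ∘ₗ antipode (k := k))) (WithConv.toConv (ψ.toLinearMap ∘ₗ LinearMap.id))
  rw [conv, h2, hLR, conv, h3, hS, conv, h1, ← hRL, conv, h4] at key
  exact AlgHom.ext fun a => (congrArg (fun f => f a) key).symm

end

end WeakHopfAlgebra

namespace FinRep

open CoalgebraStruct WeakBialgebra WeakHopfAlgebra

noncomputable section

variable {k : Type u} {A : Type w} [Field k] [Ring A] [Algebra k A] [Module.Finite k A]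
  [WeakHopfAlgebra k A]

/-- Over an algebraically closed field every representation is a dual representation. -/
lemma exists_dual_iso [IsAlgClosed k] (Y : FinRep k A) : ∃ X : FinRep k A, Nonempty (Y ≅ dual X) := by
  obtain ⟨ed⟩ : Nonempty (Y.Carrier ≃ₗ[k] Module.Dual k Y.Carrier) :=
    ⟨LinearEquiv.ofFinrankEq _ _ Subspace.dual_finrank_eq.symm⟩
  let t : Module.End k Y.Carrier →ₗ[k] Module.End k Y.Carrier :=
    ed.symm.conj.toLinearMap ∘ₗ Module.Dual.transpose
  have t_apply (f x) : ed (t f x) = (ed x) ∘ₗ f := by 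
    simp [t, LinearEquiv.conj_apply, Module.Dual.transpose]; rfl
  have t_inj : Function.Injective t := fun f g h => LinearMap.ext fun x => by
    rw [← sub_eq_zero, ← Module.forall_dual_apply_eq_zero_iff k]
    intro φ
    obtain ⟨y, rfl⟩ := ed.surjective φ
    rw [map_sub, sub_eq_zero, ← LinearMap.comp_apply, ← t_apply, h, t_apply, LinearMap.comp_apply]
  have t_mul (f g) : t (f * g) = t g * t f := LinearMap.ext fun x => ed.injective <| by
    rw [Module.End.mul_apply, t_apply, t_apply, t_apply]; rfl
  have t_one : t 1 = 1 := LinearMap.ext fun x => ed.injective <| by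
    rw [t_apply]; rfl
  obtain ⟨φ, hφ⟩ := AlgHom.exists_preimage_of_injOn
    (LinearMap.llcomp k A _ _ t ∘ₗ LinearMap.lcomp k (Module.End k Y.Carrier) (antipode (k := k) (A := A)))
    (fun φ => ⟨AlgHom.ofLinearMap (t ∘ₗ φ.toLinearMap ∘ₗ antipode (k := k))
      (by simp [antipode_one, t_one]) (fun a b => by simp [antipode_mul_rev, t_mul]), rfl⟩)
    (fun φ φ' h => algHom_ext_antipode fun a => t_inj (LinearMap.congr_fun h a)) Y.toLin
  let X : FinRep k A := ⟨Y.V, AlgHom.ofLinearMap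
    { toFun := fun a => FGModuleCat.ofHom (φ a)
      map_add' := fun a b => by rw [map_add]; rfl
      map_smul' := fun c a => by rw [map_smul]; rfl }
    (FGModuleCat.hom_ext (map_one φ)) (fun a b => FGModuleCat.hom_ext (map_mul φ a b))⟩
  let f : Y.V ⟶ (dual X).V := FGModuleCat.ofHom ed.toLinearMap
  let g : (dual X).V ⟶ Y.V := FGModuleCat.ofHom ed.symm.toLinearMap
  refine ⟨X, ⟨mkIso ⟨f, fun a => FGModuleCat.hom_ext (LinearMap.ext fun y => ?_)⟩ g
    (FGModuleCat.hom_ext (LinearMap.ext ed.symm_apply_apply))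
    (FGModuleCat.hom_ext (LinearMap.ext ed.apply_symm_apply))⟩⟩
  have h1 := LinearMap.congr_fun (LinearMap.congr_fun hφ a) y
  exact (congrArg ed h1.symm).trans (t_apply _ _)

variable (k A) in
lemma nonempty_rigidCategory [IsAlgClosed k] : Nonempty (RigidCategory (FinRep k A)) := by
  have h (Y : FinRep k A) : ∃ X : FinRep k A, Nonempty (ExactPairing X Y) := by
    obtain ⟨X, ⟨i⟩⟩ := exists_dual_iso Y
    exact ⟨X, ⟨exactPairingCongrRight i⟩⟩
  choose D hD using h
  exact ⟨{ rightDual := fun X => ⟨dual X⟩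
           leftDual := fun Y => @HasLeftDual.mk _ _ _ Y (D Y) (hD Y).some }⟩

end
end FinRep

namespace FinRep

noncomputable section

section Restriction

variable {k : Type u} [Field k] {A : Type w} [Ring A] [Algebra k A] {B : Type w'} [Ring B]
  [Algebra k B]

/-- Restriction of representations along an algebra homomorphism. -/
def restrict (f : B →ₐ[k] A) : FinRep k A ⥤ FinRep k B where
  obj X := ⟨X.V, X.ρ.comp f⟩
  map g := ⟨g.hom, fun b => g.comm (f b)⟩

instance (f : B →ₐ[k] A) : (restrict f).Additive where
  map_add := rfl

instance (f : B →ₐ[k] A) : (restrict f).Linear k where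
  map_smul _ _ := rfl

instance (f : B →ₐ[k] A) : (restrict f).Faithful where
  map_injective h := hom_ext (congrArg Hom.hom h :)

instance (f : B ≃ₐ[k] A) : (restrict f.toAlgHom).IsEquivalence where
  full := ⟨fun {X Y} g => ⟨⟨g.hom, fun a => by
    obtain ⟨b, rfl⟩ := f.surjective a
    exact g.comm b⟩, rfl⟩⟩
  essSurj := ⟨fun Y => ⟨⟨Y.V, Y.ρ.comp f.symm.toAlgHom⟩, ⟨mkIso ⟨𝟙 Y.V, fun b => by
      have h : Y.ρ (f.symm (f b)) = Y.ρ b := by rw [f.symm_apply_apply]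
      exact (Category.comp_id _).trans (h.trans (Category.id_comp _).symm)⟩ (𝟙 Y.V)
    (Category.comp_id _) (Category.comp_id _)⟩⟩⟩

variable (k A) in
lemma isFiniteLinearCategory [Module.Finite k A] : IsFiniteLinearCategory k (FinRep k A) := by
  have : Small.{u} A := Module.Finite.small k A
  exact ⟨Shrink.{u} A, inferInstance, inferInstance,
    Module.Finite.equiv (Shrink.linearEquiv.{u} k A).symm, restrict (Shrink.algEquiv k A).toAlgHom,
    inferInstance, inferInstance, inferInstance⟩

end Restriction

section Monoidal

variable {k : Type u} [Field k] {A : Type w} [Ring A] [Algebra k A] [Module.Finite k A]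

open WeakBialgebra

section WeakBialgebra

variable [WeakBialgebra k A]

lemma whiskerLeft_hom (X : FinRep k A) {Y Z : FinRep k A} (f : Y ⟶ Z) :
    (X ◁ f).hom = ι X Y ≫ X.V ◁ f.hom ≫ π X Z := by
  rw [← MonoidalCategory.id_tensorHom]; rfl

lemma whiskerRight_hom {Y Z : FinRep k A} (f : Y ⟶ Z) (X : FinRep k A) :
    (f ▷ X).hom = ι Y X ≫ f.hom ▷ X.V ≫ π Z X := by
  rw [← MonoidalCategory.tensorHom_id]; rfl

instance : MonoidalPreadditive (FinRep k A) where
  whiskerLeft_zero := hom_ext (by simp [whiskerLeft_hom])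
  zero_whiskerRight := hom_ext (by simp [whiskerRight_hom])
  whiskerLeft_add f g := hom_ext (by
    refine (whiskerLeft_hom _ _).trans ?_
    rw [add_hom, add_hom, whiskerLeft_hom, whiskerLeft_hom, MonoidalPreadditive.whiskerLeft_add,
      Preadditive.add_comp, Preadditive.comp_add])
  add_whiskerRight f g := hom_ext (by
    refine (whiskerRight_hom _ _).trans ?_
    rw [add_hom, add_hom, whiskerRight_hom, whiskerRight_hom, MonoidalPreadditive.add_whiskerRight,
      Preadditive.add_comp, Preadditive.comp_add])

instance : MonoidalLinear k (FinRep k A) where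
  whiskerLeft_smul X _ _ r f := hom_ext (by
    refine (whiskerLeft_hom _ _).trans ?_
    rw [smul_hom, smul_hom, whiskerLeft_hom, MonoidalLinear.whiskerLeft_smul, Linear.smul_comp,
      Linear.comp_smul])
  smul_whiskerRight r _ _ f X := hom_ext (by
    refine (whiskerRight_hom _ _).trans ?_
    rw [smul_hom, smul_hom, whiskerRight_hom, MonoidalLinear.smul_whiskerRight, Linear.smul_comp,
      Linear.comp_smul])

lemma act₂_comul (X Y : FinRep k A) (a : A) :
    act₂ X Y (CoalgebraStruct.comul a) = π X Y ≫ (tensor X Y).act a ≫ ι X Y := by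
  rw [tensor_act_ι, π_ι_assoc, e_act]

lemma e_ι_π (X Y Z : FinRep k A) :
    e (tensor X Y) Z ≫ ι X Y ▷ Z.V ≫ (α_ X.V Y.V Z.V).hom ≫ X.V ◁ π Y Z =
      ι X Y ▷ Z.V ≫ (α_ X.V Y.V Z.V).hom ≫ X.V ◁ π Y Z := by
  have h1 := tripleAct_rTensor X Y Z (tensor X Y) CoalgebraStruct.comul (π X Y) (ι X Y)
    (act₂_comul X Y) (CoalgebraStruct.comul 1)
  rw [coassoc', ← comul_one_right, tripleAct_mul, tripleAct_assoc, tripleAct_tmul, act_one, act_one,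
    MonoidalCategory.id_tensorHom, MonoidalCategory.tensorHom_id] at h1
  have h2 := congrArg (fun f => ι X Y ▷ Z.V ≫ (α_ X.V Y.V Z.V).hom ≫ f ≫ X.V ◁ π Y Z) h1
  simp only [Category.assoc, Iso.hom_inv_id_assoc] at h2
  rw [← MonoidalCategory.comp_whiskerRight_assoc, ← MonoidalCategory.comp_whiskerRight_assoc,
    ι_π, MonoidalCategory.id_whiskerRight, ← MonoidalCategory.whiskerLeft_comp] at h2
  have h3 : act₂ Y Z (CoalgebraStruct.comul 1) ≫ π Y Z = π Y Z := e_π Y Z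
  have h4 : ι X Y ≫ act₂ X Y (CoalgebraStruct.comul 1) = ι X Y := ι_e X Y
  rw [h3, h4] at h2
  exact (h2.trans (Category.id_comp _)).symm

lemma e_ι_π' (X Y Z : FinRep k A) :
    e X (tensor Y Z) ≫ X.V ◁ ι Y Z ≫ (α_ X.V Y.V Z.V).inv ≫ π X Y ▷ Z.V =
      X.V ◁ ι Y Z ≫ (α_ X.V Y.V Z.V).inv ≫ π X Y ▷ Z.V := by
  have h1 := tripleAct_lTensor X Y Z (tensor Y Z) CoalgebraStruct.comul (π Y Z) (ι Y Z)
    (act₂_comul Y Z) (CoalgebraStruct.comul 1)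
  rw [← comul_one_left, tripleAct_mul, tripleAct_assoc, tripleAct_tmul, act_one, act_one,
    MonoidalCategory.id_tensorHom, MonoidalCategory.tensorHom_id] at h1
  have h2 := congrArg (fun f => X.V ◁ ι Y Z ≫ f ≫ (α_ X.V Y.V Z.V).inv ≫ π X Y ▷ Z.V) h1
  simp only [Category.assoc, Iso.hom_inv_id_assoc] at h2
  rw [← MonoidalCategory.whiskerLeft_comp_assoc, ← MonoidalCategory.whiskerLeft_comp_assoc,
    ι_π, MonoidalCategory.whiskerLeft_id, ← MonoidalCategory.comp_whiskerRight] at h2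
  have h3 : act₂ X Y (CoalgebraStruct.comul 1) ≫ π X Y = π X Y := e_π X Y
  have h4 : ι Y Z ≫ act₂ Y Z (CoalgebraStruct.comul 1) = ι Y Z := ι_e Y Z
  rw [h3, h4] at h2
  exact (h2.trans (Category.id_comp _)).symm

variable (k A) in
lemma isSeparableFrobenius_forget : IsSeparableFrobenius (forget k A) where
  frobenius_left X Y Z := by
    change ι X Y ▷ Z.V ≫ (α_ X.V Y.V Z.V).hom ≫ X.V ◁ π Y Z =
      π (tensor X Y) Z ≫ assocHom X Y Z ≫ ι X (tensor Y Z)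
    have h : ι X (tensor Y Z) = jR X Y Z ≫ X.V ◁ π Y Z := by
      rw [jR, Category.assoc, ← MonoidalCategory.whiskerLeft_comp, ι_π, MonoidalCategory.whiskerLeft_id]
      exact (Category.comp_id _).symm
    rw [h, assocHom_jR_assoc, jL, Category.assoc, π_ι_assoc, e_ι_π]
  frobenius_right X Y Z := by
    change X.V ◁ ι Y Z ≫ (α_ X.V Y.V Z.V).inv ≫ π X Y ▷ Z.V =
      π X (tensor Y Z) ≫ assocInv X Y Z ≫ ι (tensor X Y) Z
    have h : ι (tensor X Y) Z = jL X Y Z ≫ π X Y ▷ Z.V := by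
      rw [jL, Category.assoc, ← MonoidalCategory.comp_whiskerRight, ι_π, MonoidalCategory.id_whiskerRight]
      exact (Category.comp_id _).symm
    rw [h, assocInv_jL_assoc, jR, Category.assoc, π_ι_assoc, e_ι_π']
  separable X Y := ι_π X Y

variable (k A) in
lemma isWeakFiberFunctor_forget : IsWeakFiberFunctor k (forget k A) where
  additive := inferInstance
  linear := inferInstance
  faithful := inferInstance
  preservesFiniteLimits := inferInstance
  preservesFiniteColimits := inferInstance
  separableFrobenius := isSeparableFrobenius_forget k A

end WeakBialgebra

variable (k A) in
lemma isFiniteMultiTensorCategory [IsAlgClosed k] [WeakHopfAlgebra k A] :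
    IsFiniteMultiTensorCategory k (FinRep k A) where
  finite := isFiniteLinearCategory k A
  monoidalPreadditive := inferInstance
  monoidalLinear := inferInstance
  rigid := nonempty_rigidCategory k A

end Monoidal

section Tautological

variable (k : Type u) [Field k] (A : Type w) [Ring A] [Algebra k A]

/-- The action of an algebra on the forgetful functor of its category of representations. -/
def forgetAction : NatAction k A (forget k A) where
  ρ X := X.ρ
  naturality' f a := (f.comm a).symm


/-- The regular representation. -/
def regular [Small.{u} A] [Module.Finite k A] : FinRep k A where
  V := FGModuleCat.of k (Shrink.{u} A)
  ρ := AlgHom.ofLinearMap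
    { toFun := fun a => FGModuleCat.ofHom ((Shrink.linearEquiv.{u} k A).symm.conj (LinearMap.mulLeft k a))
      map_add' := fun a b => FGModuleCat.hom_ext (LinearMap.ext fun s => by
        change (Shrink.linearEquiv.{u} k A).symm ((a + b) * _) =
          (Shrink.linearEquiv.{u} k A).symm (a * _) + (Shrink.linearEquiv.{u} k A).symm (b * _)
        rw [add_mul, map_add])
      map_smul' := fun c a => FGModuleCat.hom_ext (LinearMap.ext fun s => by
        change (Shrink.linearEquiv.{u} k A).symm ((c • a) * _) =
          c • (Shrink.linearEquiv.{u} k A).symm (a * _)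
        rw [smul_mul_assoc, map_smul]) }
    (FGModuleCat.hom_ext (LinearMap.ext fun s => by
      change (Shrink.linearEquiv.{u} k A).symm (1 * Shrink.linearEquiv.{u} k A s) = s
      rw [one_mul, LinearEquiv.symm_apply_apply]))
    (fun a b => FGModuleCat.hom_ext (LinearMap.ext fun s => by
      change (Shrink.linearEquiv.{u} k A).symm (a * b * _) = (Shrink.linearEquiv.{u} k A).symm
        (a * Shrink.linearEquiv.{u} k A ((Shrink.linearEquiv.{u} k A).symm (b * _)))
      rw [LinearEquiv.apply_symm_apply, mul_assoc]))

lemma represents_regular [Small.{u} A] [Module.Finite k A] :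
    Represents (forget k A) (regular k A) ((Shrink.linearEquiv.{u} k A).symm 1 : Shrink.{u} A) := by
  intro X
  have key (f : regular k A ⟶ X) (s : Shrink.{u} A) : f.hom.hom.hom s =
      (X.act (Shrink.linearEquiv.{u} k A s)).hom.hom (f.hom.hom.hom ((Shrink.linearEquiv.{u} k A).symm 1)) := by
    have h := congrArg (fun g : (regular k A).V ⟶ X.V => g.hom.hom ((Shrink.linearEquiv.{u} k A).symm 1 :
      Shrink.{u} A)) (f.comm (Shrink.linearEquiv.{u} k A s))
    refine Eq.trans (congrArg f.hom.hom.hom ?_) h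
    change s = (Shrink.linearEquiv.{u} k A).symm (Shrink.linearEquiv.{u} k A s *
      Shrink.linearEquiv.{u} k A ((Shrink.linearEquiv.{u} k A).symm 1))
    rw [LinearEquiv.apply_symm_apply, mul_one, LinearEquiv.symm_apply_apply]
  constructor
  · intro f g h
    refine hom_ext (FGModuleCat.hom_ext (LinearMap.ext fun s => ?_))
    exact (key f s).trans ((congrArg (X.act (Shrink.linearEquiv.{u} k A s)).hom.hom h).trans (key g s).symm)
  · intro x
    refine ⟨⟨FGModuleCat.ofHom (X.orbit x ∘ₗ (Shrink.linearEquiv.{u} k A).toLinearMap), fun a =>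
      FGModuleCat.hom_ext (LinearMap.ext fun s => ?_)⟩, ?_⟩
    · change (X.act (Shrink.linearEquiv.{u} k A ((Shrink.linearEquiv.{u} k A).symm
        (a * Shrink.linearEquiv.{u} k A s)))).hom.hom x = (X.act a).hom.hom
          ((X.act (Shrink.linearEquiv.{u} k A s)).hom.hom x)
      rw [LinearEquiv.apply_symm_apply, act_mul]
      rfl
    · change (X.act (Shrink.linearEquiv.{u} k A ((Shrink.linearEquiv.{u} k A).symm 1))).hom.hom x = x
      rw [LinearEquiv.apply_symm_apply, act_one]
      rfl

lemma isFull_forgetAction [Module.Finite k A] : (forgetAction k A).IsFull := by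
  have : Small.{u} A := Module.Finite.small k A
  refine (represents_regular k A).isFull (Shrink.linearEquiv.{u} k A).symm fun a => ?_
  change (Shrink.linearEquiv.{u} k A).symm
    (a * Shrink.linearEquiv.{u} k A ((Shrink.linearEquiv.{u} k A).symm 1)) = _
  rw [LinearEquiv.apply_symm_apply, mul_one]
  rfl

open CoalgebraStruct WeakBialgebra in
lemma isReconstructedCoalgebra_forgetAction [Module.Finite k A] [WeakBialgebra k A] :
    IsReconstructedCoalgebra (forgetAction k A) where
  comul a X Y := act₂_comul X Y a
  counit a := by
    rw [← smul_id_unit (Functor.LaxMonoidal.ε (forget k A) ≫ _)]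
    congr 1
    change _ = counit (R := k) (unitIncl k A (unitProj k A (a * unitIncl k A ((1 : k) • unitProj k A 1))))
    rw [one_smul, unitIncl_unitProj_one, mul_one, unitIncl_unitProj, counit_epsLR]

end Tautological

end
end FinRep

section Uniqueness

variable {k : Type u} [Field k] {C : Type w} [Category.{v} C] [MonoidalCategory C]
  {F : C ⥤ FGModuleCat.{u} k} [F.LaxMonoidal] [F.OplaxMonoidal]
  {A : Type w'} [Ring A] [Algebra k A] {B : Type v'} [Ring B] [Algebra k B]

lemma NatAction.app₂_map {ρ : NatAction k A F} {σ : NatAction k B F} (θ : A →ₗ[k] B)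
    (h : ∀ a X, σ.app (θ a) X = ρ.app a X) (t : A ⊗[k] A) (X Y : C) :
    σ.app₂ (TensorProduct.map θ θ t) X Y = ρ.app₂ t X Y := by
  induction t with
  | zero =>
    rw [map_zero]
    exact (FinRep.act₂_zero (σ.rep X) (σ.rep Y)).trans (FinRep.act₂_zero (ρ.rep X) (ρ.rep Y)).symm
  | tmul a b =>
    refine (FinRep.act₂_tmul (σ.rep X) (σ.rep Y) (θ a) (θ b)).trans
      (Eq.trans ?_ (FinRep.act₂_tmul (ρ.rep X) (ρ.rep Y) a b).symm)
    exact congrArg₂ (fun f g => f ⊗ₘ g) (h a X) (h b Y)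
  | add s t hs ht => rw [map_add, NatAction.app₂_add, NatAction.app₂_add, hs, ht]

/-- The algebra of all natural endomorphisms, with its reconstructed coalgebra structure, is unique
up to isomorphism. -/
theorem IsReconstructedCoalgebra.nonempty_bialgEquiv [CoalgebraStruct k A] [CoalgebraStruct k B]
    {ρ : NatAction k A F} {σ : NatAction k B F} (hρ : ρ.IsFull) (hσ : σ.IsFull)
    (h : IsReconstructedCoalgebra ρ) (h' : IsReconstructedCoalgebra σ) : Nonempty (A ≃ₐc[k] B) := by
  choose f hf using fun a => hσ.exists_app (fun X => ρ.app a X) (ρ.naturality a)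
  choose g hg using fun b => hρ.exists_app (fun X => σ.app b X) (σ.naturality b)
  let θ : A →ₗ[k] B :=
    { toFun := f
      map_add' := fun a b => hσ.ext fun X => by rw [hf, ρ.app_add, σ.app_add, hf, hf]
      map_smul' := fun c a => hσ.ext fun X => by rw [hf, ρ.app_smul, RingHom.id_apply, σ.app_smul, hf] }
  have counit_comp (a : A) : CoalgebraStruct.counit (R := k) (f a) = CoalgebraStruct.counit (R := k) a :=
    unit_smul_injective (by rw [h.counit, h'.counit, hf])
  have map_comul (a : A) : TensorProduct.map θ θ (CoalgebraStruct.comul (R := k) a) =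
      CoalgebraStruct.comul (R := k) (f a) := hσ.ext₂ fun X Y => by
    rw [NatAction.app₂_map θ hf, h.comul, h'.comul, hf]
  exact ⟨{
    toFun := f
    map_add' := θ.map_add
    map_smul' := θ.map_smul
    counit_comp := LinearMap.ext counit_comp
    map_comp_comul := LinearMap.ext map_comul
    invFun := g
    left_inv := fun a => hρ.ext fun X => by rw [hg, hf]
    right_inv := fun b => hσ.ext fun X => by rw [hf, hg]
    map_mul' := fun a b => hσ.ext fun X => by rw [hf, ρ.app_mul, σ.app_mul, hf, hf] }⟩

end Uniqueness

section SeparableFrobeniusIso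

open Functor.LaxMonoidal Functor.OplaxMonoidal

variable {C : Type w} [Category.{v} C] [MonoidalCategory C]
  {D : Type w'} [Category.{v'} D] [MonoidalCategory D]

namespace IsSeparableFrobeniusIso

variable {F G H : C ⥤ D} [F.LaxMonoidal] [F.OplaxMonoidal] [G.LaxMonoidal] [G.OplaxMonoidal]
  [H.LaxMonoidal] [H.OplaxMonoidal]

lemma symm {ξ : F ≅ G} (h : IsSeparableFrobeniusIso ξ) : IsSeparableFrobeniusIso ξ.symm where
  μ_comp X Y := by
    rw [← cancel_mono (ξ.hom.app (X ⊗ Y)), ← cancel_epi (ξ.hom.app X ⊗ₘ ξ.hom.app Y)]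
    simp [← h.μ_comp]
  ε_comp := by simp [← h.ε_comp]
  δ_comp X Y := by
    rw [← cancel_mono (ξ.hom.app X ⊗ₘ ξ.hom.app Y), ← cancel_epi (ξ.hom.app (X ⊗ Y))]
    simp [h.δ_comp]
  η_comp := by simp [← h.η_comp]

lemma trans {ξ : F ≅ G} {ζ : G ≅ H} (h : IsSeparableFrobeniusIso ξ) (h' : IsSeparableFrobeniusIso ζ) :
    IsSeparableFrobeniusIso (ξ ≪≫ ζ) where
  μ_comp X Y := by
    simp only [Iso.trans_hom, NatTrans.comp_app, ← tensorHom_comp_tensorHom, Category.assoc,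
      ← h'.μ_comp]
    rw [← Category.assoc, h.μ_comp, Category.assoc]
  ε_comp := by
    rw [Iso.trans_hom, NatTrans.comp_app, ← Category.assoc, h.ε_comp, h'.ε_comp]
  δ_comp X Y := by
    simp only [Iso.trans_hom, NatTrans.comp_app, ← tensorHom_comp_tensorHom, Category.assoc,
      ← h'.δ_comp]
    rw [← Category.assoc, h.δ_comp, Category.assoc]
  η_comp := by
    rw [Iso.trans_hom, NatTrans.comp_app, Category.assoc, h'.η_comp, h.η_comp]

/-- Between strong monoidal functors, compatibility with the lax structures suffices. -/
lemma of_isMonoidal {F G : C ⥤ D} [F.Monoidal] [G.Monoidal] (ξ : F ≅ G)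
    [h : NatTrans.IsMonoidal ξ.hom] : IsSeparableFrobeniusIso ξ where
  μ_comp X Y := h.tensor X Y
  ε_comp := h.unit
  δ_comp X Y := by
    rw [← cancel_epi (μ F X Y), Functor.Monoidal.μ_δ_assoc, ← Category.assoc, h.tensor,
      Category.assoc, Functor.Monoidal.μ_δ, Category.comp_id]
  η_comp := by
    rw [← cancel_epi (ε F), ← Category.assoc, h.unit, Functor.Monoidal.ε_η, Functor.Monoidal.ε_η]

variable {E : Type*} [Category* E] [MonoidalCategory E]

lemma whiskerLeft (Φ : E ⥤ C) [Φ.LaxMonoidal] [Φ.OplaxMonoidal] {ξ : F ≅ G}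
    (h : IsSeparableFrobeniusIso ξ) : IsSeparableFrobeniusIso (Functor.isoWhiskerLeft Φ ξ) where
  μ_comp X Y := by
    simp only [Functor.isoWhiskerLeft_hom, Functor.whiskerLeft_app, comp_μ, Category.assoc,
      NatTrans.naturality]
    rw [← Category.assoc, h.μ_comp, Category.assoc]
  ε_comp := by
    simp only [Functor.isoWhiskerLeft_hom, Functor.whiskerLeft_app, comp_ε, Category.assoc,
      NatTrans.naturality]
    rw [← Category.assoc, h.ε_comp]
  δ_comp X Y := by
    simp only [Functor.isoWhiskerLeft_hom, Functor.whiskerLeft_app, comp_δ, Category.assoc, h.δ_comp,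
      NatTrans.naturality_assoc]
  η_comp := by
    simp only [Functor.isoWhiskerLeft_hom, Functor.whiskerLeft_app, comp_η]
    rw [← NatTrans.naturality_assoc, h.η_comp]

lemma whiskerRight {ξ : F ≅ G} (h : IsSeparableFrobeniusIso ξ) (Φ : D ⥤ E) [Φ.LaxMonoidal]
    [Φ.OplaxMonoidal] : IsSeparableFrobeniusIso (Functor.isoWhiskerRight ξ Φ) where
  μ_comp X Y := by
    simp only [Functor.isoWhiskerRight_hom, Functor.whiskerRight_app, comp_μ, Category.assoc,
      ← Φ.map_comp, h.μ_comp]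
    rw [Φ.map_comp, μ_natural_assoc]
  ε_comp := by
    simp only [Functor.isoWhiskerRight_hom, Functor.whiskerRight_app, comp_ε, Category.assoc,
      ← Φ.map_comp, h.ε_comp]
  δ_comp X Y := by
    simp only [Functor.isoWhiskerRight_hom, Functor.whiskerRight_app, comp_δ, Category.assoc,
      δ_natural]
    rw [← Φ.map_comp_assoc, h.δ_comp, Φ.map_comp_assoc]
  η_comp := by
    simp only [Functor.isoWhiskerRight_hom, Functor.whiskerRight_app, comp_η]
    rw [← Φ.map_comp_assoc, h.η_comp]

lemma leftUnitor (F : C ⥤ D) [F.LaxMonoidal] [F.OplaxMonoidal] :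
    IsSeparableFrobeniusIso F.leftUnitor where
  μ_comp X Y := by simp
  ε_comp := by simp
  δ_comp X Y := by simp
  η_comp := by simp

lemma associator (Φ : E ⥤ C) [Φ.LaxMonoidal] [Φ.OplaxMonoidal] (Ψ : C ⥤ D) [Ψ.LaxMonoidal]
    [Ψ.OplaxMonoidal] {D' : Type*} [Category* D'] [MonoidalCategory D'] (G : D ⥤ D') [G.LaxMonoidal]
    [G.OplaxMonoidal] : IsSeparableFrobeniusIso (Functor.associator Φ Ψ G) where
  μ_comp X Y := by simp
  ε_comp := by simp
  δ_comp X Y := by simp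
  η_comp := by simp

end IsSeparableFrobeniusIso

end SeparableFrobeniusIso

section Equivalence

lemma exists_monoidal_inverse {C : Type w} [Category.{v} C] [MonoidalCategory C] {D : Type w'}
    [Category.{v'} D] [MonoidalCategory D] (e : C ≌ D) [e.functor.Monoidal] :
    ∃ _ : e.inverse.Monoidal, e.IsMonoidal := by
  refine ⟨e.inverseMonoidal, ?_⟩
  have h : letI := e.toAdjunction.rightAdjointLaxMonoidal
    e.toAdjunction.IsMonoidal := inferInstance
  exact h

variable {k : Type u} [Field k]

lemma WeakFiberFunctor.Equivalent.refl (P : WeakFiberFunctor.{u, v, w} k) : P.Equivalent P :=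
  ⟨𝟭 _, inferInstance, inferInstance, inferInstance, inferInstance, _,
    IsSeparableFrobeniusIso.leftUnitor P.F⟩

lemma WeakFiberFunctor.Equivalent.trans {P Q R : WeakFiberFunctor.{u, v, w} k} (h : P.Equivalent Q)
    (h' : Q.Equivalent R) : P.Equivalent R := by
  obtain ⟨Φ, _, _, _, _, ξ, hξ⟩ := h
  obtain ⟨Ψ, _, _, _, _, ζ, hζ⟩ := h'
  exact ⟨Φ ⋙ Ψ, inferInstance, inferInstance, inferInstance, inferInstance, _,
    ((IsSeparableFrobeniusIso.associator Φ Ψ R.F).trans (hζ.whiskerLeft Φ)).trans hξ⟩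

lemma WeakFiberFunctor.Equivalent.symm {P Q : WeakFiberFunctor.{u, v, w} k} (h : P.Equivalent Q) :
    Q.Equivalent P := by
  obtain ⟨Φ, _, _, _, _, ξ, hξ⟩ := h
  let e := Φ.asEquivalence
  have : e.functor.Additive := ‹Φ.Additive›
  have : e.functor.Linear k := ‹Φ.Linear k›
  let _ : e.functor.Monoidal := ‹Φ.Monoidal›
  obtain ⟨_, _⟩ := exists_monoidal_inverse e
  have h1 : IsSeparableFrobeniusIso e.counitIso := by
    have : NatTrans.IsMonoidal e.counitIso.hom := inferInstanceAs (NatTrans.IsMonoidal e.counit)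
    exact .of_isMonoidal _
  exact ⟨e.inverse, inferInstance, inferInstance, inferInstance, inferInstance, _,
    ((hξ.symm.whiskerLeft e.inverse).trans
      (IsSeparableFrobeniusIso.associator e.inverse e.functor Q.F).symm).trans
        ((h1.whiskerRight Q.F).trans (IsSeparableFrobeniusIso.leftUnitor Q.F))⟩

lemma FinWeakHopfAlgebra.Isomorphic.equivalence :
    Equivalence (FinWeakHopfAlgebra.Isomorphic.{u, w} (k := k)) :=
  ⟨fun A => ⟨BialgEquiv.refl k A.carrier⟩, fun ⟨e⟩ => ⟨e.symm⟩, fun ⟨e⟩ ⟨f⟩ => ⟨e.trans f⟩⟩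

lemma WeakFiberFunctor.Equivalent.equivalence :
    Equivalence (WeakFiberFunctor.Equivalent.{u, v, w} (k := k)) :=
  ⟨.refl, .symm, .trans⟩

end Equivalence

section Transport

variable {k : Type u} [Field k] {C : Type w} [Category.{v} C] {D : Type w'} [Category.{v'} D]
  {F : C ⥤ FGModuleCat.{u} k} {G : D ⥤ FGModuleCat.{u} k} {Φ : C ⥤ D}

lemma Represents.of_isEquivalence [Φ.IsEquivalence] (ξ : Φ ⋙ G ≅ F) {P : C} {p : F.obj P}
    (hP : Represents F P p) : Represents G (Φ.obj P) ((ξ.inv.app P).hom.hom p) := by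
  have bij (X : C) : Function.Bijective (ξ.inv.app X).hom.hom := by
    refine Function.bijective_iff_has_inverse.2 ⟨(ξ.hom.app X).hom.hom, fun x => ?_, fun x => ?_⟩
    · exact congrArg (fun f : F.obj X ⟶ F.obj X => f.hom.hom x) (ξ.inv_hom_id_app X)
    · exact congrArg (fun f : (Φ ⋙ G).obj X ⟶ (Φ ⋙ G).obj X => f.hom.hom x) (ξ.hom_inv_id_app X)
  have key {X : C} (g : P ⟶ X) : fmap G (Φ.map g) ((ξ.inv.app P).hom.hom p) =
      (ξ.inv.app X).hom.hom (fmap F g p) :=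
    congrArg (fun f : F.obj P ⟶ (Φ ⋙ G).obj X => f.hom.hom p) (ξ.inv.naturality g).symm
  intro Y
  let i := Φ.objObjPreimageIso Y
  have inv (y) : fmap G i.inv (fmap G i.hom y) = y := by
    rw [← fmap_comp, i.hom_inv_id, fmap_id]
  have inv' (y) : fmap G i.hom (fmap G i.inv y) = y := by
    rw [← fmap_comp, i.inv_hom_id, fmap_id]
  constructor
  · intro f f' h
    obtain ⟨g, hg⟩ := Φ.map_surjective (f ≫ i.inv)
    obtain ⟨g', hg'⟩ := Φ.map_surjective (f' ≫ i.inv)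
    have h1 : g = g' := (hP _).1 ((bij _).1 (by
      simp only [← key, hg, hg', fmap_comp]
      exact congrArg (fmap G i.inv) h))
    rw [← cancel_mono i.inv, ← hg, ← hg', h1]
  · intro y
    obtain ⟨x, hx⟩ := (bij _).2 (fmap G i.inv y)
    obtain ⟨g, rfl⟩ := hP.exists_eq x
    refine ⟨Φ.map g ≫ i.hom, ?_⟩
    simp only [fmap_comp, key, hx, inv']

namespace NatAction

variable {A : Type*} [Ring A] [Algebra k A]

/-- The action on `F` induced from an action on `G` by an isomorphism `Φ ⋙ G ≅ F`. -/
def transport (σ : NatAction k A G) (ξ : Φ ⋙ G ≅ F) : NatAction k A F where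
  ρ X := AlgHom.ofLinearMap
    { toFun := fun a => ξ.inv.app X ≫ σ.app a (Φ.obj X) ≫ ξ.hom.app X
      map_add' := fun a b => by
        rw [σ.app_add, Preadditive.add_comp, Preadditive.comp_add]
      map_smul' := fun c a => by
        rw [σ.app_smul, Linear.smul_comp, Linear.comp_smul]
        rfl }
    (by
      change ξ.inv.app X ≫ σ.app 1 (Φ.obj X) ≫ ξ.hom.app X = 𝟙 _
      rw [σ.app_one]
      exact (congrArg (ξ.inv.app X ≫ ·) (Category.id_comp (ξ.hom.app X))).trans (ξ.inv_hom_id_app X))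
    (fun a b => by
      change ξ.inv.app X ≫ σ.app (a * b) (Φ.obj X) ≫ ξ.hom.app X =
        (ξ.inv.app X ≫ σ.app b (Φ.obj X) ≫ ξ.hom.app X) ≫
          ξ.inv.app X ≫ σ.app a (Φ.obj X) ≫ ξ.hom.app X
      rw [σ.app_mul]
      simp)
  naturality' {X Y} f a := by
    change F.map f ≫ ξ.inv.app Y ≫ σ.app a (Φ.obj Y) ≫ ξ.hom.app Y =
      (ξ.inv.app X ≫ σ.app a (Φ.obj X) ≫ ξ.hom.app X) ≫ F.map f
    simp only [Category.assoc, ← ξ.hom.naturality]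
    rw [ξ.inv.naturality_assoc]
    exact congrArg (ξ.inv.app X ≫ ·) (σ.naturality_assoc a (Φ.map f) (ξ.hom.app Y))

lemma transport_app (σ : NatAction k A G) (ξ : Φ ⋙ G ≅ F) (a : A) (X : C) :
    (σ.transport ξ).app a X = ξ.inv.app X ≫ σ.app a (Φ.obj X) ≫ ξ.hom.app X := rfl

lemma transport_app₂ (σ : NatAction k A G) (ξ : Φ ⋙ G ≅ F) (t : A ⊗[k] A) (X Y : C) :
    (σ.transport ξ).app₂ t X Y = (ξ.inv.app X ⊗ₘ ξ.inv.app Y) ≫ σ.app₂ t (Φ.obj X) (Φ.obj Y) ≫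
      (ξ.hom.app X ⊗ₘ ξ.hom.app Y) := by
  induction t with
  | zero =>
    refine (FinRep.act₂_zero ((σ.transport ξ).rep X) ((σ.transport ξ).rep Y)).trans ?_
    have h : σ.app₂ 0 (Φ.obj X) (Φ.obj Y) = 0 := FinRep.act₂_zero _ _
    rw [h, Limits.zero_comp, Limits.comp_zero]
  | tmul a b =>
    refine (FinRep.act₂_tmul ((σ.transport ξ).rep X) ((σ.transport ξ).rep Y) a b).trans ?_
    have h : σ.app₂ (a ⊗ₜ b) (Φ.obj X) (Φ.obj Y) = σ.app a _ ⊗ₘ σ.app b _ := FinRep.act₂_tmul _ _ _ _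
    rw [h]
    change ((ξ.inv.app X ≫ σ.app a (Φ.obj X) ≫ ξ.hom.app X) ⊗ₘ
      (ξ.inv.app Y ≫ σ.app b (Φ.obj Y) ≫ ξ.hom.app Y)) = _
    rw [← tensorHom_comp_tensorHom, ← tensorHom_comp_tensorHom]
  | add s t hs ht =>
    rw [app₂_add, app₂_add, hs, ht, Preadditive.add_comp, Preadditive.comp_add]

lemma isReconstructedCoalgebra_transport [MonoidalCategory C] [MonoidalCategory D] [Φ.Monoidal]
    [F.LaxMonoidal] [F.OplaxMonoidal] [G.LaxMonoidal] [G.OplaxMonoidal] [CoalgebraStruct k A]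
    {σ : NatAction k A G} (h : IsReconstructedCoalgebra σ) {ξ : Φ ⋙ G ≅ F}
    (hξ : IsSeparableFrobeniusIso ξ) : IsReconstructedCoalgebra (σ.transport ξ) where
  comul a X Y := by
    have h1 := hξ.symm.μ_comp X Y
    have h2 := hξ.δ_comp X Y
    rw [Functor.LaxMonoidal.comp_μ] at h1
    rw [Functor.OplaxMonoidal.comp_δ] at h2
    rw [transport_app₂, transport_app, h.comul]
    have h3 : G.map (Functor.LaxMonoidal.μ Φ X Y) ≫ σ.app a (Φ.obj (X ⊗ Y)) ≫
        G.map (Functor.OplaxMonoidal.δ Φ X Y) = σ.app a _ := by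
      rw [σ.naturality_assoc, ← G.map_comp, Functor.Monoidal.μ_δ, G.map_id, Category.comp_id]
    rw [← h3]
    simp only [Category.assoc, Iso.symm_hom] at h1 h2 ⊢
    rw [h2, ← reassoc_of% h1]
  counit a := by
    have h1 := hξ.symm.ε_comp
    have h2 := hξ.η_comp
    rw [Functor.LaxMonoidal.comp_ε] at h1
    rw [Functor.OplaxMonoidal.comp_η] at h2
    rw [transport_app, h.counit]
    have h3 : G.map (Functor.LaxMonoidal.ε Φ) ≫ σ.app a (Φ.obj (𝟙_ C)) ≫
        G.map (Functor.OplaxMonoidal.η Φ) = σ.app a _ := by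
      rw [σ.naturality_assoc, ← G.map_comp, Functor.Monoidal.ε_η, G.map_id, Category.comp_id]
    rw [← h3]
    simp only [Category.assoc, Iso.symm_hom] at h1 h2 ⊢
    rw [h2, reassoc_of% h1]

end NatAction

end Transport

section Restriction

open CoalgebraStruct

variable {k : Type u} [Field k] {A : Type w} [Ring A] [Algebra k A] [Module.Finite k A]
  {B : Type w'} [Ring B] [Algebra k B] [Module.Finite k B]

/-- The action of `B` on the forgetful functor of `Rep(A)` by restriction along `B → A`. -/
def NatAction.restrict (f : B →ₐ[k] A) : NatAction k B (FinRep.forget k A) where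
  ρ X := X.ρ.comp f
  naturality' g b := (g.comm (f b)).symm

lemma NatAction.isFull_restrict (f : B ≃ₐ[k] A) : (NatAction.restrict f.toAlgHom).IsFull := by
  have : Small.{u} A := Module.Finite.small k A
  refine (FinRep.represents_regular k A).isFull
    (f.toLinearEquiv ≪≫ₗ (Shrink.linearEquiv.{u} k A).symm) fun b => ?_
  change (Shrink.linearEquiv.{u} k A).symm
    (f b * Shrink.linearEquiv.{u} k A ((Shrink.linearEquiv.{u} k A).symm 1)) = _
  rw [LinearEquiv.apply_symm_apply, mul_one]
  rfl

lemma NatAction.isReconstructedCoalgebra_restrict [WeakBialgebra k A] [WeakBialgebra k B]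
    (f : B ≃ₐc[k] A) : IsReconstructedCoalgebra (NatAction.restrict f.toAlgEquiv.toAlgHom) where
  comul b X Y := by
    rw [← NatAction.app₂_map (σ := FinRep.forgetAction k A) f.toCoalgEquiv.toLinearMap (fun _ _ => rfl)]
    have h : TensorProduct.map f.toCoalgEquiv.toLinearMap f.toCoalgEquiv.toLinearMap (comul b) =
      comul (R := k) (f b) := CoalgHomClass.map_comp_comul_apply f b
    rw [h]
    exact (FinRep.isReconstructedCoalgebra_forgetAction k A).comul (f b) X Y
  counit b := by
    rw [← CoalgHomClass.counit_comp_apply f b]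
    exact (FinRep.isReconstructedCoalgebra_forgetAction k A).counit (f b)

end Restriction

section Correspondence

variable {k : Type u} [Field k]

/-- The natural endomorphisms of a weak fiber functor form a weak Hopf algebra, and the comparison
functor is a monoidal equivalence. -/
lemma WeakFiberFunctor.exists_weakHopfAlgebra (P : WeakFiberFunctor.{u, v, w} k) :
    ∃ (_ : Module.Finite k (End P.F)) (W : WeakHopfAlgebra k (End P.F)),
      IsReconstructed P.F W ∧ (∀ W', IsReconstructed P.F W' → W' = W) ∧ IsMonoidalComparison P.F := by
  obtain ⟨_, _, _, _, _, hF⟩ := P.isWeakFiberFunctor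
  obtain ⟨_, _, _, hρ, hE, _⟩ := P.isFiniteMultiTensorCategory.finite.exists_represents (F := P.F)
  obtain ⟨_⟩ := P.isFiniteMultiTensorCategory.rigid
  obtain ⟨W, hW⟩ := exists_isReconstructed hρ hF
  exact ⟨inferInstance, W, hW, fun W' hW' => hW'.unique hρ hW, hW.isMonoidalComparison hρ hF hE⟩

/-- Evaluation at a representing element identifies `End F` with the value of `F`. -/
lemma IsFiniteLinearCategory.exists_endEquiv {C : Type w} [Category.{v} C] [Preadditive C]
    [CategoryTheory.Linear k C] (hC : IsFiniteLinearCategory k C) {F : C ⥤ FGModuleCat.{u} k}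
    [F.Additive] [F.Linear k] {X : C} {x : F.obj X} (hX : Represents F X x) :
    ∃ e : End F ≃ₗ[k] F.obj X, ∀ α, e α = (endApp α X).hom.hom x := by
  obtain ⟨B, _, _, _, E, _, _, _⟩ := hC
  have : Limits.HasFiniteBiproducts C := by
    have := Limits.hasFiniteProducts_of_hasFiniteLimits (FinRep k B)
    have : Limits.HasFiniteProducts C :=
      ⟨fun n => Adjunction.hasLimitsOfShape_of_equivalence E⟩
    exact Limits.HasFiniteBiproducts.of_hasFiniteProducts
  let _ : Abelian C := abelianOfEquivalence E
  exact ⟨hX.endEquiv, fun _ => rfl⟩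

/-- Equivalent weak fiber functors have isomorphic weak Hopf algebras of natural endomorphisms. -/
lemma WeakFiberFunctor.Equivalent.nonempty_bialgEquiv {P Q : WeakFiberFunctor.{u, v, w} k}
    (h : P.Equivalent Q) {V : WeakHopfAlgebra k (End P.F)} {W : WeakHopfAlgebra k (End Q.F)}
    (hV : IsReconstructed P.F V) (hW : IsReconstructed Q.F W) :
    Nonempty (End P.F ≃ₐc[k] End Q.F) := by
  obtain ⟨_, _, _, _, _, _⟩ := P.isWeakFiberFunctor
  obtain ⟨_, _, _, _, _, _⟩ := Q.isWeakFiberFunctor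
  obtain ⟨X, x, hX, hρ, _, _⟩ := P.isFiniteMultiTensorCategory.finite.exists_represents (F := P.F)
  obtain ⟨Φ, _, _, _, _, ξ, hξ⟩ := h
  have hY := hX.of_isEquivalence ξ
  obtain ⟨e, he⟩ := Q.isFiniteMultiTensorCategory.finite.exists_endEquiv hY
  have hσ : ((evalAction Q.F).transport ξ).IsFull :=
    hX.isFull (e ≪≫ₗ LinearEquiv.ofLinearMap (ξ.hom.app X).hom.hom (ξ.inv.app X).hom.hom
      (congrArg (fun f : P.F.obj X ⟶ P.F.obj X => f.hom.hom) (ξ.inv_hom_id_app X))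
      (congrArg (fun f : (Φ ⋙ Q.F).obj X ⟶ (Φ ⋙ Q.F).obj X => f.hom.hom) (ξ.hom_inv_id_app X)))
      fun α => by
        exact congrArg (ξ.hom.app X).hom.hom (he α).symm
  exact hV.isReconstructedCoalgebra.nonempty_bialgEquiv hρ hσ
    (NatAction.isReconstructedCoalgebra_transport hW.isReconstructedCoalgebra hξ)

/-- A weak Hopf algebra is isomorphic to the algebra of natural endomorphisms of its forgetful
functor. -/
lemma WeakHopfAlgebra.nonempty_bialgEquiv_end_forget {A : Type w} [Ring A] [Algebra k A]
    [Module.Finite k A] [WeakHopfAlgebra k A] {W : WeakHopfAlgebra k (End (FinRep.forget k A))}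
    (hW : IsReconstructed (FinRep.forget k A) W) : Nonempty (A ≃ₐc[k] End (FinRep.forget k A)) := by
  obtain ⟨_, _, _, hρ, _, _⟩ :=
    (FinRep.isFiniteLinearCategory k A).exists_represents (F := FinRep.forget k A)
  exact (FinRep.isReconstructedCoalgebra_forgetAction k A).nonempty_bialgEquiv
    (FinRep.isFull_forgetAction k A) hρ hW.isReconstructedCoalgebra

variable [IsAlgClosed k]

/-- The identity is an isomorphism of separable Frobenius functors when the structure maps agree. -/
lemma isSeparableFrobeniusIso_refl {C : Type w} [Category.{v} C] [MonoidalCategory C]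
    {D : Type w'} [Category.{v'} D] [MonoidalCategory D] (F : C ⥤ D)
    {l l' : F.LaxMonoidal} {o o' : F.OplaxMonoidal}
    (hε : l.ε = l'.ε) (hμ : ∀ X Y, l.μ X Y = l'.μ X Y)
    (hη : o.η = o'.η) (hδ : ∀ X Y, o.δ X Y = o'.δ X Y) :
    @IsSeparableFrobeniusIso _ _ _ _ _ _ F F l o l' o' (Iso.refl F) :=
  @IsSeparableFrobeniusIso.mk _ _ _ _ _ _ F F l o l' o' (Iso.refl F)
    (fun X Y => by
      refine (Category.comp_id _).trans ((hμ X Y).trans ?_)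
      refine ((congrArg (· ≫ l'.μ X Y) (id_tensorHom_id _ _)).trans (Category.id_comp _)).symm)
    ((Category.comp_id _).trans hε)
    (fun X Y => by
      refine (congrArg (o.δ X Y ≫ ·) (id_tensorHom_id _ _)).trans ?_
      exact (Category.comp_id _).trans ((hδ X Y).trans (Category.id_comp _).symm))
    ((Category.id_comp _).trans hη.symm)

/-- The weak fiber functor of representations of a weak Hopf algebra. -/
noncomputable def FinWeakHopfAlgebra.rep (A : FinWeakHopfAlgebra.{u, u + 1} k) : WeakFiberFunctor.{u, u, u + 1} k :=
  WeakFiberFunctor.of (FinRep k A.carrier) (FinRep.forget k A.carrier)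
    (FinRep.isFiniteMultiTensorCategory k A.carrier) (FinRep.isWeakFiberFunctor_forget k A.carrier)

lemma FinWeakHopfAlgebra.Isomorphic.rep_equivalent {A B : FinWeakHopfAlgebra.{u, u + 1} k}
    (h : A.Isomorphic B) : A.rep.Equivalent B.rep := by
  obtain ⟨f⟩ := h
  let g : B.carrier ≃ₐc[k] A.carrier := f.symm
  have h := NatAction.isReconstructedCoalgebra_restrict g
  obtain ⟨hM, h1, h2, h3, h4⟩ := h.exists_monoidal (NatAction.isFull_restrict g.toAlgEquiv)
    (FinRep.isSeparableFrobenius_forget k A.carrier)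
  refine ⟨(NatAction.restrict g.toAlgEquiv.toAlgHom).toRep, hM,
    inferInstanceAs (FinRep.restrict g.toAlgEquiv.toAlgHom).IsEquivalence,
    inferInstanceAs (FinRep.restrict g.toAlgEquiv.toAlgHom).Additive,
    inferInstanceAs ((FinRep.restrict g.toAlgEquiv.toAlgHom).Linear k), Iso.refl _, ?_⟩
  exact isSeparableFrobeniusIso_refl _ h1 h2 h3 h4

lemma WeakFiberFunctor.equivalent_rep_of_isMonoidalComparison (P : WeakFiberFunctor.{u, u, u + 1} k)
    [Module.Finite k (End P.F)] [WeakHopfAlgebra k (End P.F)] (h : IsMonoidalComparison P.F) :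
    P.Equivalent (FinWeakHopfAlgebra.of (End P.F)).rep := by
  obtain ⟨hE, hA, hL, hM, h1, h2, h3, h4⟩ := h
  refine ⟨comparison P.F, hM, hE, hA, hL, Iso.refl _, ?_⟩
  exact isSeparableFrobeniusIso_refl _ h1 h2 h3 h4

end Correspondence

theorem theorem1p19 (k : Type u) [Field k] [IsAlgClosed k] [CharZero k] :
    -- reconstruction of the weak Hopf algebra and of the category from a weak fiber functor
    (∀ P : WeakFiberFunctor.{u, v, w} k,
      ∃ (_ : Module.Finite k (End P.F)) (W : WeakHopfAlgebra k (End P.F)),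
        IsReconstructed P.F W ∧ (∀ W', IsReconstructed P.F W' → W' = W) ∧
          IsMonoidalComparison P.F) ∧
    -- reconstruction of a weak Hopf algebra from its forgetful functor
    (∀ A : FinWeakHopfAlgebra.{u, w'} k,
      IsFiniteMultiTensorCategory k (FinRep k A.carrier) ∧
      IsWeakFiberFunctor k (FinRep.forget k A.carrier) ∧
      ∃ W : WeakHopfAlgebra k (End (FinRep.forget k A.carrier)),
        IsReconstructed (FinRep.forget k A.carrier) W ∧
          Nonempty (A.carrier ≃ₐc[k] End (FinRep.forget k A.carrier))) ∧
    -- the bijection between isomorphism classes and equivalence classes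
    Equivalence (FinWeakHopfAlgebra.Isomorphic.{u, u + 1} (k := k)) ∧
    Equivalence (WeakFiberFunctor.Equivalent.{u, u, u + 1} (k := k)) ∧
    ∃ (rep : FinWeakHopfAlgebra.{u, u + 1} k → WeakFiberFunctor.{u, u, u + 1} k)
      (recon : WeakFiberFunctor.{u, u, u + 1} k → FinWeakHopfAlgebra.{u, u + 1} k),
      (∀ A, ∃ h₁ h₂,
        rep A = WeakFiberFunctor.of (FinRep k A.carrier) (FinRep.forget k A.carrier) h₁ h₂) ∧
      (∀ P, ∃ (_ : Module.Finite k (End P.F)) (W : WeakHopfAlgebra k (End P.F)),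
        IsReconstructed P.F W ∧ recon P = FinWeakHopfAlgebra.of (End P.F)) ∧
      (∀ A B, A.Isomorphic B → (rep A).Equivalent (rep B)) ∧
      (∀ P Q, P.Equivalent Q → (recon P).Isomorphic (recon Q)) ∧
      ∃ e : Quot (FinWeakHopfAlgebra.Isomorphic.{u, u + 1} (k := k)) ≃
          Quot (WeakFiberFunctor.Equivalent.{u, u, u + 1} (k := k)),
        (∀ A, e (Quot.mk _ A) = Quot.mk _ (rep A)) ∧
        (∀ P, e.symm (Quot.mk _ P) = Quot.mk _ (recon P)) := by
  refine ⟨fun P => P.exists_weakHopfAlgebra, fun A => ?_,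
    FinWeakHopfAlgebra.Isomorphic.equivalence, WeakFiberFunctor.Equivalent.equivalence, ?_⟩
  · have h₁ := FinRep.isFiniteMultiTensorCategory k A.carrier
    have h₂ := FinRep.isWeakFiberFunctor_forget k A.carrier
    obtain ⟨_, W, hW, _⟩ :=
      (WeakFiberFunctor.of (FinRep k A.carrier) (FinRep.forget k A.carrier) h₁ h₂).exists_weakHopfAlgebra
    exact ⟨h₁, h₂, W, hW, WeakHopfAlgebra.nonempty_bialgEquiv_end_forget hW⟩
  · choose fin W hW _ hcomp using WeakFiberFunctor.exists_weakHopfAlgebra.{u, u, u + 1} (k := k)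
    let recon (P : WeakFiberFunctor.{u, u, u + 1} k) : FinWeakHopfAlgebra.{u, u + 1} k :=
      @FinWeakHopfAlgebra.of k _ (End P.F) _ _ (fin P) (W P)
    have rep_congr (A B : FinWeakHopfAlgebra.{u, u + 1} k) (h : A.Isomorphic B) :
        A.rep.Equivalent B.rep := h.rep_equivalent
    have recon_congr (P Q : WeakFiberFunctor.{u, u, u + 1} k) (h : P.Equivalent Q) :
        (recon P).Isomorphic (recon Q) := h.nonempty_bialgEquiv (hW P) (hW Q)
    have rep_recon (P : WeakFiberFunctor.{u, u, u + 1} k) : P.Equivalent (recon P).rep :=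
      @WeakFiberFunctor.equivalent_rep_of_isMonoidalComparison k _ _ P (fin P) (W P) (hcomp P)
    have recon_rep (A : FinWeakHopfAlgebra.{u, u + 1} k) : A.Isomorphic (recon A.rep) :=
      WeakHopfAlgebra.nonempty_bialgEquiv_end_forget (hW A.rep)
    refine ⟨FinWeakHopfAlgebra.rep, recon, fun A => ⟨_, _, rfl⟩, fun P => ⟨fin P, W P, hW P, rfl⟩,
      rep_congr, recon_congr, ⟨Quot.map _ rep_congr, Quot.map _ recon_congr, ?_, ?_⟩,
      fun A => rfl, fun P => rfl⟩
    · rintro ⟨A⟩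
      exact (Quot.sound (recon_rep A)).symm
    · rintro ⟨P⟩
      exact (Quot.sound (rep_recon P)).symm
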